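/- Let $\zeta(s)$ denote the Riemann zeta-function, and for $T\ge 3$ put \[ I(T)=\int_{-T}^{T}\frac{\log|\zeta(\tfrac12+it)|}{\tfrac14+t^2}\,dt , \] where the integral converges absolutely. Then, unconditionally and uniformly for $T\ge 3$, \[ I(T)=2\pi\sum_{\substack{-T\le\gamma\le T\\ \beta>1/2}}\log\left|\frac{\rho}{1-\rho}\right|+O\!\left(\frac{1}{T^2}\log T\right), \] where the sum runs over the nontrivial zeros $\rho=\beta+i\gamma$ of $\zeta(s)$ (the zeros with $0<\beta<1$) satisfying $\beta>1/2$ and $-T\le\gamma\le T$, each counted with its multiplicity, and the implied constant is absolute. -/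

import Mathlib

namespace BalazardSaiasYor

/-- The nontrivial zeros of the Riemann zeta-function: its zeros in the open critical strip. -/
def nontrivialZeros : Set ℂ :=
  {ρ | riemannZeta ρ = 0 ∧ 0 < ρ.re ∧ ρ.re < 1}

/-- The nontrivial zeros `ρ = β + iγ` with `-T ≤ γ ≤ T` and `β > 1/2`. -/
def zerosRightOfLine (T : ℝ) : Set ℂ :=
  {ρ | ρ ∈ nontrivialZeros ∧ (-T ≤ ρ.im ∧ ρ.im ≤ T) ∧ 1 / 2 < ρ.re}

theorem zerosRightOfLine_finite (T : ℝ) : (zerosRightOfLine T).Finite := by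
  have hK : IsCompact (Set.Icc (0 : ℝ) 1 ×ℂ Set.Icc (-T) T) :=
    isCompact_Icc.reProdIm isCompact_Icc
  refine hK.inter_riemannZetaZeros_finite.subset ?_
  rintro ρ ⟨⟨h0, h1, h2⟩, h3, -⟩
  exact ⟨⟨⟨h1.le, h2.le⟩, h3⟩, h0⟩

/-- The integrand `log |ζ(1/2 + it)| / (1/4 + t ^ 2)`. -/
noncomputable def integrand (t : ℝ) : ℝ :=
  Real.log ‖riemannZeta (1 / 2 + (t : ℂ) * Complex.I)‖ / (1 / 4 + t ^ 2)

/-- The truncated integral `I(T)`. -/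
noncomputable def truncatedIntegral (T : ℝ) : ℝ :=
  ∫ t in (-T)..T, integrand t

/-- The sum of `log |ρ / (1 - ρ)|` over the nontrivial zeros `ρ = β + iγ` with `-T ≤ γ ≤ T` and
`β > 1/2`, each zero being counted with its multiplicity. -/
noncomputable def zeroSum (T : ℝ) : ℝ :=
  ∑ ρ ∈ (zerosRightOfLine_finite T).toFinset,
    (analyticOrderNatAt riemannZeta ρ : ℝ) * Real.log ‖ρ / (1 - ρ)‖

end BalazardSaiasYor

open Set MeasureTheory Filter Topology

namespace BalazardSaiasYor

/-! Put f(s) = ((s-1)/s) ζ(s). It is holomorphic for Re s > 0, has |f| = |ζ| on the critical line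
and f(1) = 1, and vanishes exactly at the nontrivial zeros. Let g(s) = log|s/(s-1)| be Green's
function of the half-plane Re s > 1/2 with pole 1. It vanishes on the critical line, where its
x-derivative is 1/(1/4 + y²). Pairing log|f| with g in Green's identity therefore gives the integral
I(T) on the boundary, 2π Σ log|ρ/(1-ρ)| from the zeros, and a multiple of log|f(1)| = 0 from the
pole.

To truncate at height T, g is multiplied by smooth cutoffs in y (`cut`) and in x (`cutR`). Since f
has logarithmic poles and g has one too, the identity is first proved for C² functions on a
rectangle (`green_rect`), then for log|s - q| by regularization (`greenFor_logDist`), then for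
log|f| by factoring out zeros (`greenFor_log_norm`); `logZB_identity` removes the smoothing of g.

The error lives where the cutoffs vary. In the strips T ≤ |y| ≤ T+1 the weight is O(x/T²), while
log|f| decays only like 1/x, so a direct bound diverges as the right edge moves off. But g times the
strip weight is an exact y-derivative and integrates to zero (`setIntegral_gr_mul_stripW`), so
log|f| may be replaced by log|f| + g, which is log|ζ| and decays fast for Re s ≥ 2. Near the line an
L¹ bound O(log T) for log|f| suffices (`exists_setIntegral_abs_log_zetaBlaschke_le`): it follows
from |f| ≤ T⁶ and one Jensen-type inequality on a disc. The right end contributes O(T/X), which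
tends to 0.

Finally the sharp cutoff is sandwiched between smooth ones at heights T-1 and T+1. The zero terms
are nonnegative, hence monotone in the cutoff, and log|ζ| has a pointwise upper bound; together they
control the L¹ norm of the integrand near ±T without any pointwise lower bound
(`exists_bound_truncatedIntegral_sub`). -/

/-- `u` has the partial derivatives `ux`, …, `uyy` on `R`, and all of them are continuous there. -/
structure C2On (R : Set (ℝ × ℝ)) (u ux uy uxx uyy : ℝ × ℝ → ℝ) : Prop where
  dx : ∀ p ∈ R, HasDerivAt (fun x => u (x, p.2)) (ux p) p.1
  dy : ∀ p ∈ R, HasDerivAt (fun y => u (p.1, y)) (uy p) p.2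
  dxx : ∀ p ∈ R, HasDerivAt (fun x => ux (x, p.2)) (uxx p) p.1
  dyy : ∀ p ∈ R, HasDerivAt (fun y => uy (p.1, y)) (uyy p) p.2
  cont : ContinuousOn u R
  contx : ContinuousOn ux R
  conty : ContinuousOn uy R
  contxx : ContinuousOn uxx R
  contyy : ContinuousOn uyy R

/-- A `C²` function on a rectangle that vanishes on the left side and vanishes with its normal
derivative on the other three sides. -/
structure TestOn (a b c d : ℝ) (φ φx φy φxx φyy : ℝ × ℝ → ℝ) : Prop extends
    C2On (Icc a b ×ˢ Icc c d) φ φx φy φxx φyy where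
  left : ∀ y ∈ Icc c d, φ (a, y) = 0
  right : ∀ y ∈ Icc c d, φ (b, y) = 0
  right' : ∀ y ∈ Icc c d, φx (b, y) = 0
  bot : ∀ x ∈ Icc a b, φ (x, c) = 0
  bot' : ∀ x ∈ Icc a b, φy (x, c) = 0
  top : ∀ x ∈ Icc a b, φ (x, d) = 0
  top' : ∀ x ∈ Icc a b, φy (x, d) = 0

/-! ### Calculus of C² functions and Green's identity on a rectangle -/

theorem C2On.mul {R : Set (ℝ × ℝ)} {u ux uy uxx uyy v vx vy vxx vyy : ℝ × ℝ → ℝ}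
    (hu : C2On R u ux uy uxx uyy) (hv : C2On R v vx vy vxx vyy) :
    C2On R (fun p => u p * v p) (fun p => ux p * v p + u p * vx p)
      (fun p => uy p * v p + u p * vy p)
      (fun p => uxx p * v p + ux p * vx p + (ux p * vx p + u p * vxx p))
      (fun p => uyy p * v p + uy p * vy p + (uy p * vy p + u p * vyy p)) where
  dx p hp := (hu.dx p hp).mul (hv.dx p hp)
  dy p hp := (hu.dy p hp).mul (hv.dy p hp)
  dxx p hp := ((hu.dxx p hp).mul (hv.dx p hp)).add ((hu.dx p hp).mul (hv.dxx p hp))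
  dyy p hp := ((hu.dyy p hp).mul (hv.dy p hp)).add ((hu.dy p hp).mul (hv.dyy p hp))
  cont := hu.cont.mul hv.cont
  contx := (hu.contx.mul hv.cont).add (hu.cont.mul hv.contx)
  conty := (hu.conty.mul hv.cont).add (hu.cont.mul hv.conty)
  contxx := ((hu.contxx.mul hv.cont).add (hu.contx.mul hv.contx)).add
    ((hu.contx.mul hv.contx).add (hu.cont.mul hv.contxx))
  contyy := ((hu.contyy.mul hv.cont).add (hu.conty.mul hv.conty)).add
    ((hu.conty.mul hv.conty).add (hu.cont.mul hv.contyy))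

theorem C2On.sub {R : Set (ℝ × ℝ)} {u ux uy uxx uyy v vx vy vxx vyy : ℝ × ℝ → ℝ}
    (hu : C2On R u ux uy uxx uyy) (hv : C2On R v vx vy vxx vyy) :
    C2On R (fun p => u p - v p) (fun p => ux p - vx p) (fun p => uy p - vy p)
      (fun p => uxx p - vxx p) (fun p => uyy p - vyy p) where
  dx p hp := (hu.dx p hp).sub (hv.dx p hp)
  dy p hp := (hu.dy p hp).sub (hv.dy p hp)
  dxx p hp := (hu.dxx p hp).sub (hv.dxx p hp)
  dyy p hp := (hu.dyy p hp).sub (hv.dyy p hp)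
  cont := hu.cont.sub hv.cont
  contx := hu.contx.sub hv.contx
  conty := hu.conty.sub hv.conty
  contxx := hu.contxx.sub hv.contxx
  contyy := hu.contyy.sub hv.contyy

theorem C2On.mono {R S : Set (ℝ × ℝ)} {u ux uy uxx uyy : ℝ × ℝ → ℝ}
    (hu : C2On R u ux uy uxx uyy) (h : S ⊆ R) : C2On S u ux uy uxx uyy where
  dx p hp := hu.dx p (h hp)
  dy p hp := hu.dy p (h hp)
  dxx p hp := hu.dxx p (h hp)
  dyy p hp := hu.dyy p (h hp)
  cont := hu.cont.mono h
  contx := hu.contx.mono h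
  conty := hu.conty.mono h
  contxx := hu.contxx.mono h
  contyy := hu.contyy.mono h

theorem C2On.prod {f f' f'' g g' g'' : ℝ → ℝ} (hf : ∀ x, HasDerivAt f (f' x) x)
    (hf' : ∀ x, HasDerivAt f' (f'' x) x) (hf'' : Continuous f'')
    (hg : ∀ x, HasDerivAt g (g' x) x)
    (hg' : ∀ x, HasDerivAt g' (g'' x) x) (hg'' : Continuous g'') (R : Set (ℝ × ℝ)) :
    C2On R (fun p => f p.1 * g p.2) (fun p => f' p.1 * g p.2) (fun p => f p.1 * g' p.2)
      (fun p => f'' p.1 * g p.2) (fun p => f p.1 * g'' p.2) := by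
  have cf : Continuous f := continuous_iff_continuousAt.2 fun x => (hf x).continuousAt
  have cf' : Continuous f' := continuous_iff_continuousAt.2 fun x => (hf' x).continuousAt
  have cg : Continuous g := continuous_iff_continuousAt.2 fun x => (hg x).continuousAt
  have cg' : Continuous g' := continuous_iff_continuousAt.2 fun x => (hg' x).continuousAt
  refine ⟨fun p _ => (hf p.1).mul_const (g p.2), fun p _ => (hg p.2).const_mul (f p.1),
    fun p _ => (hf' p.1).mul_const (g p.2), fun p _ => (hg' p.2).const_mul (f p.1), ?_, ?_, ?_, ?_, ?_⟩ <;>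
  fun_prop

theorem isCompact_rect (a b c d : ℝ) : IsCompact (Icc a b ×ˢ Icc c d) :=
  isCompact_Icc.prod isCompact_Icc

theorem setIntegral_rect_eq {a b c d : ℝ} (hab : a ≤ b) (hcd : c ≤ d) {f : ℝ × ℝ → ℝ}
    (hf : IntegrableOn f (Icc a b ×ˢ Icc c d)) :
    ∫ p in Icc a b ×ˢ Icc c d, f p = ∫ x in a..b, ∫ y in c..d, f (x, y) := by
  rw [Measure.volume_eq_prod] at hf ⊢
  rw [setIntegral_prod f hf, intervalIntegral.integral_of_le hab, integral_Icc_eq_integral_Ioc]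
  refine setIntegral_congr_fun measurableSet_Ioc fun x _ => ?_
  rw [intervalIntegral.integral_of_le hcd, integral_Icc_eq_integral_Ioc]

theorem setIntegral_rect_eq_swap {a b c d : ℝ} (hab : a ≤ b) (hcd : c ≤ d) {f : ℝ × ℝ → ℝ}
    (hf : IntegrableOn f (Icc a b ×ˢ Icc c d)) :
    ∫ p in Icc a b ×ˢ Icc c d, f p = ∫ y in c..d, ∫ x in a..b, f (x, y) := by
  have hf' : IntegrableOn (fun z : ℝ × ℝ => f z.swap) (Icc c d ×ˢ Icc a b) := by
    rw [Measure.volume_eq_prod] at hf ⊢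
    exact hf.swap
  have := setIntegral_rect_eq hcd hab hf'
  rw [Measure.volume_eq_prod] at this ⊢
  rw [← setIntegral_prod_swap, this]
  rfl

/-- Green's second identity on a rectangle. -/
theorem green_rect {a b c d : ℝ} (hab : a ≤ b) (hcd : c ≤ d)
    {u ux uy uxx uyy φ φx φy φxx φyy : ℝ × ℝ → ℝ}
    (hu : C2On (Icc a b ×ˢ Icc c d) u ux uy uxx uyy) (hφ : TestOn a b c d φ φx φy φxx φyy) :
    ∫ p in Icc a b ×ˢ Icc c d, (u p * (φxx p + φyy p) - φ p * (uxx p + uyy p)) =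
      -∫ y in c..d, u (a, y) * φx (a, y) := by
  have hK := isCompact_rect a b c d
  have c1 : ContinuousOn (fun p => u p * φxx p - φ p * uxx p) (Icc a b ×ˢ Icc c d) :=
    (hu.cont.mul hφ.contxx).sub (hφ.cont.mul hu.contxx)
  have c2 : ContinuousOn (fun p => u p * φyy p - φ p * uyy p) (Icc a b ×ˢ Icc c d) :=
    (hu.cont.mul hφ.contyy).sub (hφ.cont.mul hu.contyy)
  have i1 := c1.integrableOn_compact hK (μ := volume)
  have i2 := c2.integrableOn_compact hK (μ := volume)
  have e : ∀ p : ℝ × ℝ, u p * (φxx p + φyy p) - φ p * (uxx p + uyy p) =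
      (u p * φxx p - φ p * uxx p) + (u p * φyy p - φ p * uyy p) := fun p => by ring
  simp_rw [e]
  rw [integral_add i1 i2, setIntegral_rect_eq_swap hab hcd i1, setIntegral_rect_eq hab hcd i2]
  -- The integrand is the y-derivative of u φy - φ uy, which vanishes at both ends.
  have h2 : ∀ x ∈ uIcc a b, ∫ y in c..d, (u (x, y) * φyy (x, y) - φ (x, y) * uyy (x, y)) = 0 := by
    intro x hx
    rw [uIcc_of_le hab] at hx
    rw [intervalIntegral.integral_eq_sub_of_hasDerivAt
      (f := fun y => u (x, y) * φy (x, y) - φ (x, y) * uy (x, y))]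
    · simp [hφ.top x hx, hφ.top' x hx, hφ.bot x hx, hφ.bot' x hx]
    · intro y hy
      rw [uIcc_of_le hcd] at hy
      have hp : (x, y) ∈ Icc a b ×ˢ Icc c d := ⟨hx, hy⟩
      refine (((hu.dy _ hp).fun_mul (hφ.dyy _ hp)).fun_sub
        ((hφ.dy _ hp).fun_mul (hu.dyy _ hp))).congr_deriv ?_
      ring
    · refine ContinuousOn.intervalIntegrable ?_
      rw [uIcc_of_le hcd]
      exact c2.comp (f := fun y => (x, y)) (by fun_prop) fun y hy => ⟨hx, hy⟩
  -- Same primitive in x; on the left side φ vanishes but φx need not, so one boundary term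
  -- survives.
  have h1 : ∀ y ∈ uIcc c d, ∫ x in a..b, (u (x, y) * φxx (x, y) - φ (x, y) * uxx (x, y)) =
      -(u (a, y) * φx (a, y)) := by
    intro y hy
    rw [uIcc_of_le hcd] at hy
    rw [intervalIntegral.integral_eq_sub_of_hasDerivAt
      (f := fun x => u (x, y) * φx (x, y) - φ (x, y) * ux (x, y))]
    · simp [hφ.left y hy, hφ.right y hy, hφ.right' y hy]
    · intro x hx
      rw [uIcc_of_le hab] at hx
      have hp : (x, y) ∈ Icc a b ×ˢ Icc c d := ⟨hx, hy⟩
      refine (((hu.dx _ hp).fun_mul (hφ.dxx _ hp)).fun_sub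
        ((hφ.dx _ hp).fun_mul (hu.dxx _ hp))).congr_deriv ?_
      ring
    · refine ContinuousOn.intervalIntegrable ?_
      rw [uIcc_of_le hab]
      exact c1.comp (f := fun x => (x, y)) (by fun_prop) fun x hx => ⟨hx, hy⟩
  rw [intervalIntegral.integral_congr h1, intervalIntegral.integral_congr h2]
  simp

/-! ### A regularized logarithm -/

theorem hasDerivAt_ite_lt {f g f' g' : ℝ → ℝ} {a : ℝ} (hf : ∀ t ≤ a, HasDerivAt f (f' t) t)
    (hg : ∀ t, a ≤ t → HasDerivAt g (g' t) t) (h0 : f a = g a) (h1 : f' a = g' a) (t : ℝ) :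
    HasDerivAt (fun t => if t < a then f t else g t) (if t < a then f' t else g' t) t := by
  rcases lt_trichotomy t a with h | h | h
  · rw [if_pos h]
    refine (hf t h.le).congr_of_eventuallyEq ?_
    filter_upwards [gt_mem_nhds h] with s hs using if_pos hs
  · subst h
    rw [if_neg (lt_irrefl t)]
    have l : HasDerivWithinAt (fun s => if s < t then f s else g s) (g' t) (Iic t) t := by
      rw [← h1]
      refine (hf t le_rfl).hasDerivWithinAt.congr (fun s hs => ?_) (by simp [h0])
      rcases (mem_Iic.1 hs).lt_or_eq with h | h
      · simp [h]
      · simp [h, h0]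
    have r : HasDerivWithinAt (fun s => if s < t then f s else g s) (g' t) (Ici t) t :=
      (hg t le_rfl).hasDerivWithinAt.congr (fun s hs => if_neg (not_lt.2 hs)) (by simp)
    have := l.union r
    rwa [Iic_union_Ici, hasDerivWithinAt_univ] at this
  · rw [if_neg h.not_gt]
    refine (hg t h.le).congr_of_eventuallyEq ?_
    filter_upwards [lt_mem_nhds h] with s hs using if_neg hs.not_gt

/-- The `C²` function that agrees with `log` on `[1, ∞)` and with its second Taylor polynomial at
`1` on `(-∞, 1]`. -/
noncomputable def softLog (t : ℝ) : ℝ :=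
  if t < 1 then (t - 1) - (t - 1) ^ 2 / 2 else Real.log t

noncomputable def softLog' (t : ℝ) : ℝ := if t < 1 then 2 - t else t⁻¹

/-- The `max` makes continuity visible: the value is -1 for t ≤ 1 and -1/t² beyond. -/
noncomputable def softLog'' (t : ℝ) : ℝ := -((max t 1) ^ 2)⁻¹

theorem hasDerivAt_softLog (t : ℝ) : HasDerivAt softLog (softLog' t) t := by
  refine hasDerivAt_ite_lt (f := fun t => (t - 1) - (t - 1) ^ 2 / 2) (f' := fun t => 2 - t)
    (g' := fun t => t⁻¹) ?_ ?_ (by simp) (by norm_num) t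
  · intro t _
    refine (((hasDerivAt_id' t).sub_const 1).fun_sub
      ((((hasDerivAt_id' t).sub_const 1).fun_pow 2).div_const 2)).congr_deriv ?_
    norm_num; ring
  · exact fun t ht => Real.hasDerivAt_log (by linarith)

theorem hasDerivAt_softLog' (t : ℝ) : HasDerivAt softLog' (softLog'' t) t := by
  have : softLog'' t = if t < 1 then -1 else -(t ^ 2)⁻¹ := by
    unfold softLog''
    split_ifs with h
    · simp [max_eq_right h.le]
    · simp [max_eq_left (not_lt.1 h)]
  rw [this]
  refine hasDerivAt_ite_lt (f := fun t => 2 - t) (f' := fun _ => -1)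
    (g' := fun t => -(t ^ 2)⁻¹) ?_ ?_ (by norm_num) (by norm_num) t
  · intro t _
    exact (hasDerivAt_id t).const_sub 2
  · exact fun t ht => hasDerivAt_inv (by linarith)

theorem continuous_softLog : Continuous softLog :=
  continuous_iff_continuousAt.2 fun x => (hasDerivAt_softLog x).continuousAt

theorem continuous_softLog' : Continuous softLog' :=
  continuous_iff_continuousAt.2 fun x => (hasDerivAt_softLog' x).continuousAt

theorem continuous_softLog'' : Continuous softLog'' := by
  refine Continuous.neg (Continuous.inv₀ (by fun_prop) fun x => ?_)
  have : (0 : ℝ) < max x 1 := lt_max_of_lt_right one_pos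
  positivity

theorem softLog_of_one_le {t : ℝ} (ht : 1 ≤ t) : softLog t = Real.log t := if_neg ht.not_gt

theorem softLog'_of_one_le {t : ℝ} (ht : 1 ≤ t) : softLog' t = t⁻¹ := if_neg ht.not_gt

/-- With t = c²r² the left side is, up to the factor 2c², the Laplacian of the radial function
softLog(t)/2. It vanishes for t ≥ 1 because log r is harmonic. -/
theorem softLog'_add (t : ℝ) : softLog' t + t * softLog'' t = 2 * max (1 - t) 0 := by
  unfold softLog' softLog''
  split_ifs with h
  · rw [max_eq_right h.le, max_eq_left (by linarith)]; ring
  · have h := not_lt.1 h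
    rw [max_eq_left h, max_eq_right (by linarith)]
    have : t ≠ 0 := by linarith
    field_simp
    ring

/-- On (0, 1] the difference softLog - log has derivative -(s-1)²/s ≤ 0 and ends at 0. -/
theorem log_le_softLog {t : ℝ} (ht : 0 < t) : Real.log t ≤ softLog t := by
  rcases lt_or_ge t 1 with h | h
  · have e : softLog t = (t - 1) - (t - 1) ^ 2 / 2 := if_pos h
    rw [e]
    let F : ℝ → ℝ := fun t => (t - 1) - (t - 1) ^ 2 / 2 - Real.log t
    have hd : ∀ s ∈ Ioc (0 : ℝ) 1, HasDerivAt F (2 - s - s⁻¹) s := by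
      intro s hs
      refine ((((hasDerivAt_id' s).sub_const 1).fun_sub
        ((((hasDerivAt_id' s).sub_const 1).fun_pow 2).div_const 2)).fun_sub
          (Real.hasDerivAt_log hs.1.ne')).congr_deriv ?_
      norm_num; ring
    have anti : AntitoneOn F (Ioc 0 1) := by
      refine antitoneOn_of_deriv_nonpos (convex_Ioc 0 1)
        (fun s hs => (hd s hs).continuousAt.continuousWithinAt)
        (fun s hs => (hd s (interior_subset hs)).differentiableAt.differentiableWithinAt) ?_
      intro s hs
      have hs := interior_subset hs
      rw [(hd s hs).deriv]
      have h0 := hs.1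
      have : 2 - s - s⁻¹ = -((s - 1) ^ 2 / s) := by field_simp; ring
      rw [this]
      have : 0 ≤ (s - 1) ^ 2 / s := by positivity
      linarith
    have := anti ⟨ht, h.le⟩ ⟨one_pos, le_rfl⟩ h.le
    simp only [F] at this
    norm_num at this
    linarith
  · rw [softLog_of_one_le h]

theorem softLog_nonpos {t : ℝ} (h : t ≤ 1) : softLog t ≤ 0 := by
  rcases h.lt_or_eq with h | h
  · have e : softLog t = (t - 1) - (t - 1) ^ 2 / 2 := if_pos h
    rw [e]; nlinarith [sq_nonneg (t - 1)]
  · simp [h, softLog]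

/-- `C²` regularization of `log (√(x² + y²))` at scale `1/c`. -/
noncomputable def regLog (c : ℝ) (p : ℝ × ℝ) : ℝ :=
  softLog (c ^ 2 * (p.1 ^ 2 + p.2 ^ 2)) / 2 - Real.log c

noncomputable def regLogD (c : ℝ) (x : ℝ) (p : ℝ × ℝ) : ℝ :=
  c ^ 2 * x * softLog' (c ^ 2 * (p.1 ^ 2 + p.2 ^ 2))

noncomputable def regLogDD (c : ℝ) (x : ℝ) (p : ℝ × ℝ) : ℝ :=
  c ^ 2 * softLog' (c ^ 2 * (p.1 ^ 2 + p.2 ^ 2)) +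
    2 * c ^ 4 * x ^ 2 * softLog'' (c ^ 2 * (p.1 ^ 2 + p.2 ^ 2))

/-- The Laplacian of `regLog c`. -/
noncomputable def regKernel (c : ℝ) (p : ℝ × ℝ) : ℝ :=
  4 * c ^ 2 * max (1 - c ^ 2 * (p.1 ^ 2 + p.2 ^ 2)) 0

theorem regLogDD_add (c : ℝ) (p : ℝ × ℝ) :
    regLogDD c p.1 p + regLogDD c p.2 p = regKernel c p := by
  have := softLog'_add (c ^ 2 * (p.1 ^ 2 + p.2 ^ 2))
  unfold regLogDD regKernel
  linear_combination (2 * c ^ 2) * this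

theorem regLog_eq {c : ℝ} (hc : 0 < c) {p : ℝ × ℝ} (hp : 1 ≤ c ^ 2 * (p.1 ^ 2 + p.2 ^ 2)) :
    regLog c p = Real.log (p.1 ^ 2 + p.2 ^ 2) / 2 := by
  have h0 : p.1 ^ 2 + p.2 ^ 2 ≠ 0 := by rintro h; rw [h] at hp; norm_num at hp
  rw [regLog, softLog_of_one_le hp, Real.log_mul (by positivity) h0, Real.log_pow]
  push_cast; ring

theorem regLogD_eq {c : ℝ} (hc : 0 < c) (x : ℝ) {p : ℝ × ℝ}
    (hp : 1 ≤ c ^ 2 * (p.1 ^ 2 + p.2 ^ 2)) :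
    regLogD c x p = x / (p.1 ^ 2 + p.2 ^ 2) := by
  have h0 : p.1 ^ 2 + p.2 ^ 2 ≠ 0 := by rintro h; rw [h] at hp; norm_num at hp
  rw [regLogD, softLog'_of_one_le hp]
  field_simp

theorem regKernel_eq_zero {c : ℝ} {p : ℝ × ℝ} (hp : 1 ≤ c ^ 2 * (p.1 ^ 2 + p.2 ^ 2)) :
    regKernel c p = 0 := by
  rw [regKernel, max_eq_right (by linarith), mul_zero]

/-- The domination needed to let c → ∞: inside the smoothing disc, log r ≤ regLog ≤ 0 because c ≥ 1.
-/
theorem abs_regLog_le {c : ℝ} (hc : 1 ≤ c) {p : ℝ × ℝ} (hp : 0 < p.1 ^ 2 + p.2 ^ 2) :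
    |regLog c p| ≤ |Real.log (p.1 ^ 2 + p.2 ^ 2) / 2| := by
  rcases le_or_gt 1 (c ^ 2 * (p.1 ^ 2 + p.2 ^ 2)) with h | h
  · rw [regLog_eq (by linarith) h]
  · have h0 : 0 < c := by linarith
    have h1 := log_le_softLog (t := c ^ 2 * (p.1 ^ 2 + p.2 ^ 2)) (by positivity)
    rw [Real.log_mul (by positivity) hp.ne', Real.log_pow] at h1
    push_cast at h1
    have h2 := softLog_nonpos h.le
    have h3 := Real.log_nonneg hc
    have h4 : Real.log (p.1 ^ 2 + p.2 ^ 2) / 2 ≤ regLog c p := by unfold regLog; linarith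
    have h5 : regLog c p ≤ 0 := by unfold regLog; linarith
    rw [abs_of_nonpos h5, abs_of_nonpos (h4.trans h5)]
    linarith

theorem c2On_regLog (c : ℝ) (a : ℝ × ℝ) (R : Set (ℝ × ℝ)) :
    C2On R (fun p => regLog c (p - a)) (fun p => regLogD c (p.1 - a.1) (p - a))
      (fun p => regLogD c (p.2 - a.2) (p - a)) (fun p => regLogDD c (p.1 - a.1) (p - a))
      (fun p => regLogDD c (p.2 - a.2) (p - a)) := by
  have k1 := continuous_softLog
  have k2 := continuous_softLog'
  have k3 := continuous_softLog''
  have e1 : ∀ p : ℝ × ℝ, HasDerivAt (fun x => c ^ 2 * ((x - a.1) ^ 2 + (p.2 - a.2) ^ 2))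
      (c ^ 2 * (2 * (p.1 - a.1))) p.1 := fun p => by
    simpa using ((((hasDerivAt_id p.1).sub_const a.1).pow 2).add_const ((p.2 - a.2) ^ 2)).const_mul
      (c ^ 2)
  have e2 : ∀ p : ℝ × ℝ, HasDerivAt (fun y => c ^ 2 * ((p.1 - a.1) ^ 2 + (y - a.2) ^ 2))
      (c ^ 2 * (2 * (p.2 - a.2))) p.2 := fun p => by
    simpa using ((((hasDerivAt_id p.2).sub_const a.2).pow 2).const_add ((p.1 - a.1) ^ 2)).const_mul
      (c ^ 2)
  refine ⟨fun p _ => ?_, fun p _ => ?_, fun p _ => ?_, fun p _ => ?_, ?_, ?_, ?_, ?_, ?_⟩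
  · refine ((((hasDerivAt_softLog _).comp p.1 (e1 p)).div_const 2).sub_const
      (Real.log c)).congr_deriv ?_
    simp only [regLogD, Prod.fst_sub, Prod.snd_sub]; ring
  · refine ((((hasDerivAt_softLog _).comp p.2 (e2 p)).div_const 2).sub_const
      (Real.log c)).congr_deriv ?_
    simp only [regLogD, Prod.fst_sub, Prod.snd_sub]; ring
  · refine ((((hasDerivAt_id' p.1).sub_const a.1).const_mul (c ^ 2)).fun_mul
      ((hasDerivAt_softLog' _).comp p.1 (e1 p))).congr_deriv ?_
    simp only [regLogDD, Prod.fst_sub, Prod.snd_sub, Function.comp]; ring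
  · refine ((((hasDerivAt_id' p.2).sub_const a.2).const_mul (c ^ 2)).fun_mul
      ((hasDerivAt_softLog' _).comp p.2 (e2 p))).congr_deriv ?_
    simp only [regLogDD, Prod.fst_sub, Prod.snd_sub, Function.comp]; ring
  all_goals
    simp only [regLog, regLogD, regLogDD]
    fun_prop

theorem continuous_regKernel (c : ℝ) : Continuous (regKernel c) := by
  unfold regKernel
  fun_prop

/-! ### The kernel is an approximate identity -/

/-- In polar coordinates this is 2π ∫₀¹ (r - r³) dr. With the factor 4 in `regKernel` the total mass
becomes 2π. -/
theorem integral_max_one_sub_sq :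
    ∫ p : ℝ × ℝ, max (1 - (p.1 ^ 2 + p.2 ^ 2)) 0 = Real.pi / 2 := by
  rw [← integral_comp_polarCoord_symm, polarCoord_target]
  have e : ∀ p : ℝ × ℝ, p.1 • max (1 - ((polarCoord.symm p).1 ^ 2 + (polarCoord.symm p).2 ^ 2)) 0 =
      (p.1 * max (1 - p.1 ^ 2) 0) * (fun _ => (1 : ℝ)) p.2 := by
    intro p
    have : (polarCoord.symm p).1 ^ 2 + (polarCoord.symm p).2 ^ 2 = p.1 ^ 2 := by
      simp only [polarCoord_symm_apply]
      linear_combination p.1 ^ 2 * Real.sin_sq_add_cos_sq p.2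
    rw [this]; simp
  simp_rw [e]
  rw [Measure.volume_eq_prod, setIntegral_prod_mul (fun r : ℝ => r * max (1 - r ^ 2) 0) (fun _ => (1 : ℝ))]
  have h1 : ∫ r in Ioi (0 : ℝ), r * max (1 - r ^ 2) 0 = 1 / 4 := by
    have : ∫ r in Ioi (0 : ℝ), r * max (1 - r ^ 2) 0 = ∫ r in Ioc (0 : ℝ) 1, (r - r ^ 3) := by
      rw [← Ioc_union_Ioi_eq_Ioi zero_le_one]
      have z : ∀ r ∈ Ioi (1 : ℝ), r * max (1 - r ^ 2) 0 = 0 := by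
        intro r hr
        rw [max_eq_right, mul_zero]
        have := mem_Ioi.1 hr
        nlinarith
      have i1 : IntegrableOn (fun r : ℝ => r * max (1 - r ^ 2) 0) (Ioc 0 1) := by
        refine (Continuous.integrableOn_Ioc ?_)
        fun_prop
      have i2 : IntegrableOn (fun r : ℝ => r * max (1 - r ^ 2) 0) (Ioi 1) :=
        (integrableOn_zero).congr_fun (fun r hr => (z r hr).symm) measurableSet_Ioi
      rw [setIntegral_union (Ioc_disjoint_Ioi le_rfl) measurableSet_Ioi i1 i2,
        setIntegral_congr_fun measurableSet_Ioi z]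
      simp only [integral_zero, add_zero]
      refine setIntegral_congr_fun measurableSet_Ioc fun r hr => ?_
      rw [max_eq_left (by nlinarith [hr.1, hr.2])]
      ring
    rw [this, ← intervalIntegral.integral_of_le zero_le_one, intervalIntegral.integral_sub,
      integral_pow, integral_id]
    · norm_num
    · exact intervalIntegral.intervalIntegrable_id
    · exact intervalIntegral.intervalIntegrable_pow 3
  rw [h1]
  have : (0 : ℝ) ≤ Real.pi * 2 := by positivity
  simp [← mul_two, max_eq_left this]
  ring

theorem tendsto_integral_regKernel {w : ℝ × ℝ → ℝ} {a : ℝ × ℝ} (hw : Integrable w)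
    (ha : ContinuousAt w a) :
    Tendsto (fun c => ∫ p, regKernel c (p - a) * w p) atTop (𝓝 (2 * Real.pi * w a)) := by
  have hpi := Real.pi_pos
  let κ : ℝ × ℝ → ℝ := fun p => 2 / Real.pi * max (1 - (p.1 ^ 2 + p.2 ^ 2)) 0
  have h1 : ∀ p, 0 ≤ κ p := fun p => by positivity
  have h2 : ∫ p, κ p = 1 := by
    simp only [κ]
    rw [integral_const_mul, integral_max_one_sub_sq]
    field_simp
  have h3 : Tendsto (fun p : ℝ × ℝ => ‖p‖ ^ Module.finrank ℝ (ℝ × ℝ) * κ p)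
      (Bornology.cobounded (ℝ × ℝ)) (𝓝 0) := by
    refine tendsto_const_nhds.congr' ?_
    have : ∀ᶠ p : ℝ × ℝ in Bornology.cobounded (ℝ × ℝ), 1 ≤ ‖p‖ :=
      tendsto_norm_cobounded_atTop.eventually_ge_atTop 1
    filter_upwards [this] with p hp
    have : κ p = 0 := by
      have : 1 ≤ p.1 ^ 2 + p.2 ^ 2 := by
        rw [Prod.norm_def, le_max_iff, Real.norm_eq_abs, Real.norm_eq_abs] at hp
        rcases hp with h | h
        · have := sq_le_sq' (by linarith [abs_nonneg p.1]) h
          rw [sq_abs] at this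
          nlinarith [sq_nonneg p.2]
        · have := sq_le_sq' (by linarith [abs_nonneg p.2]) h
          rw [sq_abs] at this
          nlinarith [sq_nonneg p.1]
      simp only [κ]
      rw [max_eq_right (by linarith), mul_zero]
    rw [this, mul_zero]
  have := (tendsto_integral_comp_smul_smul_of_integrable' (μ := volume) h1 h2 h3 hw ha).const_mul
    (2 * Real.pi)
  refine this.congr fun c => ?_
  rw [← integral_const_mul]
  congr 1
  ext p
  have hf : Module.finrank ℝ (ℝ × ℝ) = 2 := by simp
  rw [hf]
  simp only [κ, regKernel, smul_eq_mul, Prod.smul_fst, Prod.smul_snd, Prod.fst_sub, Prod.snd_sub]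
  have : (c * (a.1 - p.1)) ^ 2 + (c * (a.2 - p.2)) ^ 2 =
    c ^ 2 * ((p.1 - a.1) ^ 2 + (p.2 - a.2) ^ 2) := by ring
  rw [this]
  field_simp
  ring

end BalazardSaiasYor

namespace BalazardSaiasYor

/-! ### Green's identity for logarithmic potentials -/

/-- `u` is integrable and satisfies Green's identity against a test function with Laplacian `L` and
normal derivative `φx` on the left side, with total mass `μ`. -/
structure GreenFor (a b c d : ℝ) (φx L u : ℝ × ℝ → ℝ) (μ : ℝ) : Prop where
  int : IntegrableOn u (Icc a b ×ˢ Icc c d)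
  intb : IntervalIntegrable (fun y => u (a, y)) volume c d
  intL : IntegrableOn (fun p => u p * L p) (Icc a b ×ˢ Icc c d)
  intx : IntervalIntegrable (fun y => u (a, y) * φx (a, y)) volume c d
  eq : (∫ p in Icc a b ×ˢ Icc c d, u p * L p) + ∫ y in c..d, u (a, y) * φx (a, y) = μ

section

variable {a b c d : ℝ} {φx L u v : ℝ × ℝ → ℝ} {μ ν : ℝ}

theorem GreenFor.add (hu : GreenFor a b c d φx L u μ) (hv : GreenFor a b c d φx L v ν) :
    GreenFor a b c d φx L (fun p => u p + v p) (μ + ν) where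
  int := hu.int.add hv.int
  intb := hu.intb.add hv.intb
  intL := (hu.intL.add hv.intL).congr_fun (fun p _ => (add_mul _ _ _).symm)
    (isCompact_rect a b c d).measurableSet
  intx := (hu.intx.add hv.intx).congr (fun y _ => (add_mul _ _ _).symm)
  eq := by
    simp_rw [add_mul]
    rw [integral_add hu.intL hv.intL, intervalIntegral.integral_add hu.intx hv.intx, ← hu.eq,
      ← hv.eq]
    ring

theorem GreenFor.const_mul (hu : GreenFor a b c d φx L u μ) (k : ℝ) :
    GreenFor a b c d φx L (fun p => k * u p) (k * μ) where
  int := hu.int.const_mul k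
  intb := hu.intb.const_mul k
  intL := by
    simp_rw [mul_assoc]
    exact hu.intL.const_mul k
  intx := (hu.intx.const_mul k).congr (fun y _ => (mul_assoc _ _ _).symm)
  eq := by
    simp_rw [mul_assoc]
    rw [integral_const_mul, intervalIntegral.integral_const_mul, ← hu.eq]
    ring

theorem GreenFor.sum {ι : Type*} (s : Finset ι) {u : ι → ℝ × ℝ → ℝ} {μ : ι → ℝ}
    (h : ∀ i ∈ s, GreenFor a b c d φx L (u i) (μ i)) :
    GreenFor a b c d φx L (fun p => ∑ i ∈ s, u i p) (∑ i ∈ s, μ i) := by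
  classical
  induction s using Finset.induction_on with
  | empty => simpa using (⟨by simp, by simp, by simp, by simp, by simp⟩ :
      GreenFor a b c d φx L (fun _ => 0) 0)
  | insert i s hi ih =>
    simp_rw [Finset.sum_insert hi]
    exact (h i (Finset.mem_insert_self i s)).add
      (ih fun j hj => h j (Finset.mem_insert_of_mem hj))

/-- A finite set is null in the plane and meets the left side in a null set. This is needed because
`Real.log 0 = 0` breaks the decomposition of log|f| at the zeros. -/
theorem GreenFor.congr (hu : GreenFor a b c d φx L u μ) {S : Set (ℝ × ℝ)} (hS : S.Finite)
    (h : ∀ p ∈ Icc a b ×ˢ Icc c d, p ∉ S → v p = u p) (hab : a ≤ b) (hcd : c ≤ d) :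
    GreenFor a b c d φx L v μ := by
  have m := (isCompact_rect a b c d).measurableSet
  have hae : ∀ᵐ p : ℝ × ℝ, p ∉ S := by
    rw [ae_iff]
    simpa using hS.countable.measure_zero volume
  have h1 : ∀ᵐ p ∂(volume.restrict (Icc a b ×ˢ Icc c d)), u p = v p := by
    rw [ae_restrict_iff' m]
    filter_upwards [hae] with p hp hpR using (h p hpR hp).symm
  have hae2 : ∀ᵐ y : ℝ, y ∉ Prod.snd '' S := by
    rw [ae_iff]
    simp only [not_not]
    exact (hS.image Prod.snd).countable.measure_zero volume
  have h2 : ∀ᵐ y : ℝ, y ∈ uIoc c d → u (a, y) = v (a, y) := by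
    filter_upwards [hae2] with y hy hyR
    rw [uIoc_of_le hcd] at hyR
    exact (h _ ⟨⟨le_rfl, hab⟩, hyR.1.le, hyR.2⟩ fun hS => hy ⟨_, hS, rfl⟩).symm
  have h2' : ∀ᵐ y ∂(volume.restrict (uIoc c d)), u (a, y) = v (a, y) := by
    rwa [ae_restrict_iff' measurableSet_uIoc]
  refine ⟨hu.int.congr h1, hu.intb.congr_ae h2', hu.intL.congr (h1.mono fun p hp => by simp [hp]),
    hu.intx.congr_ae (h2'.mono fun p hp => by simp [hp]), ?_⟩
  rw [← hu.eq]
  congr 1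
  · exact integral_congr_ae (h1.mono fun p hp => by simp [hp])
  · exact intervalIntegral.integral_congr_ae (h2.mono fun p hp hR => by simp [hp hR])

end

/-- `log` of the distance to `q`. -/
noncomputable def logDist (q p : ℝ × ℝ) : ℝ := Real.log ((p.1 - q.1) ^ 2 + (p.2 - q.2) ^ 2) / 2

theorem measurable_logDist (q : ℝ × ℝ) : Measurable (logDist q) := by
  unfold logDist
  fun_prop

/-- Reduces local integrability of log r to that of log|x| on the line: if r ≤ 1 compare with log
x², otherwise use log t ≤ t - 1. -/
theorem abs_log_add_sq_le {x : ℝ} (y : ℝ) (hx : x ≠ 0) :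
    |Real.log (x ^ 2 + y ^ 2) / 2| ≤ |Real.log x| + (x ^ 2 + y ^ 2) := by
  have h0 : 0 < x ^ 2 := by positivity
  have hy := sq_nonneg y
  rcases le_total 1 (x ^ 2 + y ^ 2) with h | h
  · have h1 := Real.log_nonneg h
    have h2 := Real.log_le_sub_one_of_pos (x := x ^ 2 + y ^ 2) (by linarith)
    rw [abs_of_nonneg (by linarith)]
    have := abs_nonneg (Real.log x)
    linarith
  · have h1 := Real.log_nonpos (by linarith) h
    have h2 := Real.log_le_log h0 (by linarith : x ^ 2 ≤ x ^ 2 + y ^ 2)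
    rw [Real.log_pow] at h2
    push_cast at h2
    rw [abs_of_nonpos (by linarith)]
    have := neg_abs_le (Real.log x)
    linarith

theorem integrableOn_logDist (q : ℝ × ℝ) {a b : ℝ} (hab : a ≤ b) (c d : ℝ) :
    IntegrableOn (logDist q) (Icc a b ×ˢ Icc c d) := by
  have i1 : IntegrableOn (fun x => |Real.log (x - q.1)|) (Icc a b) := by
    have : IntervalIntegrable (fun x => Real.log (x - q.1)) volume a b := by
      have := (intervalIntegral.intervalIntegrable_log' (a := a - q.1) (b := b - q.1)).comp_sub_right
        q.1
      simpa using this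
    rw [intervalIntegrable_iff_integrableOn_Icc_of_le hab] at this
    exact this.abs
  have i2 : IntegrableOn (fun p : ℝ × ℝ => |Real.log (p.1 - q.1)|) (Icc a b ×ˢ Icc c d) := by
    rw [IntegrableOn, Measure.volume_eq_prod, ← Measure.prod_restrict]
    exact Integrable.comp_fst i1 _
  have i3 : IntegrableOn (fun p : ℝ × ℝ => (p.1 - q.1) ^ 2 + (p.2 - q.2) ^ 2)
      (Icc a b ×ˢ Icc c d) :=
    ContinuousOn.integrableOn_compact (isCompact_rect a b c d) (by fun_prop)
  refine (i2.add i3).mono' (measurable_logDist q).aestronglyMeasurable ?_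
  have : ∀ᵐ p : ℝ × ℝ, p.1 ≠ q.1 := by
    rw [ae_iff]
    have e : {p : ℝ × ℝ | ¬ p.1 ≠ q.1} = {q.1} ×ˢ univ := by ext p; simp
    rw [e, Measure.volume_eq_prod, Measure.prod_prod]
    simp
  filter_upwards [ae_restrict_of_ae this] with p hp
  exact abs_log_add_sq_le _ (sub_ne_zero.2 hp)

theorem intervalIntegrable_logDist (q : ℝ × ℝ) (a : ℝ) {c d : ℝ} :
    IntervalIntegrable (fun y => logDist q (a, y)) volume c d := by
  have i1 : IntervalIntegrable (fun y => |Real.log (y - q.2)|) volume c d := by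
    have := ((intervalIntegral.intervalIntegrable_log' (a := c - q.2)
      (b := d - q.2)).comp_sub_right q.2).abs
    simpa using this
  have i2 : IntervalIntegrable (fun y => (y - q.2) ^ 2 + (a - q.1) ^ 2) volume c d :=
    Continuous.intervalIntegrable (by fun_prop) c d
  refine (i1.add i2).mono_fun' ((measurable_logDist q).comp (by fun_prop)).aestronglyMeasurable ?_
  have : ∀ᵐ y : ℝ, y ≠ q.2 := by simp [ae_iff]
  filter_upwards [ae_restrict_of_ae this] with y hy
  have := abs_log_add_sq_le (a - q.1) (sub_ne_zero.2 hy)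
  rw [add_comm ((y - q.2) ^ 2)] at this
  rw [Real.norm_eq_abs, add_comm]
  simpa only [logDist, add_comm] using this

/-- A test function vanishes on all four sides, so its extension by zero is continuous; the point
mass can then sit anywhere, including on the boundary. -/
theorem TestOn.continuous_indicator {a b c d : ℝ} (hab : a ≤ b) (hcd : c ≤ d)
    {φ φx φy φxx φyy : ℝ × ℝ → ℝ} (hφ : TestOn a b c d φ φx φy φxx φyy) :
    Continuous ((Icc a b ×ˢ Icc c d).indicator φ) := by
  refine _root_.continuous_indicator ?_ ?_
  · rw [frontier_prod_eq, frontier_Icc hab, frontier_Icc hcd, isClosed_Icc.closure_eq,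
      isClosed_Icc.closure_eq]
    rintro ⟨x, y⟩ (⟨hx, hy⟩ | ⟨hx, hy⟩)
    · rcases hy with rfl | rfl
      · exact hφ.bot x hx
      · exact hφ.top x hx
    · rcases hx with rfl | rfl
      · exact hφ.left y hy
      · exact hφ.right y hy
  · rw [(isClosed_Icc.prod isClosed_Icc).closure_eq]
    exact hφ.cont

section

variable {a b c d : ℝ} {φ φx φy φxx φyy : ℝ × ℝ → ℝ}

theorem TestOn.contL (hφ : TestOn a b c d φ φx φy φxx φyy) :
    ContinuousOn (fun p => φxx p + φyy p) (Icc a b ×ˢ Icc c d) := hφ.contxx.add hφ.contyy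

theorem TestOn.cont_left (hab : a ≤ b) (hcd : c ≤ d) (hφ : TestOn a b c d φ φx φy φxx φyy) :
    ContinuousOn (fun y => φx (a, y)) (uIcc c d) :=
  hφ.contx.comp (f := fun y => (a, y)) (by fun_prop) fun y hy => by
    rw [uIcc_of_le hcd] at hy
    exact ⟨⟨le_rfl, hab⟩, hy⟩

/-- Apply `green_rect` to `regLog k` and let k → ∞. Its Laplacian is an approximate identity of mass
2π, and the two other integrals converge by domination with log r itself. -/
theorem greenFor_logDist (hab : a ≤ b) (hcd : c ≤ d) (hφ : TestOn a b c d φ φx φy φxx φyy)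
    (q : ℝ × ℝ) :
    GreenFor a b c d φx (fun p => φxx p + φyy p) (logDist q)
      (2 * Real.pi * (Icc a b ×ˢ Icc c d).indicator φ q) := by
  have m := (isCompact_rect a b c d).measurableSet
  have hK := isCompact_rect a b c d
  have i1 := integrableOn_logDist q hab c d
  have i2 := intervalIntegrable_logDist q a (c := c) (d := d)
  have iL : IntegrableOn (fun p => logDist q p * (φxx p + φyy p)) (Icc a b ×ˢ Icc c d) :=
    i1.mul_continuousOn hφ.contL hK
  have ix : IntervalIntegrable (fun y => logDist q (a, y) * φx (a, y)) volume c d :=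
    i2.mul_continuousOn (hφ.cont_left hab hcd)
  refine ⟨i1, i2, iL, ix, ?_⟩
  have hlim : ∀ p : ℝ × ℝ, p ≠ q →
      ∀ᶠ k : ℝ in atTop, 1 ≤ k ^ 2 * ((p - q).1 ^ 2 + (p - q).2 ^ 2) := by
    intro p hp
    have h0 : 0 < (p - q).1 ^ 2 + (p - q).2 ^ 2 := by
      by_contra! h
      have h1 := sq_nonneg (p - q).1
      have h2 := sq_nonneg (p - q).2
      have e1 : (p - q).1 = 0 := by rw [← sq_eq_zero_iff]; linarith
      have e2 : (p - q).2 = 0 := by rw [← sq_eq_zero_iff]; linarith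
      exact hp (Prod.ext (sub_eq_zero.1 e1) (sub_eq_zero.1 e2))
    exact ((tendsto_pow_atTop two_ne_zero).atTop_mul_const h0).eventually_ge_atTop 1
  have hlog : ∀ p : ℝ × ℝ, p ≠ q → Tendsto (fun k => regLog k (p - q)) atTop (𝓝 (logDist q p)) := by
    intro p hp
    refine tendsto_const_nhds.congr' ?_
    filter_upwards [hlim p hp, eventually_gt_atTop 0] with k hk hk0
    rw [regLog_eq hk0 hk]; rfl
  have hbd : ∀ k : ℝ, 1 ≤ k → ∀ p : ℝ × ℝ, p ≠ q → |regLog k (p - q)| ≤ |logDist q p| := by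
    intro k hk p hp
    refine abs_regLog_le hk ?_
    obtain ⟨j, hj⟩ := (hlim p hp).exists
    by_contra! h
    nlinarith [sq_nonneg j]
  have hne : ∀ᵐ p : ℝ × ℝ, p ≠ q := by
    rw [ae_iff]
    simp
  have hne2 : ∀ᵐ y : ℝ, y ≠ q.2 := by simp [ae_iff]
  have creg : ∀ k : ℝ, Continuous fun p => regLog k (p - q) := fun k =>
    continuousOn_univ.1 (c2On_regLog k q univ).cont
  -- the three limits
  have t1 : Tendsto (fun k => ∫ p in Icc a b ×ˢ Icc c d, regLog k (p - q) * (φxx p + φyy p)) atTop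
      (𝓝 (∫ p in Icc a b ×ˢ Icc c d, logDist q p * (φxx p + φyy p))) := by
    refine tendsto_integral_filter_of_dominated_convergence
      (fun p => ‖logDist q p * (φxx p + φyy p)‖) ?_ ?_ iL.norm ?_
    · exact Eventually.of_forall fun k =>
        ((creg k).continuousOn.mul hφ.contL).aestronglyMeasurable m
    · filter_upwards [eventually_ge_atTop 1] with k hk
      filter_upwards [ae_restrict_of_ae hne] with p hp
      rw [norm_mul, norm_mul]
      exact mul_le_mul_of_nonneg_right (hbd k hk p hp) (norm_nonneg _)
    · filter_upwards [ae_restrict_of_ae hne] with p hp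
      exact (hlog p hp).mul_const _
  have t2 : Tendsto (fun k => ∫ y in c..d, regLog k ((a, y) - q) * φx (a, y)) atTop
      (𝓝 (∫ y in c..d, logDist q (a, y) * φx (a, y))) := by
    refine intervalIntegral.tendsto_integral_filter_of_dominated_convergence
      (fun y => ‖logDist q (a, y) * φx (a, y)‖) ?_ ?_ ix.norm ?_
    · refine Eventually.of_forall fun k => ContinuousOn.aestronglyMeasurable
        (ContinuousOn.mul ?_ ((hφ.cont_left hab hcd).mono uIoc_subset_uIcc)) measurableSet_uIoc
      exact ((creg k).comp (f := fun y => (a, y)) (by fun_prop)).continuousOn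
    · filter_upwards [eventually_ge_atTop 1] with k hk
      filter_upwards [hne2] with y hy _
      rw [norm_mul, norm_mul]
      exact mul_le_mul_of_nonneg_right (hbd k hk _ fun h => hy (by rw [← h])) (norm_nonneg _)
    · filter_upwards [hne2] with y hy _
      exact (hlog _ fun h => hy (by rw [← h])).mul_const _
  have t3 := tendsto_integral_regKernel (w := (Icc a b ×ˢ Icc c d).indicator φ) (a := q)
    ((integrable_indicator_iff m).2 (hφ.cont.integrableOn_compact hK))
    (hφ.continuous_indicator hab hcd).continuousAt
  refine tendsto_nhds_unique (t1.add t2) (t3.congr fun k => ?_)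
  have g := green_rect hab hcd (c2On_regLog k q _) hφ
  have e : ∀ p : ℝ × ℝ, regLog k (p - q) * (φxx p + φyy p) -
      φ p * (regLogDD k (p.1 - q.1) (p - q) + regLogDD k (p.2 - q.2) (p - q)) =
      regLog k (p - q) * (φxx p + φyy p) - regKernel k (p - q) * φ p := fun p => by
    rw [← Prod.fst_sub, ← Prod.snd_sub, regLogDD_add, mul_comm (φ p)]
  simp_rw [e] at g
  have j1 : IntegrableOn (fun p => regLog k (p - q) * (φxx p + φyy p)) (Icc a b ×ˢ Icc c d) :=
    ((creg k).continuousOn.mul hφ.contL).integrableOn_compact hK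
  have j2 : IntegrableOn (fun p => regKernel k (p - q) * φ p) (Icc a b ×ˢ Icc c d) := by
    refine ContinuousOn.integrableOn_compact hK (ContinuousOn.mul ?_ hφ.cont)
    exact ((continuous_regKernel k).comp (by fun_prop)).continuousOn
  rw [integral_sub j1 j2] at g
  have e3 : ∫ p, regKernel k (p - q) * (Icc a b ×ˢ Icc c d).indicator φ p =
      ∫ p in Icc a b ×ˢ Icc c d, regKernel k (p - q) * φ p := by
    rw [← integral_indicator m]
    congr 1
    ext p
    exact (indicator_mul_right _ (fun p => regKernel k (p - q)) φ).symm
  rw [e3]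
  linarith

/-! ### Harmonic functions and log|f| for holomorphic f -/

/-- The complex number with given real and imaginary part. -/
def toC (p : ℝ × ℝ) : ℂ := ⟨p.1, p.2⟩

theorem toC_eq (p : ℝ × ℝ) : toC p = p.1 + p.2 * Complex.I := by
  apply Complex.ext <;> simp [toC]

theorem continuous_toC : Continuous toC := by
  have : toC = fun p => (p.1 : ℂ) + p.2 * Complex.I := funext toC_eq
  rw [this]
  fun_prop

theorem hasDerivAt_toC_fst (p : ℝ × ℝ) : HasDerivAt (fun x => toC (x, p.2)) 1 p.1 := by
  simp_rw [toC_eq]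
  exact (Complex.ofRealCLM.hasDerivAt (x := p.1)).add_const _

theorem hasDerivAt_toC_snd (p : ℝ × ℝ) : HasDerivAt (fun y => toC (p.1, y)) Complex.I p.2 := by
  simp_rw [toC_eq]
  simpa using ((Complex.ofRealCLM.hasDerivAt (x := p.2)).mul_const Complex.I).const_add (p.1 : ℂ)

theorem hasDerivAt_re_fst {F : ℂ → ℂ} {F' : ℂ} {p : ℝ × ℝ} (h : HasDerivAt F F' (toC p)) :
    HasDerivAt (fun x => (F (toC (x, p.2))).re) F'.re p.1 := by
  refine (Complex.reCLM.hasFDerivAt.comp_hasDerivAt p.1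
    (HasDerivAt.scomp (h := fun x => toC (x, p.2)) p.1 h (hasDerivAt_toC_fst p))).congr_deriv ?_
  simp

theorem hasDerivAt_re_snd {F : ℂ → ℂ} {F' : ℂ} {p : ℝ × ℝ} (h : HasDerivAt F F' (toC p)) :
    HasDerivAt (fun y => (F (toC (p.1, y))).re) (-F'.im) p.2 := by
  refine (Complex.reCLM.hasFDerivAt.comp_hasDerivAt p.2
    (HasDerivAt.scomp (h := fun y => toC (p.1, y)) p.2 h (hasDerivAt_toC_snd p))).congr_deriv ?_
  simp

theorem hasDerivAt_im_snd {F : ℂ → ℂ} {F' : ℂ} {p : ℝ × ℝ} (h : HasDerivAt F F' (toC p)) :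
    HasDerivAt (fun y => (F (toC (p.1, y))).im) F'.re p.2 := by
  refine (Complex.imCLM.hasFDerivAt.comp_hasDerivAt p.2
    (HasDerivAt.scomp (h := fun y => toC (p.1, y)) p.2 h (hasDerivAt_toC_snd p))).congr_deriv ?_
  simp

/-- Cauchy–Riemann: ∂y Re F = -Im F', and the two pure second derivatives are opposite, which is
harmonicity. -/
theorem c2On_re {U : Set ℂ} (hU : IsOpen U) {F : ℂ → ℂ} (hF : DifferentiableOn ℂ F U)
    {R : Set (ℝ × ℝ)} (hR : ∀ p ∈ R, toC p ∈ U) :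
    C2On R (fun p => (F (toC p)).re) (fun p => (deriv F (toC p)).re)
      (fun p => -(deriv F (toC p)).im) (fun p => (deriv (deriv F) (toC p)).re)
      (fun p => -(deriv (deriv F) (toC p)).re) := by
  have h1 : DifferentiableOn ℂ (deriv F) U := hF.deriv hU
  have h2 : DifferentiableOn ℂ (deriv (deriv F)) U := h1.deriv hU
  have d0 : ∀ p ∈ R, HasDerivAt F (deriv F (toC p)) (toC p) := fun p hp =>
    (hF.differentiableAt (hU.mem_nhds (hR p hp))).hasDerivAt
  have d1 : ∀ p ∈ R, HasDerivAt (deriv F) (deriv (deriv F) (toC p)) (toC p) := fun p hp =>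
    (h1.differentiableAt (hU.mem_nhds (hR p hp))).hasDerivAt
  have k : ∀ {G : ℂ → ℂ}, DifferentiableOn ℂ G U → ContinuousOn (fun p => G (toC p)) R :=
    fun hG => hG.continuousOn.comp continuous_toC.continuousOn hR
  exact ⟨fun p hp => hasDerivAt_re_fst (d0 p hp), fun p hp => hasDerivAt_re_snd (d0 p hp),
    fun p hp => hasDerivAt_re_fst (d1 p hp), fun p hp => (hasDerivAt_im_snd (d1 p hp)).fun_neg,
    Complex.continuous_re.comp_continuousOn (k hF), Complex.continuous_re.comp_continuousOn (k h1),
    (Complex.continuous_im.comp_continuousOn (k h1)).neg,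
    Complex.continuous_re.comp_continuousOn (k h2),
    (Complex.continuous_re.comp_continuousOn (k h2)).neg⟩

theorem greenFor_re (hab : a ≤ b) (hcd : c ≤ d) (hφ : TestOn a b c d φ φx φy φxx φyy)
    {U : Set ℂ} (hU : IsOpen U) {F : ℂ → ℂ} (hF : DifferentiableOn ℂ F U)
    (hR : ∀ p ∈ Icc a b ×ˢ Icc c d, toC p ∈ U) :
    GreenFor a b c d φx (fun p => φxx p + φyy p) (fun p => (F (toC p)).re) 0 := by
  have hK := isCompact_rect a b c d
  have hu := c2On_re hU hF hR
  have cb : ContinuousOn (fun y => (F (toC (a, y))).re) (uIcc c d) :=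
    hu.cont.comp (f := fun y => (a, y)) (by fun_prop) fun y hy => by
      rw [uIcc_of_le hcd] at hy
      exact ⟨⟨le_rfl, hab⟩, hy⟩
  refine ⟨hu.cont.integrableOn_compact hK, cb.intervalIntegrable,
    (hu.cont.mul hφ.contL).integrableOn_compact hK,
    (cb.mul (hφ.cont_left hab hcd)).intervalIntegrable, ?_⟩
  have g := green_rect hab hcd hu hφ
  simp only [add_neg_cancel, mul_zero, sub_zero] at g
  rw [g]
  ring

theorem log_norm_toC_sub (p : ℝ × ℝ) (ρ : ℂ) :
    Real.log ‖toC p - ρ‖ = logDist (ρ.re, ρ.im) p := by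
  rw [Complex.norm_def, Real.log_sqrt (Complex.normSq_nonneg _), logDist,
    Complex.normSq_apply]
  congr 2
  simp [toC]; ring

/-- On a disc a zero-free holomorphic function has a holomorphic logarithm. -/
theorem exists_log_norm_eq_re {g : ℂ → ℂ} {z : ℂ} {r : ℝ}
    (hg : DifferentiableOn ℂ g (Metric.ball z r)) (h0 : ∀ w ∈ Metric.ball z r, g w ≠ 0) :
    ∃ F : ℂ → ℂ, DifferentiableOn ℂ F (Metric.ball z r) ∧
      ∀ w ∈ Metric.ball z r, Real.log ‖g w‖ = (F w).re := by
  rcases le_or_gt r 0 with hr | hr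
  · rw [Metric.ball_eq_empty.2 hr]
    exact ⟨g, differentiableOn_empty, by simp⟩
  have ho : IsOpen (Metric.ball z r) := Metric.isOpen_ball
  -- F is a primitive of g'/g, which exists on a disc; g·exp(-F) is then a nonzero constant k,
  -- absorbed as log k.
  obtain ⟨F, hF⟩ := ((hg.deriv ho).div hg h0).isExactOn_ball
  have hd : ∀ w ∈ Metric.ball z r, HasDerivAt (fun w => g w * Complex.exp (-F w)) 0 w := by
    intro w hw
    have h1 := (hg.differentiableAt (ho.mem_nhds hw)).hasDerivAt
    refine (h1.fun_mul (hF w hw).fun_neg.cexp).congr_deriv ?_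
    have := h0 w hw
    simp only [Pi.div_apply]
    field_simp
    ring
  obtain ⟨k, hk⟩ := ho.exists_is_const_of_deriv_eq_zero (convex_ball z r).isPreconnected
    (fun w hw => (hd w hw).differentiableAt.differentiableWithinAt) (fun w hw => (hd w hw).deriv)
  have hz : z ∈ Metric.ball z r := Metric.mem_ball_self hr
  have hk0 : k ≠ 0 := by
    rw [← hk z hz]
    exact mul_ne_zero (h0 z hz) (Complex.exp_ne_zero _)
  refine ⟨fun w => F w + Complex.log k, fun w hw =>
    ((hF w hw).differentiableAt.add_const _).differentiableWithinAt, fun w hw => ?_⟩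
  have e : g w = Complex.exp (F w + Complex.log k) := by
    rw [Complex.exp_add, Complex.exp_log hk0, ← hk w hw, mul_left_comm, ← Complex.exp_add]
    simp
  rw [e, Complex.norm_exp, Real.log_exp]

/-- The logarithm of the modulus of a holomorphic function on a disc, up to a finite set, is a sum
of logarithmic poles plus a harmonic function. -/
theorem exists_log_norm_eq_sum {f : ℂ → ℂ} {z : ℂ} {r r' : ℝ} (hrr : r' < r)
    (hf : DifferentiableOn ℂ f (Metric.ball z r)) (hne : ∃ w ∈ Metric.ball z r, f w ≠ 0) :
    ∃ (Z : Finset ℂ) (F : ℂ → ℂ), DifferentiableOn ℂ F (Metric.ball z r') ∧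
      (∀ ρ ∈ Metric.ball z r', f ρ = 0 → ρ ∈ Z) ∧
      ∀ w ∈ Metric.ball z r', w ∉ Z → Real.log ‖f w‖ =
        ∑ ρ ∈ Z, (analyticOrderNatAt f ρ : ℝ) * Real.log ‖w - ρ‖ + (F w).re := by
  have hfa : AnalyticOnNhd ℂ f (Metric.ball z r) := hf.analyticOnNhd Metric.isOpen_ball
  have hsub : Metric.closedBall z r' ⊆ Metric.ball z r := Metric.closedBall_subset_ball hrr
  have hfc : AnalyticOnNhd ℂ f (Metric.closedBall z r') := hfa.mono hsub
  have hord : ∀ w ∈ Metric.ball z r, analyticOrderAt f w ≠ ⊤ := by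
    obtain ⟨w, hw, hw0⟩ := hne
    intro v hv
    refine hfa.analyticOrderAt_ne_top_of_isPreconnected (convex_ball z r).isPreconnected hw hv ?_
    rw [(analyticOrderAt_eq_zero).2 (Or.inr hw0)]
    exact ENat.zero_ne_top
  have hmer : ∀ w ∈ Metric.closedBall z r',
      meromorphicOrderAt f w = ((analyticOrderNatAt f w : ℤ) : WithTop ℤ) := by
    intro w hw
    rw [(hfc w hw).meromorphicOrderAt_eq, ← Nat.cast_analyticOrderNatAt (hord w (hsub hw))]
    rfl
  set D := MeromorphicOn.divisor f (Metric.closedBall z r') with hD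
  have hDfin : D.support.Finite := D.finiteSupport (isCompact_closedBall z r')
  have hDeq : ∀ w ∈ Metric.closedBall z r', D w = (analyticOrderNatAt f w : ℤ) := by
    intro w hw
    rw [hD, MeromorphicOn.divisor_apply hfc.meromorphicOn hw, hmer w hw]
    rfl
  obtain ⟨g, hga, hg0, hfg⟩ := hfc.meromorphicOn.extract_zeros_poles
    (fun w => by rw [hmer w w.2]; exact WithTop.coe_ne_top) hDfin
  have hlog := MeromorphicOn.extract_zeros_poles_log hg0 hfg
  have hbc : Metric.ball z r' ⊆ Metric.closedBall z r' := Metric.ball_subset_closedBall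
  obtain ⟨F, hF, hgF⟩ := exists_log_norm_eq_re
    (fun w hw => (hga w (hbc hw)).differentiableAt.differentiableWithinAt)
    (fun w hw => hg0 ⟨w, hbc hw⟩)
  have hz : ∀ ρ ∈ Metric.closedBall z r', f ρ = 0 → ρ ∈ hDfin.toFinset := by
    intro ρ hρ h0
    rw [Set.Finite.mem_toFinset, Function.mem_support, hDeq ρ hρ]
    have h1 : analyticOrderAt f ρ ≠ 0 := by
      rw [Ne, (hfc ρ hρ).analyticOrderAt_eq_zero]
      simpa using h0
    intro h2
    apply h1
    rw [← Nat.cast_analyticOrderNatAt (hord ρ (hsub hρ))]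
    exact_mod_cast h2
  refine ⟨hDfin.toFinset, F, hF, fun ρ hρ => hz ρ (hbc hρ), fun w hw hwZ => ?_⟩
  have hsum : ∀ w : ℂ, (∑ᶠ u, fun x => (D u : ℝ) * Real.log ‖x - u‖) w =
      ∑ ρ ∈ hDfin.toFinset, (analyticOrderNatAt f ρ : ℝ) * Real.log ‖w - ρ‖ := by
    intro w
    rw [finsum_eq_sum_of_support_subset (s := hDfin.toFinset), Finset.sum_apply]
    · refine Finset.sum_congr rfl fun ρ hρ => ?_
      rw [Set.Finite.mem_toFinset] at hρ
      rw [hDeq ρ (D.supportWithinDomain hρ)]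
      simp
    · intro u hu
      rw [Set.Finite.coe_toFinset, Function.mem_support]
      intro h
      apply hu
      ext x
      simp [h]
  -- The factorization only gives the identity off a discrete set; away from Z both sides are
  -- continuous, so it passes to w itself.
  have hev : ∀ᶠ v in 𝓝[≠] w, Real.log ‖f v‖ =
      ∑ ρ ∈ hDfin.toFinset, (analyticOrderNatAt f ρ : ℝ) * Real.log ‖v - ρ‖ + (F v).re := by
    have h1 := mem_codiscreteWithin.1 hlog w (hbc hw)
    rw [disjoint_principal_right] at h1
    filter_upwards [h1, mem_nhdsWithin_of_mem_nhds (Metric.isOpen_ball.mem_nhds hw)] with v hv hvb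
    simp only [mem_compl_iff, Set.mem_sdiff, not_and, not_not] at hv
    have h2 := hv (hbc hvb)
    simp only [mem_ofPred_eq, Pi.add_apply] at h2
    rw [h2, hsum, hgF v hvb]
  have l1 : Tendsto (fun v => Real.log ‖f v‖) (𝓝[≠] w) (𝓝 (Real.log ‖f w‖)) := by
    have hfw : f w ≠ 0 := fun h => hwZ (hz w (hbc hw) h)
    exact (((hfc w (hbc hw)).continuousAt.norm.log (norm_ne_zero_iff.2 hfw)).tendsto).mono_left
      nhdsWithin_le_nhds
  have l2 : ContinuousAt (fun v =>
      ∑ ρ ∈ hDfin.toFinset, (analyticOrderNatAt f ρ : ℝ) * Real.log ‖v - ρ‖ + (F v).re) w := by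
    refine ContinuousAt.add (tendsto_finsetSum _ fun ρ hρ => ?_) ?_
    · refine ContinuousAt.mul continuousAt_const (ContinuousAt.log (by fun_prop) ?_)
      rw [norm_ne_zero_iff, sub_ne_zero]
      rintro rfl
      exact hwZ hρ
    · exact Complex.continuous_re.continuousAt.comp
        (hF.differentiableAt (Metric.isOpen_ball.mem_nhds hw)).continuousAt
  exact tendsto_nhds_unique l1 ((l2.tendsto.mono_left nhdsWithin_le_nhds).congr'
    (hev.mono fun v hv => hv.symm))

/-- Green's identity for `log ‖f‖`, `f` holomorphic. -/
theorem greenFor_log_norm (hab : a ≤ b) (hcd : c ≤ d) (hφ : TestOn a b c d φ φx φy φxx φyy)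
    {f : ℂ → ℂ} {z : ℂ} {r : ℝ} (hf : DifferentiableOn ℂ f (Metric.ball z r))
    (hne : ∃ w ∈ Metric.ball z r, f w ≠ 0)
    (hR : ∀ p ∈ Icc a b ×ˢ Icc c d, toC p ∈ Metric.ball z r) (S : Finset ℂ)
    (hS : ∀ ρ, f ρ = 0 → (Icc a b ×ˢ Icc c d).indicator φ (ρ.re, ρ.im) ≠ 0 → ρ ∈ S) :
    GreenFor a b c d φx (fun p => φxx p + φyy p) (fun p => Real.log ‖f (toC p)‖)
      (2 * Real.pi * ∑ ρ ∈ S, (analyticOrderNatAt f ρ : ℝ) *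
        (Icc a b ×ˢ Icc c d).indicator φ (ρ.re, ρ.im)) := by
  classical
  -- A slightly smaller disc still contains the compact rectangle, and only finitely many zeros lie
  -- in its closure.
  obtain ⟨r', hr', hsub⟩ := exists_lt_subset_ball
    ((isCompact_rect a b c d).image continuous_toC).isClosed (image_subset_iff.2 hR)
  obtain ⟨Z, F, hF, hZ, hlog⟩ := exists_log_norm_eq_sum hr' hf hne
  have hR' : ∀ p ∈ Icc a b ×ˢ Icc c d, toC p ∈ Metric.ball z r' := fun p hp => hsub ⟨p, hp, rfl⟩
  have h1 := (GreenFor.sum Z fun ρ _ =>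
    (greenFor_logDist hab hcd hφ (ρ.re, ρ.im)).const_mul (analyticOrderNatAt f ρ : ℝ)).add
    (greenFor_re hab hcd hφ Metric.isOpen_ball hF hR')
  have hinj : Function.Injective toC := by
    intro p q h
    exact Prod.ext (congrArg Complex.re h) (congrArg Complex.im h)
  have h2 := h1.congr (v := fun p => Real.log ‖f (toC p)‖) (S := toC ⁻¹' (Z : Set ℂ))
    (Z.finite_toSet.preimage hinj.injOn) (fun p hp hpZ => by
      rw [hlog _ (hR' p hp) hpZ]
      simp_rw [log_norm_toC_sub]) hab hcd
  convert h2 using 1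
  rw [add_zero, Finset.mul_sum]
  -- Z and S need not agree, but a point in only one of them has multiplicity 0 or a vanishing test
  -- function, so both sums equal the sum over Z ∪ S.
  have hzero : ∀ ρ, ρ ∉ Z ∨ ρ ∉ S → ρ ∈ Z ∪ S → (analyticOrderNatAt f ρ : ℝ) *
      (2 * Real.pi * (Icc a b ×ˢ Icc c d).indicator φ (ρ.re, ρ.im)) = 0 := by
    intro ρ h _
    by_contra hcon
    have hφ0 : (Icc a b ×ˢ Icc c d).indicator φ (ρ.re, ρ.im) ≠ 0 := by
      intro h0; apply hcon; rw [h0, mul_zero, mul_zero]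
    have hm : (ρ.re, ρ.im) ∈ Icc a b ×ˢ Icc c d := mem_of_indicator_ne_zero hφ0
    have hf0 : f ρ = 0 := by
      by_contra h0
      apply hcon
      rw [analyticOrderNatAt, analyticOrderAt_eq_zero.2 (Or.inr h0)]
      simp
    have hb : ρ ∈ Metric.ball z r' := hR' _ hm
    rcases h with h | h
    · exact h (hZ ρ hb hf0)
    · exact h (hS ρ hf0 hφ0)
  have e1 : ∑ ρ ∈ Z, (analyticOrderNatAt f ρ : ℝ) *
      (2 * Real.pi * (Icc a b ×ˢ Icc c d).indicator φ (ρ.re, ρ.im)) =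
      ∑ ρ ∈ Z ∪ S, (analyticOrderNatAt f ρ : ℝ) *
      (2 * Real.pi * (Icc a b ×ˢ Icc c d).indicator φ (ρ.re, ρ.im)) :=
    Finset.sum_subset Finset.subset_union_left fun ρ h h' => hzero ρ (Or.inl h') h
  have e2 : ∑ ρ ∈ S, (analyticOrderNatAt f ρ : ℝ) *
      (2 * Real.pi * (Icc a b ×ˢ Icc c d).indicator φ (ρ.re, ρ.im)) =
      ∑ ρ ∈ Z ∪ S, (analyticOrderNatAt f ρ : ℝ) *
      (2 * Real.pi * (Icc a b ×ˢ Icc c d).indicator φ (ρ.re, ρ.im)) :=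
    Finset.sum_subset Finset.subset_union_right fun ρ h h' => hzero ρ (Or.inr h') h
  rw [e1, ← e2]
  exact Finset.sum_congr rfl fun ρ _ => by ring

end

end BalazardSaiasYor

namespace BalazardSaiasYor

/-! ### The zeta-function to the right of the imaginary axis -/

/-- Truncated to t > 1, so that its Mellin transform at -s is ∫₁^∞ {t} t^(-s-1) dt, holomorphic for
Re s > 0. -/
noncomputable def fractIndicator (t : ℝ) : ℂ := (Ioi (1 : ℝ)).indicator (fun t => ((Int.fract t : ℝ) : ℂ)) t

theorem norm_fractIndicator_le (t : ℝ) : ‖fractIndicator t‖ ≤ 1 := by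
  unfold fractIndicator
  by_cases h : t ∈ Ioi (1 : ℝ)
  · rw [indicator_of_mem h, Complex.norm_real, Real.norm_of_nonneg (Int.fract_nonneg t)]
    exact (Int.fract_lt_one t).le
  · rw [indicator_of_notMem h]; simp

theorem measurable_fractIndicator : Measurable fractIndicator :=
  Measurable.indicator (Complex.measurable_ofReal.comp measurable_fract) measurableSet_Ioi

theorem mellin_fractIndicator_eq (s : ℂ) :
    mellin fractIndicator (-s) = ∫ t in Ioi (1 : ℝ), ((Int.fract t : ℝ) : ℂ) * (t : ℂ) ^ (-(s + 1)) := by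
  have hsub : Ioi (1 : ℝ) ⊆ Ioi 0 := Ioi_subset_Ioi zero_le_one
  have e : ∀ t : ℝ, (t : ℂ) ^ (-s - 1) • fractIndicator t =
      (Ioi (1 : ℝ)).indicator (fun t => ((Int.fract t : ℝ) : ℂ) * (t : ℂ) ^ (-(s + 1))) t := by
    intro t
    unfold fractIndicator
    by_cases h : t ∈ Ioi (1 : ℝ)
    · rw [indicator_of_mem h, indicator_of_mem h, smul_eq_mul, mul_comm, neg_add']
    · rw [indicator_of_notMem h, indicator_of_notMem h, smul_zero]
  simp_rw [mellin, e]
  rw [setIntegral_indicator measurableSet_Ioi, inter_eq_self_of_subset_right hsub]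

theorem norm_mellin_fractIndicator_le {s : ℂ} (hs : 0 < s.re) :
    ‖mellin fractIndicator (-s)‖ ≤ 1 / s.re := by
  rw [mellin_fractIndicator_eq]
  have h1 : -(s.re + 1) < -1 := by linarith
  have e : ∫ t in Ioi (1 : ℝ), t ^ (-(s.re + 1)) = 1 / s.re := by
    rw [integral_Ioi_rpow_of_lt h1 one_pos, Real.one_rpow]
    have : -(s.re + 1) + 1 ≠ 0 := by linarith
    field_simp
    ring
  rw [← e]
  refine norm_integral_le_of_norm_le (integrableOn_Ioi_rpow_of_lt h1 one_pos) ?_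
  filter_upwards [ae_restrict_mem measurableSet_Ioi] with t ht
  have ht0 : 0 < t := one_pos.trans ht
  rw [norm_mul, Complex.norm_cpow_eq_rpow_re_of_pos ht0, Complex.norm_real,
    Real.norm_of_nonneg (Int.fract_nonneg t)]
  simp only [Complex.neg_re, Complex.add_re, Complex.one_re]
  exact mul_le_of_le_one_left (by positivity) (Int.fract_lt_one t).le

theorem differentiableAt_mellin_fractIndicator {s : ℂ} (hs : 0 < s.re) :
    DifferentiableAt ℂ (fun s => mellin fractIndicator (-s)) s := by
  have h : DifferentiableAt ℂ (mellin fractIndicator) (-s) := by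
    refine mellin_differentiableAt_of_isBigO_rpow (a := 0) (b := (-s).re - 1) ?_ ?_ (by simpa) ?_
      (by linarith)
    · refine LocallyIntegrable.locallyIntegrableOn ?_ _
      refine (locallyIntegrable_const (1 : ℝ)).mono
        measurable_fractIndicator.aestronglyMeasurable (Eventually.of_forall fun t => ?_)
      simpa using norm_fractIndicator_le t
    · refine Asymptotics.IsBigO.of_bound 1 (Eventually.of_forall fun t => ?_)
      simpa using norm_fractIndicator_le t
    · refine Asymptotics.IsBigO.of_bound 1 ?_
      filter_upwards [mem_nhdsWithin_of_mem_nhds (Iio_mem_nhds one_pos)] with t ht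
      have : t ∉ Ioi (1 : ℝ) := fun h => lt_asymm (mem_Ioi.1 h) (mem_Iio.1 ht)
      rw [fractIndicator, indicator_of_notMem this, norm_zero]
      positivity
  exact h.comp s differentiableAt_id.neg

/-- Partial summation gives s ∫₁^∞ ⌊t⌋ t^(-s-1) dt; then write ⌊t⌋ = t - {t}. -/
theorem riemannZeta_eq_of_one_lt_re {s : ℂ} (hs : 1 < s.re) :
    riemannZeta s = s / (s - 1) - s * mellin fractIndicator (-s) := by
  have hs1 : s - 1 ≠ 0 := by
    intro h
    have := congrArg Complex.re h
    simp at this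
    linarith
  rw [← LSeries_one_eq_riemannZeta hs, LSeries_eq_mul_integral 1 zero_le_one hs
    (LSeriesSummable_one_iff.2 hs), mellin_fractIndicator_eq]
  · have h1 : (-s).re < -1 := by simpa using hs
    have i1 : IntegrableOn (fun t : ℝ => (t : ℂ) ^ (-s)) (Ioi 1) :=
      integrableOn_Ioi_cpow_of_lt h1 one_pos
    have i2 : IntegrableOn (fun t : ℝ => ((Int.fract t : ℝ) : ℂ) * (t : ℂ) ^ (-(s + 1))) (Ioi 1) := by
      have h2 : (-(s + 1)).re < -1 := by simp; linarith
      refine (integrableOn_Ioi_cpow_of_lt h2 one_pos).bdd_mul (c := 1)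
        (Complex.measurable_ofReal.comp measurable_fract).aestronglyMeasurable ?_
      filter_upwards with t
      rw [Complex.norm_real, Real.norm_of_nonneg (Int.fract_nonneg t)]
      exact (Int.fract_lt_one t).le
    have e : ∫ t in Ioi (1 : ℝ), (∑ k ∈ Finset.Icc 1 ⌊t⌋₊, (1 : ℕ → ℂ) k) * (t : ℂ) ^ (-(s + 1)) =
        ∫ t in Ioi (1 : ℝ), ((t : ℂ) ^ (-s) - ((Int.fract t : ℝ) : ℂ) * (t : ℂ) ^ (-(s + 1))) := by
      refine setIntegral_congr_fun measurableSet_Ioi fun t ht => ?_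
      have ht0 : (0 : ℝ) < t := one_pos.trans ht
      have htc : (t : ℂ) ≠ 0 := by exact_mod_cast ht0.ne'
      have h3 : (⌊t⌋₊ : ℂ) = t - ((Int.fract t : ℝ) : ℂ) := by
        have : (⌊t⌋₊ : ℝ) = t - Int.fract t := by
          rw [natCast_floor_eq_intCast_floor ht0.le]
          exact (Int.self_sub_fract t).symm
        exact_mod_cast congrArg (Complex.ofReal) this
      have h4 : (t : ℂ) ^ (-s) = t * (t : ℂ) ^ (-(s + 1)) := by
        rw [show -s = 1 + -(s + 1) by ring, Complex.cpow_add _ _ htc, Complex.cpow_one]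
      simp only [Pi.one_apply, Finset.sum_const, Nat.card_Icc, add_tsub_cancel_right, nsmul_eq_mul,
        mul_one]
      rw [h3, h4]
      ring
    rw [e, integral_sub i1 i2, integral_Ioi_cpow_of_lt h1 one_pos]
    have : -s + 1 ≠ 0 := by rw [neg_add_eq_sub]; exact fun h => hs1 (by linear_combination -h)
    simp only [Complex.ofReal_one, Complex.one_cpow]
    rw [mul_sub]
    congr 1
    field_simp
    ring
  · refine Asymptotics.IsBigO.of_bound 1 (Eventually.of_forall fun n => ?_)
    simp

/-- Both sides are holomorphic for Re s > 0 and agree near 2, so the identity theorem applies.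
`riemannZeta₁` is the entire function (s-1)ζ(s). -/
theorem riemannZeta₁_eq {s : ℂ} (hs : 0 < s.re) :
    riemannZeta₁ s = s - s * (s - 1) * mellin fractIndicator (-s) := by
  have ho : IsOpen {s : ℂ | 0 < s.re} := isOpen_lt continuous_const Complex.continuous_re
  have hpre : IsPreconnected {s : ℂ | 0 < s.re} := (convex_halfSpace_re_gt 0).isPreconnected
  have a1 : AnalyticOnNhd ℂ riemannZeta₁ {s : ℂ | 0 < s.re} :=
    differentiable_riemannZeta₁.differentiableOn.analyticOnNhd ho
  have a2 : AnalyticOnNhd ℂ (fun s => s - s * (s - 1) * mellin fractIndicator (-s))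
      {s : ℂ | 0 < s.re} := by
    refine DifferentiableOn.analyticOnNhd (fun s hs => DifferentiableAt.differentiableWithinAt ?_) ho
    have := differentiableAt_mellin_fractIndicator hs
    fun_prop
  refine a1.eqOn_of_preconnected_of_eventuallyEq a2 hpre (z₀ := 2) (by simp) ?_ hs
  have : {s : ℂ | 1 < s.re} ∈ 𝓝 (2 : ℂ) :=
    (isOpen_lt continuous_const Complex.continuous_re).mem_nhds (by simp)
  filter_upwards [this] with s hs
  have hs1 : s ≠ 1 := by rintro rfl; simp at hs
  have h1 := riemannZeta_eq_inv_sub_mul hs1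
  rw [riemannZeta_eq_of_one_lt_re hs] at h1
  have := sub_ne_zero.2 hs1
  field_simp at h1
  rw [← h1]
  ring

/-- `((s - 1) / s) ζ(s)`, which has the modulus of `ζ` on the critical line and no pole at `1`. -/
noncomputable def zetaBlaschke (s : ℂ) : ℂ := riemannZeta₁ s / s

theorem zetaBlaschke_one : zetaBlaschke 1 = 1 := by simp [zetaBlaschke]

theorem differentiableOn_zetaBlaschke : DifferentiableOn ℂ zetaBlaschke {s : ℂ | 0 < s.re} := by
  intro s hs
  have : s ≠ 0 := by rintro rfl; simp at hs
  exact (differentiable_riemannZeta₁.differentiableAt.div differentiableAt_id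
    this).differentiableWithinAt

theorem zetaBlaschke_eq {s : ℂ} (hs : s ≠ 1) :
    zetaBlaschke s = (s - 1) / s * riemannZeta s := by
  rw [riemannZeta_eq_inv_sub_mul hs, zetaBlaschke]
  have := sub_ne_zero.2 hs
  field_simp

theorem norm_zetaBlaschke_le {s : ℂ} (hs : 0 < s.re) :
    ‖zetaBlaschke s‖ ≤ 1 + ‖s - 1‖ / s.re := by
  have h0 : s ≠ 0 := by rintro rfl; simp at hs
  have e : zetaBlaschke s = 1 - (s - 1) * mellin fractIndicator (-s) := by
    rw [zetaBlaschke, riemannZeta₁_eq hs]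
    field_simp
  rw [e]
  refine (norm_sub_le _ _).trans ?_
  rw [norm_one, norm_mul, div_eq_mul_one_div ‖s - 1‖]
  gcongr
  exact norm_mellin_fractIndicator_le hs

theorem log_norm_zetaBlaschke_le {s : ℂ} {T : ℝ} (hT : 2 ≤ T) (h1 : 1 / 4 ≤ s.re) (h2 : s.re ≤ 6)
    (h3 : |s.im| ≤ T + 4) : Real.log ‖zetaBlaschke s‖ ≤ 6 * Real.log T := by
  have hlog : 0 ≤ Real.log T := Real.log_nonneg (by linarith)
  rcases eq_or_ne (zetaBlaschke s) 0 with h | h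
  · rw [h, norm_zero, Real.log_zero]; positivity
  have e : 6 * Real.log T = Real.log (T ^ 6) := by rw [Real.log_pow]; norm_num
  rw [e]
  refine Real.log_le_log (norm_pos_iff.2 h) ((norm_zetaBlaschke_le (by linarith)).trans ?_)
  have hn : ‖s - 1‖ ≤ T + 9 := by
    refine (Complex.norm_le_abs_re_add_abs_im _).trans ?_
    have : |(s - 1).re| ≤ 5 := by
      rw [Complex.sub_re, Complex.one_re, abs_le]; constructor <;> linarith
    have : (s - 1).im = s.im := by simp
    rw [this]
    linarith
  have : ‖s - 1‖ / s.re ≤ 4 * (T + 9) := by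
    rw [div_le_iff₀ (by linarith)]
    nlinarith [norm_nonneg (s - 1)]
  -- For T ≥ 2, 1 + 4(T + 9) ≤ 32T ≤ T⁶, which is the source of the exponent 6.
  have h5 : (32 : ℝ) ≤ T ^ 5 := by
    calc (32 : ℝ) = 2 ^ 5 := by norm_num
      _ ≤ T ^ 5 := by gcongr
  nlinarith

/-- The line Re s = 1/2 is equidistant from 0 and 1. -/
theorem norm_zetaBlaschke_half (t : ℝ) :
    ‖zetaBlaschke (1 / 2 + t * Complex.I)‖ = ‖riemannZeta (1 / 2 + t * Complex.I)‖ := by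
  have hs : (1 / 2 + t * Complex.I : ℂ) ≠ 1 := by
    intro h
    have := congrArg Complex.re h
    norm_num at this
  rw [zetaBlaschke_eq hs, norm_mul, norm_div]
  have e : ‖(1 / 2 + t * Complex.I - 1 : ℂ)‖ = ‖(1 / 2 + t * Complex.I : ℂ)‖ := by
    rw [Complex.norm_def, Complex.norm_def]
    congr 1
    simp [Complex.normSq_apply]
    norm_num
  have h0 : ‖(1 / 2 + t * Complex.I : ℂ)‖ ≠ 0 := by
    rw [norm_ne_zero_iff]
    intro h
    have := congrArg Complex.re h
    norm_num at this
  rw [e, div_self h0, one_mul]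

theorem zetaBlaschke_eq_zero_iff {s : ℂ} (hs : 0 < s.re) :
    zetaBlaschke s = 0 ↔ riemannZeta s = 0 ∧ s.re < 1 := by
  rcases eq_or_ne s 1 with rfl | h1
  · simp [zetaBlaschke_one, riemannZeta_one_ne_zero]
  have h0 : s ≠ 0 := by rintro rfl; simp at hs
  have hiff : zetaBlaschke s = 0 ↔ riemannZeta s = 0 := by
    rw [zetaBlaschke_eq h1]
    simp [h0, sub_ne_zero.2 h1]
  rw [hiff]
  refine ⟨fun h => ⟨h, ?_⟩, fun h => h.1⟩
  by_contra! h2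
  exact riemannZeta_ne_zero_of_one_le_re h2 h

theorem analyticOrderNatAt_zetaBlaschke {s : ℂ} (h0 : s ≠ 0) (h1 : s ≠ 1) :
    analyticOrderNatAt zetaBlaschke s = analyticOrderNatAt riemannZeta s := by
  have e : zetaBlaschke =ᶠ[𝓝 s] (fun s => (s - 1) / s) * riemannZeta := by
    filter_upwards [isOpen_ne.mem_nhds h1] with w hw
    exact zetaBlaschke_eq hw
  have a1 : AnalyticAt ℂ (fun s : ℂ => (s - 1) / s) s :=
    (analyticAt_id.sub analyticAt_const).div analyticAt_id h0
  have a2 : AnalyticAt ℂ riemannZeta s := by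
    refine DifferentiableOn.analyticAt (s := {1}ᶜ) (fun w hw => ?_) (isOpen_ne.mem_nhds h1)
    exact (differentiableAt_riemannZeta hw).differentiableWithinAt
  rw [analyticOrderNatAt, analyticOrderNatAt, analyticOrderAt_congr e, analyticOrderAt_mul a1 a2,
    a1.analyticOrderAt_eq_zero.2 (div_ne_zero (sub_ne_zero.2 h1) h0), zero_add]

/-! ### Decay of log|ζ| for Re s ≥ 2 -/

/-- For n ≥ 2, n^(-σ) ≤ n^(-2) 2^(2-σ), and Σ_{n≥2} n^(-2) = π²/6 - 1 < 13/20. -/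
theorem norm_riemannZeta_sub_one_le {s : ℂ} (hs : 2 ≤ s.re) :
    ‖riemannZeta s - 1‖ ≤ 13 / 20 * 2 ^ (2 - s.re) := by
  have h1 : 1 < s.re := by linarith
  have hz2 : HasSum (fun n : ℕ => 1 / ((n : ℝ) + 2) ^ 2) (Real.pi ^ 2 / 6 - 1) := by
    have := (hasSum_nat_add_iff' 2).2 hasSum_zeta_two
    simpa [Finset.sum_range_succ] using this
  have hsum : Summable (fun n : ℕ => 1 / ((n : ℂ) + 1) ^ s) := by
    have := (summable_nat_add_iff 1).2 (Complex.summable_one_div_nat_cpow.2 h1)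
    simpa using this
  have e : riemannZeta s - 1 = ∑' n : ℕ, 1 / ((n : ℂ) + 2) ^ s := by
    rw [zeta_eq_tsum_one_div_nat_add_one_cpow h1, hsum.tsum_eq_zero_add]
    simp only [Nat.cast_zero, zero_add, Complex.one_cpow, div_one, add_sub_cancel_left]
    congr 1
    ext n
    push_cast
    ring_nf
  have hb : ∀ n : ℕ, ‖1 / ((n : ℂ) + 2) ^ s‖ ≤ 1 / ((n : ℝ) + 2) ^ 2 * 2 ^ (2 - s.re) := by
    intro n
    have h2 : (0 : ℝ) < (n : ℝ) + 2 := by positivity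
    have h3 : ((n : ℂ) + 2) = (((n : ℝ) + 2 : ℝ) : ℂ) := by push_cast; rfl
    rw [h3, norm_div, norm_one, Complex.norm_cpow_eq_rpow_re_of_pos h2, one_div, one_div,
      ← Real.rpow_neg h2.le]
    have h4 : -s.re = -2 + (2 - s.re) := by ring
    rw [h4, Real.rpow_add h2]
    have h5 : ((n : ℝ) + 2) ^ (-2 : ℝ) = (((n : ℝ) + 2) ^ 2)⁻¹ := by
      rw [Real.rpow_neg h2.le]; norm_num
    rw [h5]
    have h6 : ((n : ℝ) + 2) ^ (2 - s.re) ≤ 2 ^ (2 - s.re) :=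
      Real.rpow_le_rpow_of_nonpos two_pos (by linarith [Nat.cast_nonneg (α := ℝ) n]) (by linarith)
    gcongr
  rw [e]
  have h3 := tsum_of_norm_bounded (hz2.mul_right ((2 : ℝ) ^ (2 - s.re))) hb
  refine h3.trans ?_
  have hpi : Real.pi ^ 2 / 6 - 1 ≤ 13 / 20 := by
    nlinarith [Real.pi_lt_d4, Real.pi_pos]
  gcongr

/-- The decay is exponential, but the cube is what is used: against a weight growing like x it
leaves the integrable 1/x². -/
theorem abs_log_norm_riemannZeta_le {s : ℂ} (hs : 2 ≤ s.re) :
    |Real.log ‖riemannZeta s‖| ≤ 200 / s.re ^ 3 ∧ riemannZeta s ≠ 0 := by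
  have h1 := norm_riemannZeta_sub_one_le hs
  set e : ℝ := 13 / 20 * 2 ^ (2 - s.re) with he
  have h0 : 0 ≤ e := by positivity
  have h2 : (2 : ℝ) ^ (2 - s.re) ≤ 1 := Real.rpow_le_one_of_one_le_of_nonpos one_le_two (by linarith)
  have h3 : e ≤ 13 / 20 := by linarith
  have u : ‖riemannZeta s‖ ≤ 1 + e := by
    have := norm_le_insert' (riemannZeta s) 1
    rw [norm_one] at this
    linarith
  have l : 1 - e ≤ ‖riemannZeta s‖ := by
    have := norm_sub_norm_le (1 : ℂ) (riemannZeta s)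
    rw [norm_one, norm_sub_rev] at this
    linarith
  have hpos : 0 < ‖riemannZeta s‖ := by linarith
  have b1 : Real.log ‖riemannZeta s‖ ≤ e := by
    have := Real.log_le_sub_one_of_pos hpos
    linarith
  have b2 : -(3 * e) ≤ Real.log ‖riemannZeta s‖ := by
    have h4 := Real.one_sub_inv_le_log_of_pos hpos
    have h5 : ‖riemannZeta s‖⁻¹ ≤ (1 - e)⁻¹ := by gcongr; linarith
    -- Equivalent to e ≤ 2/3 for e > 0; hence the constant 13/20 above.
    have h6 : (1 - e)⁻¹ ≤ 1 + 3 * e := by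
      rw [inv_le_iff_one_le_mul₀ (by linarith)]
      nlinarith
    linarith
  refine ⟨?_, norm_pos_iff.1 hpos⟩
  have h7 : |Real.log ‖riemannZeta s‖| ≤ 3 * e := by rw [abs_le]; constructor <;> linarith
  refine h7.trans ?_
  have h8 : (2 : ℝ) ^ (2 - s.re) = 4 / 2 ^ s.re := by
    rw [Real.rpow_sub two_pos]; norm_num
  -- The cubic term of the exponential series, with log 2 > 13/20.
  have h9 : (s.re * (13 / 20)) ^ 3 / 6 ≤ 2 ^ s.re := by
    have h10 := Real.pow_div_factorial_le_exp (s.re * Real.log 2)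
      (by have := Real.log_two_gt_d9; positivity) 3
    have h11 : (2 : ℝ) ^ s.re = Real.exp (s.re * Real.log 2) := by
      rw [Real.rpow_def_of_pos two_pos, mul_comm]
    rw [h11]
    refine le_trans ?_ h10
    have := Real.log_two_gt_d9
    norm_num [Nat.factorial]
    gcongr
    linarith
  have hre : 0 < s.re ^ 3 := by positivity
  have h2p : (0 : ℝ) < 2 ^ s.re := by positivity
  have h12 : 3 * e = 39 / 5 / 2 ^ s.re := by rw [he, h8]; ring
  rw [h12, div_le_div_iff₀ h2p hre]
  nlinarith

end BalazardSaiasYor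

namespace BalazardSaiasYor

/-! ### Local integrability of `log |ζ|` -/

theorem volume_real_rect {a b c d : ℝ} (hab : a ≤ b) (hcd : c ≤ d) :
    volume.real (Icc a b ×ˢ Icc c d) = (b - a) * (d - c) := by
  rw [Measure.volume_eq_prod, measureReal_prod_prod, Real.volume_real_Icc_of_le hab,
    Real.volume_real_Icc_of_le hcd]

/-- |z - r| < r means |z|² < 2r Re z, so large discs tangent to the imaginary axis at 0 exhaust the
half-plane Re z > 0. -/
theorem exists_ball_rect {a : ℝ} (ha : 0 < a) (b c d : ℝ) :
    ∃ r : ℝ, 1 ≤ r ∧ ∀ p ∈ Icc a b ×ˢ Icc c d, toC p ∈ Metric.ball (r : ℂ) r := by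
  refine ⟨1 + (b ^ 2 + c ^ 2 + d ^ 2) / (2 * a), by
    have : 0 ≤ (b ^ 2 + c ^ 2 + d ^ 2) / (2 * a) := by positivity
    linarith, ?_⟩
  set r := 1 + (b ^ 2 + c ^ 2 + d ^ 2) / (2 * a) with hr
  have hr2 : (r - 1) * (2 * a) = b ^ 2 + c ^ 2 + d ^ 2 := by rw [hr]; field_simp; ring
  have hr1 : 1 ≤ r := by
    have : 0 ≤ (b ^ 2 + c ^ 2 + d ^ 2) / (2 * a) := by positivity
    linarith
  rintro ⟨x, y⟩ ⟨⟨hx1, hx2⟩, hy1, hy2⟩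
  simp only at hx1 hx2 hy1 hy2
  rw [Metric.mem_ball, Complex.dist_eq, ← sq_lt_sq₀ (norm_nonneg _) (by linarith), ← Complex.normSq_eq_norm_sq,
    Complex.normSq_apply]
  have e1 : (toC (x, y) - r).re = x - r := by simp [toC]
  have e2 : (toC (x, y) - r).im = y := by simp [toC]
  rw [e1, e2]
  have hx : x ^ 2 ≤ b ^ 2 := by nlinarith
  have hy : y ^ 2 ≤ c ^ 2 + d ^ 2 := by
    rcases le_total 0 y with h | h <;> nlinarith [sq_nonneg c, sq_nonneg d]
  nlinarith

theorem greenFor_zetaBlaschke {a b c d : ℝ} (ha : 0 < a) (hab : a ≤ b) (hcd : c ≤ d)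
    {φ φx φy φxx φyy : ℝ × ℝ → ℝ} (hφ : TestOn a b c d φ φx φy φxx φyy) (S : Finset ℂ)
    (hS : ∀ ρ, zetaBlaschke ρ = 0 → (Icc a b ×ˢ Icc c d).indicator φ (ρ.re, ρ.im) ≠ 0 → ρ ∈ S) :
    GreenFor a b c d φx (fun p => φxx p + φyy p) (fun p => Real.log ‖zetaBlaschke (toC p)‖)
      (2 * Real.pi * ∑ ρ ∈ S, (analyticOrderNatAt zetaBlaschke ρ : ℝ) *
        (Icc a b ×ˢ Icc c d).indicator φ (ρ.re, ρ.im)) := by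
  obtain ⟨r, hr, hball⟩ := exists_ball_rect ha b c d
  refine greenFor_log_norm hab hcd hφ (z := r) (r := r)
    (differentiableOn_zetaBlaschke.mono fun w hw => ?_) ⟨1, ?_, ?_⟩ hball S hS
  · rw [Metric.mem_ball, Complex.dist_eq] at hw
    have h1 := (Complex.abs_re_le_norm (w - r)).trans_lt hw
    rw [abs_lt] at h1
    simp at h1
    exact h1.1
  · rw [Metric.mem_ball, Complex.dist_eq]
    have : ‖(1 : ℂ) - r‖ = |1 - r| := by
      rw [← Complex.ofReal_one, ← Complex.ofReal_sub, Complex.norm_real, Real.norm_eq_abs]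
    rw [this, abs_lt]
    constructor <;> linarith
  · rw [zetaBlaschke_one]; exact one_ne_zero

/-! ### Test functions on discs and the L¹ bound for log|f| -/

theorem hasDerivAt_max_pow (n : ℕ) (t : ℝ) :
    HasDerivAt (fun t : ℝ => max t 0 ^ (n + 2)) ((n + 2 : ℕ) * max t 0 ^ (n + 1)) t := by
  have h := hasDerivAt_ite_lt (f := fun _ => 0) (f' := fun _ => 0) (a := 0)
    (g := fun t => t ^ (n + 2)) (g' := fun t => (n + 2 : ℕ) * t ^ (n + 1))
    (fun t _ => hasDerivAt_const t 0) (fun t _ => by simpa using hasDerivAt_pow (n + 2) t)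
    (by simp) (by simp) t
  have e1 : (fun t : ℝ => max t 0 ^ (n + 2)) = fun t => if t < 0 then 0 else t ^ (n + 2) := by
    ext t
    split_ifs with ht
    · simp [max_eq_right ht.le]
    · simp [max_eq_left (not_lt.1 ht)]
  rw [e1]
  refine h.congr_deriv ?_
  split_ifs with ht
  · simp [max_eq_right ht.le]
  · simp [max_eq_left (not_lt.1 ht)]

/-- `R² - |p - (3, t)|²` with `R = 11/4`. -/
noncomputable def discDefect (t : ℝ) (p : ℝ × ℝ) : ℝ := 121 / 16 - (p.1 - 3) ^ 2 - (p.2 - t) ^ 2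

/-- In terms of the distance r to the centre, the Laplacian of (R² - r²)ⁿ is 4n(R² - r²)^(n-2)(n r²
- R²). With n = 9 and R = 11/4 it is negative only for r < 11/12, inside the unit disc about 3 + it,
where Re s ≥ 2; the support still stays in Re s ≥ 1/4. -/
theorem testOn_disc (t : ℝ) :
    TestOn (1 / 4) (23 / 4) (t - 11 / 4) (t + 11 / 4) (fun p => max (discDefect t p) 0 ^ 9)
      (fun p => -(18 * (p.1 - 3)) * max (discDefect t p) 0 ^ 8)
      (fun p => -(18 * (p.2 - t)) * max (discDefect t p) 0 ^ 8)
      (fun p => -18 * max (discDefect t p) 0 ^ 8 +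
        288 * (p.1 - 3) ^ 2 * max (discDefect t p) 0 ^ 7)
      (fun p => -18 * max (discDefect t p) 0 ^ 8 +
        288 * (p.2 - t) ^ 2 * max (discDefect t p) 0 ^ 7) := by
  have e1 : ∀ p : ℝ × ℝ, HasDerivAt (fun x => discDefect t (x, p.2)) (-(2 * (p.1 - 3))) p.1 :=
    fun p => by
      refine (((((hasDerivAt_id' p.1).sub_const 3).fun_pow 2).const_sub
        (121 / 16)).sub_const ((p.2 - t) ^ 2)).congr_deriv ?_
      simp
  have e2 : ∀ p : ℝ × ℝ, HasDerivAt (fun y => discDefect t (p.1, y)) (-(2 * (p.2 - t))) p.2 :=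
    fun p => by
      refine ((((hasDerivAt_id' p.2).sub_const t).fun_pow 2).const_sub
        (121 / 16 - (p.1 - 3) ^ 2)).congr_deriv ?_
      simp
  have hc : Continuous (discDefect t) := by unfold discDefect; fun_prop
  have hx0 : ∀ x y : ℝ, (x = 1 / 4 ∨ x = 23 / 4) → max (discDefect t (x, y)) 0 = 0 := by
    intro x y h
    refine max_eq_right ?_
    simp only [discDefect]
    rcases h with rfl | rfl <;> nlinarith [sq_nonneg (y - t)]
  have hy0 : ∀ x y : ℝ, (y = t - 11 / 4 ∨ y = t + 11 / 4) → max (discDefect t (x, y)) 0 = 0 := by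
    intro x y h
    refine max_eq_right ?_
    simp only [discDefect]
    rcases h with rfl | rfl <;> nlinarith [sq_nonneg (x - 3)]
  refine ⟨⟨fun p _ => ?_, fun p _ => ?_, fun p _ => ?_, fun p _ => ?_, ?_, ?_, ?_, ?_, ?_⟩,
    fun y _ => ?_, fun y _ => ?_, fun y _ => ?_, fun x _ => ?_, fun x _ => ?_, fun x _ => ?_,
    fun x _ => ?_⟩
  · refine ((hasDerivAt_max_pow 7 _).comp p.1 (e1 p)).congr_deriv ?_
    push_cast; ring
  · refine ((hasDerivAt_max_pow 7 _).comp p.2 (e2 p)).congr_deriv ?_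
    push_cast; ring
  · refine ((((hasDerivAt_id' p.1).sub_const 3).const_mul 18).fun_neg.fun_mul
      ((hasDerivAt_max_pow 6 _).comp p.1 (e1 p))).congr_deriv ?_
    simp only [Function.comp]; push_cast; ring
  · refine ((((hasDerivAt_id' p.2).sub_const t).const_mul 18).fun_neg.fun_mul
      ((hasDerivAt_max_pow 6 _).comp p.2 (e2 p))).congr_deriv ?_
    simp only [Function.comp]; push_cast; ring
  · fun_prop
  · fun_prop
  · fun_prop
  · fun_prop
  · fun_prop
  all_goals
    first
    | rw [hx0 _ _ (Or.inl rfl)]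
    | rw [hx0 _ _ (Or.inr rfl)]
    | rw [hy0 _ _ (Or.inl rfl)]
    | rw [hy0 _ _ (Or.inr rfl)]
    simp

/-- A is the target box, D the disc where the Laplacian L may be negative. Off D the product (M -
u)L is nonnegative; on D the lower bound u ≥ -B makes the loss at most (M + B)K. -/
theorem indicator_nonneg_le {M B K κ u L : ℝ} {A D : Prop} [Decidable A] [Decidable D] (huM : u ≤ M)
    (hM : 0 ≤ M) (hB : 0 ≤ B) (hK : |L| ≤ K) (hAD : A → ¬D) (hD : D → -B ≤ u) (hL : ¬D → 0 ≤ L)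
    (hA : A → κ ≤ L) :
    κ * (if A then M - u else 0) ≤ (M - u) * L + (M + B) * K := by
  have hK0 : 0 ≤ K := (abs_nonneg L).trans hK
  have hL' := abs_le.1 hK
  by_cases h : D
  · have hA' : ¬A := fun hA => hAD hA h
    rw [if_neg hA']
    have := hD h
    nlinarith
  · have h1 := hL h
    have h2 : 0 ≤ (M + B) * K := by positivity
    by_cases h' : A
    · rw [if_pos h']
      have := hA h'
      nlinarith
    · rw [if_neg h']
      nlinarith [mul_nonneg (sub_nonneg.2 huM) h1]

/-- 26 = 200/2³ + 1: the first part bounds log|ζ|, and |(s-1)/s| ≥ 1/2 costs at most 1. -/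
theorem neg_le_log_norm_zetaBlaschke {s : ℂ} (hs : 2 ≤ s.re) :
    -26 ≤ Real.log ‖zetaBlaschke s‖ := by
  obtain ⟨h1, h2⟩ := abs_log_norm_riemannZeta_le hs
  have hs1 : s ≠ 1 := by rintro rfl; norm_num at hs
  have hs0 : s ≠ 0 := by rintro rfl; norm_num at hs
  have n1 : 0 < ‖s - 1‖ := norm_pos_iff.2 (sub_ne_zero.2 hs1)
  have n0 : 0 < ‖s‖ := norm_pos_iff.2 hs0
  rw [zetaBlaschke_eq hs1, norm_mul, Real.log_mul (by simp [hs0, sub_ne_zero.2 hs1])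
    (norm_ne_zero_iff.2 h2), norm_div]
  have h3 : 200 / s.re ^ 3 ≤ 25 := by
    rw [div_le_iff₀ (by positivity)]
    have : (2 : ℝ) ^ 3 ≤ s.re ^ 3 := by gcongr
    linarith
  have h4 : 1 / 2 ≤ ‖s - 1‖ / ‖s‖ := by
    rw [div_le_div_iff₀ two_pos n0]
    have h5 : ‖s‖ ≤ ‖s - 1‖ + 1 := by
      have := norm_add_le (s - 1) 1
      simpa using this
    have h6 : 1 ≤ ‖s - 1‖ := by
      have := Complex.abs_re_le_norm (s - 1)
      have h7 := le_abs_self (s - 1).re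
      simp at this h7
      linarith
    linarith
  have h5 : Real.log (1 / 2) ≤ Real.log (‖s - 1‖ / ‖s‖) := Real.log_le_log (by norm_num) h4
  have h6 : -1 ≤ Real.log (1 / 2) := by
    rw [one_div, Real.log_inv]
    have := Real.log_two_lt_d9
    linarith
  have := (abs_le.1 h1).1
  linarith

/-- The Laplacian of the test function of `testOn_disc`. -/
noncomputable def discLap (t : ℝ) (p : ℝ × ℝ) : ℝ :=
  36 * (8 * ((p.1 - 3) ^ 2 + (p.2 - t) ^ 2) * max (discDefect t p) 0 ^ 7 -
    max (discDefect t p) 0 ^ 8)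

theorem exists_abs_discLap_le : ∃ K : ℝ, 0 < K ∧ ∀ t : ℝ,
    ∀ p ∈ Icc (1 / 4 : ℝ) (23 / 4) ×ˢ Icc (t - 11 / 4) (t + 11 / 4), |discLap t p| ≤ K := by
  refine ⟨36 * 17 * (121 / 16) ^ 8, by positivity, ?_⟩
  rintro t p ⟨⟨hx1, hx2⟩, hy1, hy2⟩
  have hsq1 : (p.1 - 3) ^ 2 ≤ 121 / 16 := by nlinarith
  have hsq2 : (p.2 - t) ^ 2 ≤ 121 / 16 := by nlinarith
  have hs1 := sq_nonneg (p.1 - 3)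
  have hs2 := sq_nonneg (p.2 - t)
  have hm0 : 0 ≤ max (discDefect t p) 0 := le_max_right _ _
  have hm1 : max (discDefect t p) 0 ≤ 121 / 16 :=
    max_le (by unfold discDefect; linarith) (by norm_num)
  have hp8 : max (discDefect t p) 0 ^ 8 ≤ (121 / 16) ^ 8 := by gcongr
  have hq8 : 0 ≤ max (discDefect t p) 0 ^ 8 := by positivity
  have h1 : 0 ≤ ((p.1 - 3) ^ 2 + (p.2 - t) ^ 2) * max (discDefect t p) 0 ^ 7 := by positivity
  have h2 : ((p.1 - 3) ^ 2 + (p.2 - t) ^ 2) * max (discDefect t p) 0 ^ 7 ≤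
      (2 * (121 / 16)) * (121 / 16) ^ 7 := by
    gcongr
    linarith
  rw [discLap, abs_le]
  constructor <;> linarith

theorem discLap_eq {t : ℝ} {p : ℝ × ℝ} (h : 0 ≤ discDefect t p) : discLap t p =
    36 * (discDefect t p ^ 7 * (9 * ((p.1 - 3) ^ 2 + (p.2 - t) ^ 2) - 121 / 16)) := by
  rw [discLap, max_eq_left h]
  have : discDefect t p ^ 8 = discDefect t p ^ 7 * discDefect t p := pow_succ _ _
  rw [this]
  nth_rewrite 3 [discDefect]
  ring

theorem discLap_nonneg {t : ℝ} {p : ℝ × ℝ} (h : 1 ≤ (p.1 - 3) ^ 2 + (p.2 - t) ^ 2) :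
    0 ≤ discLap t p := by
  rcases le_or_gt (discDefect t p) 0 with h0 | h0
  · rw [discLap, max_eq_right h0]; norm_num
  · rw [discLap_eq h0.le]
    have : 0 ≤ 9 * ((p.1 - 3) ^ 2 + (p.2 - t) ^ 2) - 121 / 16 := by linarith
    positivity

theorem le_discLap {t : ℝ} {p : ℝ × ℝ}
    (hp : p ∈ Icc (1 / 2 : ℝ) 2 ×ˢ Icc (t - 1 / 2) (t + 1 / 2)) : 36 ≤ discLap t p := by
  obtain ⟨⟨h1, h2⟩, h3, h4⟩ := hp
  have h5 : (p.1 - 3) ^ 2 ≤ 25 / 4 := by nlinarith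
  have h5' : 1 ≤ (p.1 - 3) ^ 2 := by nlinarith
  have h6 : (p.2 - t) ^ 2 ≤ 1 / 4 := by nlinarith
  have h7 : 1 ≤ discDefect t p := by rw [discDefect]; linarith
  rw [discLap_eq (by linarith)]
  have h8 : 1 ≤ discDefect t p ^ 7 := one_le_pow₀ h7
  have h9 : 1 ≤ 9 * ((p.1 - 3) ^ 2 + (p.2 - t) ^ 2) - 121 / 16 := by
    linarith [sq_nonneg (p.2 - t)]
  have := one_le_mul_of_one_le_of_one_le h8 h9
  linarith

/-- The Jensen-type inequality: the test function and its x-derivative both vanish on the left side,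
so the integral equals 2π times a sum of multiplicities against nonnegative values. -/
theorem setIntegral_log_zetaBlaschke_mul_discLap_nonneg (t : ℝ) :
    IntegrableOn (fun p => Real.log ‖zetaBlaschke (toC p)‖)
      (Icc (1 / 4 : ℝ) (23 / 4) ×ˢ Icc (t - 11 / 4) (t + 11 / 4)) ∧
    IntegrableOn (fun p => Real.log ‖zetaBlaschke (toC p)‖ * discLap t p)
      (Icc (1 / 4 : ℝ) (23 / 4) ×ˢ Icc (t - 11 / 4) (t + 11 / 4)) ∧
    0 ≤ ∫ p in Icc (1 / 4 : ℝ) (23 / 4) ×ˢ Icc (t - 11 / 4) (t + 11 / 4),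
      Real.log ‖zetaBlaschke (toC p)‖ * discLap t p := by
  have hφ := testOn_disc t
  have hfin : ((Icc (1 / 4 : ℝ) (23 / 4) ×ℂ Icc (t - 11 / 4) (t + 11 / 4)) ∩
      riemannZetaZeros).Finite :=
    (isCompact_Icc.reProdIm isCompact_Icc).inter_riemannZetaZeros_finite
  have g := greenFor_zetaBlaschke (by norm_num) (by norm_num) (by linarith) hφ hfin.toFinset
    (fun ρ h0 h1 => by
      have hm := mem_of_indicator_ne_zero h1
      rw [Set.Finite.mem_toFinset]
      exact ⟨⟨hm.1, hm.2⟩, ((zetaBlaschke_eq_zero_iff (by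
        have := hm.1.1; simp only at this; linarith)).1 h0).1⟩)
  have hL : (fun p : ℝ × ℝ => -18 * max (discDefect t p) 0 ^ 8 +
        288 * (p.1 - 3) ^ 2 * max (discDefect t p) 0 ^ 7 + (-18 * max (discDefect t p) 0 ^ 8 +
        288 * (p.2 - t) ^ 2 * max (discDefect t p) 0 ^ 7)) = discLap t := by
    ext p
    rw [discLap]
    ring
  rw [hL] at g
  refine ⟨g.int, g.intL, ?_⟩
  have h1 := g.eq
  have h2 : ∫ y in (t - 11 / 4)..(t + 11 / 4), Real.log ‖zetaBlaschke (toC (1 / 4, y))‖ *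
      (-(18 * ((1 / 4 : ℝ) - 3)) * max (discDefect t (1 / 4, y)) 0 ^ 8) = 0 := by
    refine (intervalIntegral.integral_congr (g := fun _ => 0) fun y _ => ?_).trans (by simp)
    have : max (discDefect t (1 / 4, y)) 0 = 0 := by
      refine max_eq_right ?_
      rw [discDefect]
      nlinarith [sq_nonneg (y - t)]
    simp only [this]
    ring
  rw [h2, add_zero] at h1
  rw [h1]
  refine mul_nonneg (by positivity) (Finset.sum_nonneg fun ρ _ => mul_nonneg (by positivity) ?_)
  exact indicator_nonneg (fun p _ => by positivity) _

theorem continuous_discLap (t : ℝ) : Continuous (discLap t) := by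
  unfold discLap discDefect
  fun_prop

/-- Write M = 6 log T ≥ u. Since ∫ u·discLap ≥ 0, the integral of (M - u)·discLap is O(M); it
dominates 36 ∫_A (M - u) up to the loss on the inner disc, and |u| ≤ M + (M - u). -/
theorem exists_setIntegral_abs_log_zetaBlaschke_le :
    ∃ C : ℝ, 0 ≤ C ∧ ∀ T t : ℝ, 2 ≤ T → |t| = T + 1 / 2 →
      ∫ p in Icc (1 / 2) 2 ×ˢ Icc (t - 1 / 2) (t + 1 / 2), |Real.log ‖zetaBlaschke (toC p)‖| ≤
        C * Real.log T := by
  classical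
  obtain ⟨K, hK0, hK⟩ := exists_abs_discLap_le
  set V : ℝ := 11 / 2 * (11 / 2) with hV
  have hV0 : 0 < V := by positivity
  -- The box has area 3/2, and 26 ≤ 52 log T because log T ≥ 1/2.
  refine ⟨6 * (3 / 2) + ((6 + 6 + 52) * (K * V)) / 36, by positivity, fun T t hT ht => ?_⟩
  set M := 6 * Real.log T with hM
  have hlogT : 1 / 2 ≤ Real.log T := by
    have h1 := Real.log_le_log two_pos hT
    have := Real.log_two_gt_d9
    linarith
  have hM0 : 0 ≤ M := by positivity
  obtain ⟨iu, iuL, hpos⟩ := setIntegral_log_zetaBlaschke_mul_discLap_nonneg t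
  specialize hK t
  set R := Icc (1 / 4 : ℝ) (23 / 4) ×ˢ Icc (t - 11 / 4) (t + 11 / 4) with hR
  set A := Icc (1 / 2 : ℝ) 2 ×ˢ Icc (t - 1 / 2) (t + 1 / 2) with hA
  set u : ℝ × ℝ → ℝ := fun p => Real.log ‖zetaBlaschke (toC p)‖ with hu
  have mR : MeasurableSet R := (isCompact_rect _ _ _ _).measurableSet
  have mA : MeasurableSet A := (isCompact_rect _ _ _ _).measurableSet
  have hAR : A ⊆ R := prod_mono (Icc_subset_Icc (by norm_num) (by norm_num))
    (Icc_subset_Icc (by linarith) (by linarith))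
  have huM : ∀ p ∈ R, u p ≤ M := by
    rintro p ⟨⟨hx1, hx2⟩, hy1, hy2⟩
    refine log_norm_zetaBlaschke_le hT hx1 (by simp only [toC]; linarith) ?_
    have h1 : |p.2| ≤ |p.2 - t| + |t| := by simpa using abs_add_le (p.2 - t) t
    have h2 : |p.2 - t| ≤ 11 / 4 := by rw [abs_le]; constructor <;> linarith
    simp only [toC]
    linarith
  have key : ∀ p ∈ R, 36 * (if p ∈ A then M - u p else 0) ≤
      (M - u p) * discLap t p + (M + 26) * K := by
    intro p hp
    refine indicator_nonneg_le (D := (p.1 - 3) ^ 2 + (p.2 - t) ^ 2 < 1) (huM p hp) hM0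
      (by norm_num) (hK p hp) ?_ ?_ (fun h => discLap_nonneg (not_lt.1 h)) le_discLap
    · rintro ⟨⟨_, h1⟩, _⟩
      nlinarith [sq_nonneg (p.2 - t)]
    · intro h
      refine neg_le_log_norm_zetaBlaschke ?_
      simp only [toC]
      nlinarith [sq_nonneg (p.2 - t)]
  have iuA : IntegrableOn u A := iu.mono_set hAR
  have iconst : ∀ k : ℝ, IntegrableOn (fun _ => k) R := fun k =>
    continuousOn_const.integrableOn_compact (isCompact_rect _ _ _ _)
  have iconstA : ∀ k : ℝ, IntegrableOn (fun _ => k) A := fun k =>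
    continuousOn_const.integrableOn_compact (isCompact_rect _ _ _ _)
  have iL : IntegrableOn (discLap t) R :=
    (continuous_discLap t).continuousOn.integrableOn_compact (isCompact_rect _ _ _ _)
  have vR : volume.real R = V := by
    rw [hR, volume_real_rect (by norm_num) (by linarith), hV]; ring
  have vA : volume.real A = 3 / 2 := by
    rw [hA, volume_real_rect (by norm_num) (by linarith)]; ring
  have hLK : ∫ p in R, discLap t p ≤ K * V := by
    calc ∫ p in R, discLap t p ≤ ∫ _ in R, K :=
          setIntegral_mono_on iL (iconst K) mR fun p hp => (abs_le.1 (hK p hp)).2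
      _ = K * V := by rw [setIntegral_const, vR, smul_eq_mul, mul_comm]
  have i1 : IntegrableOn (fun p => M * discLap t p - u p * discLap t p) R :=
    (iL.const_mul M).sub iuL
  have i2 : IntegrableOn (fun p => M - u p) A := (iconstA M).sub iuA
  have int1 : 36 * ∫ p in A, (M - u p) ≤ M * (K * V) + (M + 26) * K * V := by
    have h1 : ∫ p in R, 36 * (if p ∈ A then M - u p else 0) ≤
        ∫ p in R, ((M * discLap t p - u p * discLap t p) + (M + 26) * K) := by
      refine setIntegral_mono_on ?_ ?_ mR ?_
      · refine Integrable.const_mul ?_ _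
        refine (i2.integrable_indicator mA).integrableOn.congr_fun
          (fun p _ => ?_) mR
        simp only [indicator_apply]
      · exact i1.add (iconst _)
      · intro p hp
        have := key p hp
        linarith
    rw [integral_const_mul, integral_add i1 (iconst _),
      integral_sub (iL.const_mul M) iuL, integral_const_mul, setIntegral_const, vR] at h1
    have h2 : ∫ p in R, (if p ∈ A then M - u p else 0) = ∫ p in A, (M - u p) := by
      have : (fun p => if p ∈ A then M - u p else 0) = A.indicator fun p => M - u p := by
        ext p; simp only [indicator_apply]
      rw [this, setIntegral_indicator mA, inter_eq_self_of_subset_right hAR]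
    rw [h2] at h1
    have : M * ∫ p in R, discLap t p ≤ M * (K * V) := by gcongr
    rw [smul_eq_mul] at h1
    linarith
  have int2 : ∫ p in A, |u p| ≤ ∫ p in A, (M + (M - u p)) := by
    refine setIntegral_mono_on iuA.abs ((iconstA M).add ((iconstA M).sub iuA)) mA fun p hp => ?_
    have := huM p (hAR hp)
    rw [abs_le]
    constructor <;> linarith
  have int3 : ∫ p in A, (M + (M - u p)) = 3 / 2 * M + ∫ p in A, (M - u p) := by
    rw [integral_add (iconstA M) i2, setIntegral_const, vA, smul_eq_mul]
  have h26 : 26 * (K * V) ≤ 52 * Real.log T * (K * V) := by gcongr; linarith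
  rw [int3] at int2
  refine int2.trans ?_
  generalize ∫ p in A, (M - u p) = I at int1 ⊢
  rw [hM] at int1 ⊢
  clear_value V M
  linarith

end BalazardSaiasYor

namespace BalazardSaiasYor

/-! ### Cutoff functions -/

noncomputable def step (x : ℝ) : ℝ := Real.smoothTransition x

noncomputable def step' : ℝ → ℝ := deriv step

noncomputable def step'' : ℝ → ℝ := deriv step'

theorem contDiff_step : ContDiff ℝ 2 step := Real.smoothTransition.contDiff

theorem contDiff_step' : ContDiff ℝ 1 step' := by
  have : ContDiff ℝ (1 + 1) step := by simpa [one_add_one_eq_two] using contDiff_step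
  exact (contDiff_succ_iff_deriv.1 this).2.2

theorem hasDerivAt_step (x : ℝ) : HasDerivAt step (step' x) x :=
  (contDiff_step.differentiable (by norm_num) x).hasDerivAt

theorem hasDerivAt_step' (x : ℝ) : HasDerivAt step' (step'' x) x :=
  (contDiff_step'.differentiable (by norm_num) x).hasDerivAt

theorem continuous_step : Continuous step := contDiff_step.continuous

theorem continuous_step' : Continuous step' := contDiff_step'.continuous

theorem continuous_step'' : Continuous step'' := contDiff_step'.continuous_deriv le_rfl

theorem step_of_nonpos {x : ℝ} (h : x ≤ 0) : step x = 0 := Real.smoothTransition.zero_of_nonpos h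

theorem step_of_one_le {x : ℝ} (h : 1 ≤ x) : step x = 1 := Real.smoothTransition.one_of_one_le h

theorem step_nonneg (x : ℝ) : 0 ≤ step x := Real.smoothTransition.nonneg x

theorem step_le_one (x : ℝ) : step x ≤ 1 := Real.smoothTransition.le_one x

/-- On the open half-lines f is locally constant; continuity of the derivative adds the endpoints 0
and 1. -/
theorem deriv_eq_zero_of_const_outside {f : ℝ → ℝ} {k l : ℝ} (hf : Continuous (deriv f))
    (h0 : ∀ x ≤ 0, f x = k) (h1 : ∀ x, 1 ≤ x → f x = l) {x : ℝ} (hx : x ≤ 0 ∨ 1 ≤ x) :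
    deriv f x = 0 := by
  have hc : IsClosed {x | deriv f x = 0} := isClosed_eq hf continuous_const
  rcases hx with hx | hx
  · have : Iio (0 : ℝ) ⊆ {x | deriv f x = 0} := by
      intro y hy
      have : f =ᶠ[𝓝 y] fun _ => k := by
        filter_upwards [Iio_mem_nhds hy] with z hz using h0 z (le_of_lt hz)
      exact this.deriv_eq.trans (deriv_const y k)
    have h2 := closure_minimal this hc
    rw [closure_Iio] at h2
    exact h2 hx
  · have : Ioi (1 : ℝ) ⊆ {x | deriv f x = 0} := by
      intro y hy
      have : f =ᶠ[𝓝 y] fun _ => l := by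
        filter_upwards [Ioi_mem_nhds hy] with z hz using h1 z (le_of_lt hz)
      exact this.deriv_eq.trans (deriv_const y l)
    have h2 := closure_minimal this hc
    rw [closure_Ioi] at h2
    exact h2 hx

theorem step'_eq_zero {x : ℝ} (hx : x ≤ 0 ∨ 1 ≤ x) : step' x = 0 :=
  deriv_eq_zero_of_const_outside continuous_step' (fun _ => step_of_nonpos)
    (fun _ => step_of_one_le) hx

theorem step''_eq_zero {x : ℝ} (hx : x ≤ 0 ∨ 1 ≤ x) : step'' x = 0 :=
  deriv_eq_zero_of_const_outside continuous_step'' (fun _ h => step'_eq_zero (Or.inl h))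
    (fun _ h => step'_eq_zero (Or.inr h)) hx

theorem exists_bound_of_zero_outside {f : ℝ → ℝ} (hf : Continuous f)
    (h0 : ∀ x, x ≤ 0 ∨ 1 ≤ x → f x = 0) : ∃ B : ℝ, 0 ≤ B ∧ ∀ x, |f x| ≤ B := by
  obtain ⟨B, hB⟩ := isCompact_Icc.exists_bound_of_continuousOn (s := Icc (0 : ℝ) 1) hf.continuousOn
  have hB0 : 0 ≤ B := (norm_nonneg _).trans (hB 0 (by simp))
  refine ⟨B, hB0, fun x => ?_⟩
  by_cases hx : x ∈ Icc (0 : ℝ) 1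
  · exact hB x hx
  · rw [mem_Icc, not_and_or, not_le, not_le] at hx
    rw [h0 x (hx.imp le_of_lt le_of_lt), abs_zero]
    exact hB0

theorem exists_step_bound : ∃ B : ℝ, 0 ≤ B ∧ (∀ x, |step' x| ≤ B) ∧ ∀ x, |step'' x| ≤ B := by
  obtain ⟨B, h1, h2⟩ := exists_bound_of_zero_outside continuous_step' fun _ => step'_eq_zero
  obtain ⟨B', h3, h4⟩ := exists_bound_of_zero_outside continuous_step'' fun _ => step''_eq_zero
  exact ⟨max B B', le_max_of_le_left h1, fun x => (h2 x).trans (le_max_left _ _),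
    fun x => (h4 x).trans (le_max_right _ _)⟩

/-- A smooth even cutoff, equal to `1` on `[-T, T]` and to `0` outside `[-T - 1, T + 1]`. -/
noncomputable def cut (T y : ℝ) : ℝ := step (T + 1 - y) * step (T + 1 + y)

noncomputable def cut' (T y : ℝ) : ℝ :=
  -step' (T + 1 - y) * step (T + 1 + y) + step (T + 1 - y) * step' (T + 1 + y)

noncomputable def cut'' (T y : ℝ) : ℝ :=
  step'' (T + 1 - y) * step (T + 1 + y) - 2 * (step' (T + 1 - y) * step' (T + 1 + y)) +
    step (T + 1 - y) * step'' (T + 1 + y)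

theorem hasDerivAt_cut (T y : ℝ) : HasDerivAt (cut T) (cut' T y) y := by
  have h1 : HasDerivAt (fun y => T + 1 - y) (-1) y := (hasDerivAt_id' y).const_sub _
  have h2 : HasDerivAt (fun y => T + 1 + y) 1 y := (hasDerivAt_id' y).const_add _
  refine (((hasDerivAt_step _).comp y h1).fun_mul ((hasDerivAt_step _).comp y h2)).congr_deriv ?_
  simp [cut']

theorem hasDerivAt_cut' (T y : ℝ) : HasDerivAt (cut' T) (cut'' T y) y := by
  have h1 : HasDerivAt (fun y => T + 1 - y) (-1) y := (hasDerivAt_id' y).const_sub _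
  have h2 : HasDerivAt (fun y => T + 1 + y) 1 y := (hasDerivAt_id' y).const_add _
  refine (((((hasDerivAt_step' _).comp y h1).fun_neg).fun_mul
    ((hasDerivAt_step _).comp y h2)).fun_add
    (((hasDerivAt_step _).comp y h1).fun_mul ((hasDerivAt_step' _).comp y h2))).congr_deriv ?_
  simp only [cut'', Function.comp]
  ring

theorem continuous_cut (T : ℝ) : Continuous (cut T) :=
  continuous_iff_continuousAt.2 fun x => (hasDerivAt_cut T x).continuousAt

theorem continuous_cut' (T : ℝ) : Continuous (cut' T) :=
  continuous_iff_continuousAt.2 fun x => (hasDerivAt_cut' T x).continuousAt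

theorem continuous_cut'' (T : ℝ) : Continuous (cut'' T) := by
  have h0 := continuous_step
  have h1 := continuous_step'
  have h2 := continuous_step''
  unfold cut''
  fun_prop

theorem cut_nonneg (T y : ℝ) : 0 ≤ cut T y := mul_nonneg (step_nonneg _) (step_nonneg _)

theorem cut_le_one (T y : ℝ) : cut T y ≤ 1 :=
  mul_le_one₀ (step_le_one _) (step_nonneg _) (step_le_one _)

theorem cut_eq_one {T y : ℝ} (h : |y| ≤ T) : cut T y = 1 := by
  have := abs_le.1 h
  rw [cut, step_of_one_le (by linarith), step_of_one_le (by linarith), one_mul]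

theorem cut_eq_zero {T y : ℝ} (h : T + 1 ≤ |y|) : cut T y = 0 := by
  rcases le_abs.1 h with h | h
  · rw [cut, step_of_nonpos (by linarith), zero_mul]
  · rw [cut, mul_comm, step_of_nonpos (by linarith), zero_mul]

theorem cut_deriv_eq_zero {T y : ℝ} (h : |y| ≤ T ∨ T + 1 ≤ |y|) :
    cut' T y = 0 ∧ cut'' T y = 0 := by
  rcases h with h | h
  · have := abs_le.1 h
    have h1 : 1 ≤ T + 1 - y := by linarith
    have h2 : 1 ≤ T + 1 + y := by linarith
    simp [cut', cut'', step'_eq_zero (Or.inr h1), step'_eq_zero (Or.inr h2),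
      step''_eq_zero (Or.inr h1), step''_eq_zero (Or.inr h2)]
  · rcases le_abs.1 h with h | h
    · have h1 : T + 1 - y ≤ 0 := by linarith
      simp [cut', cut'', step'_eq_zero (Or.inl h1), step''_eq_zero (Or.inl h1), step_of_nonpos h1]
    · have h1 : T + 1 + y ≤ 0 := by linarith
      simp [cut', cut'', step'_eq_zero (Or.inl h1), step''_eq_zero (Or.inl h1), step_of_nonpos h1]

theorem exists_cut_bound :
    ∃ B : ℝ, 0 ≤ B ∧ (∀ T y, |cut' T y| ≤ B) ∧ ∀ T y, |cut'' T y| ≤ B := by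
  obtain ⟨B, hB, h1, h2⟩ := exists_step_bound
  have h0 : ∀ x, |step x| ≤ 1 := fun x => by
    rw [abs_of_nonneg (step_nonneg x)]; exact step_le_one x
  refine ⟨2 * B + 2 * (B * B), by positivity, fun T y => ?_, fun T y => ?_⟩
  · rw [cut']
    refine (abs_add_le _ _).trans ?_
    rw [abs_mul, abs_mul, abs_neg]
    have a1 := mul_le_mul (h1 (T + 1 - y)) (h0 (T + 1 + y)) (abs_nonneg _) hB
    have a2 := mul_le_mul (h0 (T + 1 - y)) (h1 (T + 1 + y)) (abs_nonneg _) zero_le_one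
    nlinarith
  · rw [cut'']
    refine (abs_add_le _ _).trans ((add_le_add_left (abs_sub _ _) _).trans ?_)
    rw [abs_mul, abs_mul, abs_mul (step' _), abs_mul (step _), abs_two]
    have a1 := mul_le_mul (h2 (T + 1 - y)) (h0 (T + 1 + y)) (abs_nonneg _) hB
    have a2 := mul_le_mul (h0 (T + 1 - y)) (h2 (T + 1 + y)) (abs_nonneg _) zero_le_one
    have a3 := mul_le_mul (h1 (T + 1 - y)) (h1 (T + 1 + y)) (abs_nonneg _) hB
    linarith

/-- A smooth cutoff, equal to `1` on `(-∞, X]` and to `0` on `[X + 1, ∞)`. -/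
noncomputable def cutR (X x : ℝ) : ℝ := step (X + 1 - x)

noncomputable def cutR' (X x : ℝ) : ℝ := -step' (X + 1 - x)

noncomputable def cutR'' (X x : ℝ) : ℝ := step'' (X + 1 - x)

theorem hasDerivAt_cutR (X x : ℝ) : HasDerivAt (cutR X) (cutR' X x) x := by
  have h1 : HasDerivAt (fun x => X + 1 - x) (-1) x := (hasDerivAt_id' x).const_sub _
  refine ((hasDerivAt_step _).comp x h1).congr_deriv ?_
  simp [cutR']

theorem hasDerivAt_cutR' (X x : ℝ) : HasDerivAt (cutR' X) (cutR'' X x) x := by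
  have h1 : HasDerivAt (fun x => X + 1 - x) (-1) x := (hasDerivAt_id' x).const_sub _
  refine ((hasDerivAt_step' _).comp x h1).fun_neg.congr_deriv ?_
  simp [cutR'']

theorem continuous_cutR (X : ℝ) : Continuous (cutR X) :=
  continuous_iff_continuousAt.2 fun x => (hasDerivAt_cutR X x).continuousAt

theorem continuous_cutR' (X : ℝ) : Continuous (cutR' X) :=
  continuous_iff_continuousAt.2 fun x => (hasDerivAt_cutR' X x).continuousAt

theorem continuous_cutR'' (X : ℝ) : Continuous (cutR'' X) :=
  continuous_step''.comp (by fun_prop)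

theorem cutR_eq_one {X x : ℝ} (h : x ≤ X) : cutR X x = 1 := step_of_one_le (by linarith)

theorem cutR_deriv_eq_zero {X x : ℝ} (h : x ≤ X ∨ X + 1 ≤ x) :
    cutR' X x = 0 ∧ cutR'' X x = 0 := by
  have : X + 1 - x ≤ 0 ∨ 1 ≤ X + 1 - x := by
    rcases h with h | h
    · right; linarith
    · left; linarith
  simp [cutR', cutR'', step'_eq_zero this, step''_eq_zero this]

theorem cutR_eq_zero {X x : ℝ} (h : X + 1 ≤ x) : cutR X x = 0 := step_of_nonpos (by linarith)

theorem abs_cutR_le (X x : ℝ) : |cutR X x| ≤ 1 := by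
  rw [cutR, abs_of_nonneg (step_nonneg _)]; exact step_le_one _

/-! ### Green's function of the half-plane `Re s > 1/2` with pole `1` -/

noncomputable def gr (p : ℝ × ℝ) : ℝ :=
  Real.log (p.1 ^ 2 + p.2 ^ 2) / 2 - Real.log ((p.1 - 1) ^ 2 + p.2 ^ 2) / 2

noncomputable def grx (p : ℝ × ℝ) : ℝ :=
  p.1 / (p.1 ^ 2 + p.2 ^ 2) - (p.1 - 1) / ((p.1 - 1) ^ 2 + p.2 ^ 2)

noncomputable def gry (p : ℝ × ℝ) : ℝ :=
  p.2 / (p.1 ^ 2 + p.2 ^ 2) - p.2 / ((p.1 - 1) ^ 2 + p.2 ^ 2)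

/-- `gr` with its poles smoothed out at scale `1/c`. -/
noncomputable def regGr (c : ℝ) (p : ℝ × ℝ) : ℝ :=
  regLog c (p - (0, 0)) - regLog c (p - (1, 0))

noncomputable def regGrx (c : ℝ) (p : ℝ × ℝ) : ℝ :=
  regLogD c (p.1 - 0) (p - (0, 0)) - regLogD c (p.1 - 1) (p - (1, 0))

noncomputable def regGry (c : ℝ) (p : ℝ × ℝ) : ℝ :=
  regLogD c (p.2 - 0) (p - (0, 0)) - regLogD c (p.2 - 0) (p - (1, 0))

/-- For c ≥ 2 the smoothing radius is at most 1/2, so the pole 0 is never felt in Re s ≥ 1/2; only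
the disc around 1 matters. -/
theorem regGr_eq {c : ℝ} {p : ℝ × ℝ} (hc : 2 ≤ c) (hx : 1 / 2 ≤ p.1)
    (hp : 1 ≤ c ^ 2 * ((p.1 - 1) ^ 2 + p.2 ^ 2)) :
    regGr c p = gr p ∧ regGrx c p = grx p ∧ regGry c p = gry p := by
  have hc0 : 0 < c := by linarith
  have h0 : 1 ≤ c ^ 2 * ((p - (0, 0)).1 ^ 2 + (p - (0, 0)).2 ^ 2) := by
    simp only [Prod.fst_sub, Prod.snd_sub, sub_zero]
    have h1 : 1 / 4 ≤ p.1 ^ 2 := by nlinarith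
    have h2 : 4 ≤ c ^ 2 := by nlinarith
    nlinarith [sq_nonneg p.2]
  have h1 : 1 ≤ c ^ 2 * ((p - (1, 0)).1 ^ 2 + (p - (1, 0)).2 ^ 2) := by
    simpa only [Prod.fst_sub, Prod.snd_sub, sub_zero] using hp
  rw [regGr, regGrx, regGry, regLog_eq hc0 h0, regLog_eq hc0 h1, regLogD_eq hc0 _ h0,
    regLogD_eq hc0 _ h1, regLogD_eq hc0 _ h0, regLogD_eq hc0 _ h1]
  simp only [Prod.fst_sub, Prod.snd_sub, sub_zero]
  exact ⟨rfl, rfl, rfl⟩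

/-- Exact even after smoothing: the two distances agree and the log c terms cancel. So the test
function vanishes on the critical line. -/
theorem regGr_half (c y : ℝ) : regGr c (1 / 2, y) = 0 := by
  simp only [regGr, regLog, Prod.fst_sub, Prod.snd_sub]
  norm_num

theorem grx_half (y : ℝ) : grx (1 / 2, y) = 1 / (1 / 4 + y ^ 2) := by
  simp only [grx]
  norm_num
  ring

/-- The part of the Laplacian of `regGr c * cutR X * cut T` that comes from the cutoffs. -/
noncomputable def cutLap (X T : ℝ) (p : ℝ × ℝ) : ℝ :=
  cutR X p.1 * (2 * gry p * cut' T p.2 + gr p * cut'' T p.2) +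
    cut T p.2 * (2 * grx p * cutR' X p.1 + gr p * cutR'' X p.1)

/-- A test function on `[1/2, X + 1] × [-(T + 1), T + 1]` built from `gr`. -/
theorem exists_testOn_regGr {X T c : ℝ} (hX : 2 ≤ X) (hT : 2 ≤ T) (hc : 2 ≤ c) :
    ∃ φx φy φxx φyy : ℝ × ℝ → ℝ,
      TestOn (1 / 2) (X + 1) (-(T + 1)) (T + 1)
        (fun p => regGr c p * (cutR X p.1 * cut T p.2)) φx φy φxx φyy ∧
      (∀ y, φx (1 / 2, y) = cut T y / (1 / 4 + y ^ 2)) ∧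
      ∀ p ∈ Icc (1 / 2) (X + 1) ×ˢ Icc (-(T + 1)) (T + 1), φxx p + φyy p =
        cutLap X T p - regKernel c (p - (1, 0)) * (cutR X p.1 * cut T p.2) := by
  have h := ((c2On_regLog c (0, 0) (Icc (1 / 2) (X + 1) ×ˢ Icc (-(T + 1)) (T + 1))).sub
    (c2On_regLog c (1, 0) _)).mul (C2On.prod (hasDerivAt_cutR X) (hasDerivAt_cutR' X)
      (continuous_cutR'' X) (hasDerivAt_cut T) (hasDerivAt_cut' T) (continuous_cut'' T) _)
  have absT : |T + 1| = T + 1 := abs_of_nonneg (by linarith)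
  have z1 : cut T (T + 1) = 0 := cut_eq_zero absT.ge
  have z2 : cut T (-(T + 1)) = 0 := cut_eq_zero (by rw [abs_neg]; exact absT.ge)
  have z3 : cut' T (T + 1) = 0 := (cut_deriv_eq_zero (Or.inr absT.ge)).1
  have z4 : cut' T (-(T + 1)) = 0 := (cut_deriv_eq_zero (Or.inr (by rw [abs_neg]; exact absT.ge))).1
  have z5 : cutR X (X + 1) = 0 := cutR_eq_zero le_rfl
  have z6 : cutR' X (X + 1) = 0 := (cutR_deriv_eq_zero (Or.inr le_rfl)).1
  refine ⟨_, _, _, _, ⟨h, ?_, ?_, ?_, ?_, ?_, ?_, ?_⟩, ?_, ?_⟩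
  · intro y _
    simp only [regGr_half, zero_mul]
  · intro y _
    simp [z5]
  · intro y _
    simp [z5, z6]
  · intro x _
    simp only [z2, mul_zero]
  · intro x _
    simp only [z2, z4, mul_zero, add_zero]
  · intro x _
    simp [z1]
  · intro x _
    simp [z1, z3]
  · intro y
    have hy : 1 ≤ c ^ 2 * (((1 / 2 : ℝ) - 1) ^ 2 + y ^ 2) := by
      have h2 : 4 ≤ c ^ 2 := by nlinarith
      nlinarith [sq_nonneg y]
    have e := (regGr_eq (p := (1 / 2, y)) hc le_rfl hy).2.1
    have e0 := regGr_half c y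
    rw [grx_half] at e
    change regGrx c (1 / 2, y) * (cutR X (1 / 2) * cut T y) +
      regGr c (1 / 2, y) * (cutR' X (1 / 2) * cut T y) = _
    rw [e, e0, cutR_eq_one (by linarith)]
    ring
  · rintro p ⟨⟨hx1, hx2⟩, hy1, hy2⟩
    have k0 : regKernel c (p - (0, 0)) = 0 := by
      refine regKernel_eq_zero ?_
      simp only [Prod.fst_sub, Prod.snd_sub, sub_zero]
      have h1 : 1 / 4 ≤ p.1 ^ 2 := by nlinarith
      have h2 : 4 ≤ c ^ 2 := by nlinarith
      nlinarith [sq_nonneg p.2]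
    have k1 := regLogDD_add c (p - (0, 0))
    have k2 := regLogDD_add c (p - (1, 0))
    simp only [Prod.fst_sub, Prod.snd_sub] at k1 k2
    rw [k0] at k1
    -- Outside the smoothing disc `regGr` is `gr`; inside it both cutoffs are locally constant, as
    -- X, T ≥ 2, and both sides are 0.
    have main : 2 * (regGrx c p * (cutR' X p.1 * cut T p.2)) +
        2 * (regGry c p * (cutR X p.1 * cut' T p.2)) +
        regGr c p * (cutR'' X p.1 * cut T p.2 + cutR X p.1 * cut'' T p.2) = cutLap X T p := by
      by_cases hp : 1 ≤ c ^ 2 * ((p.1 - 1) ^ 2 + p.2 ^ 2)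
      · obtain ⟨e1, e2, e3⟩ := regGr_eq hc hx1 hp
        rw [e1, e2, e3, cutLap]
        ring
      · push Not at hp
        have h2 : 4 ≤ c ^ 2 := by nlinarith
        have h3 : (p.1 - 1) ^ 2 + p.2 ^ 2 < 1 := by
          by_contra! h4
          nlinarith
        have h4 : |p.2| ≤ T := by
          have : |p.2| ≤ 1 := by
            rw [abs_le]; constructor <;> nlinarith [sq_nonneg (p.1 - 1)]
          linarith
        have h5 : p.1 ≤ X := by nlinarith [sq_nonneg p.2]
        obtain ⟨a1, a2⟩ := cut_deriv_eq_zero (Or.inl h4)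
        obtain ⟨a3, a4⟩ := cutR_deriv_eq_zero (Or.inl h5)
        simp [cutLap, a1, a2, a3, a4]
    rw [← main]
    simp only [regGr, regGrx, regGry]
    linear_combination (cutR X p.1 * cut T p.2) * (k1 - k2)

end BalazardSaiasYor

namespace BalazardSaiasYor

/-! ### The smoothed identity -/

noncomputable def logZB (p : ℝ × ℝ) : ℝ := Real.log ‖zetaBlaschke (toC p)‖

theorem gr_eq {ρ : ℂ} (h0 : ρ ≠ 0) (h1 : ρ ≠ 1) : gr (ρ.re, ρ.im) = Real.log ‖ρ / (1 - ρ)‖ := by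
  have hn : ∀ z : ℂ, Real.log ‖z‖ = Real.log (z.re ^ 2 + z.im ^ 2) / 2 := fun z => by
    rw [Complex.norm_def, Real.log_sqrt (Complex.normSq_nonneg _), Complex.normSq_apply]
    ring_nf
  have h1' : 1 - ρ ≠ 0 := sub_ne_zero.2 h1.symm
  rw [norm_div, Real.log_div (norm_ne_zero_iff.2 h0) (norm_ne_zero_iff.2 h1'), hn, hn, gr]
  congr 3
  simp
  ring

theorem logZB_half (y : ℝ) : logZB (1 / 2, y) =
    Real.log ‖riemannZeta (1 / 2 + (y : ℂ) * Complex.I)‖ := by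
  rw [logZB, ← norm_zetaBlaschke_half, toC_eq]
  norm_num

theorem zetaBlaschke_zero_mem {T : ℝ} {ρ : ℂ} (h0 : zetaBlaschke ρ = 0) (h1 : 1 / 2 < ρ.re)
    (h2 : -T ≤ ρ.im) (h3 : ρ.im ≤ T) : ρ ∈ zerosRightOfLine T := by
  have h := (zetaBlaschke_eq_zero_iff (by linarith)).1 h0
  exact ⟨⟨h.1, by linarith, h.2⟩, ⟨h2, h3⟩, h1⟩

theorem ne_of_mem_zeros {T : ℝ} {ρ : ℂ} (h : ρ ∈ zerosRightOfLine T) : ρ ≠ 0 ∧ ρ ≠ 1 := by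
  obtain ⟨⟨_, h1, h2⟩, _, _⟩ := h
  constructor
  · rintro rfl; simp at h1
  · rintro rfl; simp at h2

/-- The weighted sum over zeros, smoothed by the cutoff. -/
noncomputable def smoothZeroSum (T : ℝ) : ℝ :=
  ∑ ρ ∈ (zerosRightOfLine_finite (T + 1)).toFinset,
    (analyticOrderNatAt riemannZeta ρ : ℝ) * (cut T ρ.im * Real.log ‖ρ / (1 - ρ)‖)

/-- Green's identity for log|f| against the regularized g times the cutoffs, as c → ∞. -/
theorem logZB_identity {X T : ℝ} (hX : 2 ≤ X) (hT : 2 ≤ T) :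
    IntegrableOn logZB (Icc (1 / 2) (X + 1) ×ˢ Icc (-(T + 1)) (T + 1)) ∧
    IntervalIntegrable (fun y => logZB (1 / 2, y)) volume (-(T + 1)) (T + 1) ∧
    (∫ p in Icc (1 / 2) (X + 1) ×ˢ Icc (-(T + 1)) (T + 1), logZB p * cutLap X T p) +
      ∫ y in (-(T + 1))..(T + 1), logZB (1 / 2, y) * (cut T y / (1 / 4 + y ^ 2)) =
      2 * Real.pi * smoothZeroSum T := by
  set R := Icc (1 / 2) (X + 1) ×ˢ Icc (-(T + 1)) (T + 1) with hR
  have hK : IsCompact R := isCompact_rect _ _ _ _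
  have mR : MeasurableSet R := hK.measurableSet
  have hab : 1 / 2 ≤ X + 1 := by linarith
  have hcd : -(T + 1) ≤ T + 1 := by linarith
  set S := (zerosRightOfLine_finite (T + 1)).toFinset with hS
  set J := ∫ y in (-(T + 1))..(T + 1), logZB (1 / 2, y) * (cut T y / (1 / 4 + y ^ 2)) with hJ
  set χ : ℝ × ℝ → ℝ := fun p => cutR X p.1 * cut T p.2 with hχ
  have cχ : Continuous χ := by
    have h1 := continuous_cutR X
    have h2 := continuous_cut T
    fun_prop
  have hmemR : ∀ ρ ∈ S, (ρ.re, ρ.im) ∈ R := by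
    intro ρ hρ
    obtain ⟨⟨_, _, h1⟩, h2, h3⟩ := (Set.Finite.mem_toFinset _).1 hρ
    exact ⟨⟨h3.le, by simp only; linarith⟩, h2⟩
  -- Green's identity at scale `1/c`
  have green : ∀ c : ℝ, 2 ≤ c → IntegrableOn logZB R ∧
      IntervalIntegrable (fun y => logZB (1 / 2, y)) volume (-(T + 1)) (T + 1) ∧
      IntegrableOn (fun p => logZB p * (cutLap X T p - regKernel c (p - (1, 0)) * χ p)) R ∧
      (∫ p in R, logZB p * (cutLap X T p - regKernel c (p - (1, 0)) * χ p)) + J =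
        2 * Real.pi * ∑ ρ ∈ S, (analyticOrderNatAt zetaBlaschke ρ : ℝ) *
          (regGr c (ρ.re, ρ.im) * χ (ρ.re, ρ.im)) := by
    intro c hc
    obtain ⟨φx, φy, φxx, φyy, hφ, hφx, hL⟩ := exists_testOn_regGr hX hT hc
    have g := greenFor_zetaBlaschke (by norm_num) hab hcd hφ S (fun ρ h0 h1 => by
      have hm := mem_of_indicator_ne_zero h1
      rw [indicator_of_mem hm] at h1
      rw [hS, Set.Finite.mem_toFinset]
      -- A zero on the critical line is discarded because the test function vanishes there; only β >
      -- 1/2 remains.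
      refine zetaBlaschke_zero_mem h0 (lt_of_le_of_ne hm.1.1 fun h => h1 ?_) hm.2.1 hm.2.2
      rw [← h, regGr_half, zero_mul])
    refine ⟨g.int, g.intb, g.intL.congr_fun (fun p hp => ?_) mR, ?_⟩
    · simp only
      rw [hL p hp]; rfl
    · have h := g.eq
      rw [setIntegral_congr_fun (g := fun p => logZB p * (cutLap X T p -
        regKernel c (p - (1, 0)) * χ p)) mR (fun p hp => by
          simp only
          rw [hL p hp]; rfl)] at h
      rw [← hR] at h
      have e : ∑ ρ ∈ S, (analyticOrderNatAt zetaBlaschke ρ : ℝ) *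
          R.indicator (fun p => regGr c p * (cutR X p.1 * cut T p.2)) (ρ.re, ρ.im) =
          ∑ ρ ∈ S, (analyticOrderNatAt zetaBlaschke ρ : ℝ) *
          (regGr c (ρ.re, ρ.im) * χ (ρ.re, ρ.im)) := by
        refine Finset.sum_congr rfl fun ρ hρ => ?_
        rw [indicator_of_mem (hmemR ρ hρ)]
      rw [e] at h
      rw [← h]
      congr 1
      refine intervalIntegral.integral_congr fun y _ => ?_
      simp only [hφx]
      rfl
  obtain ⟨iu, ib, iL2, -⟩ := green 2 le_rfl
  have ik : ∀ c, IntegrableOn (fun p => logZB p * (regKernel c (p - (1, 0)) * χ p)) R := by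
    intro c
    refine iu.mul_continuousOn (ContinuousOn.mul ?_ cχ.continuousOn) hK
    exact ((continuous_regKernel c).comp (by fun_prop)).continuousOn
  have iW : IntegrableOn (fun p => logZB p * cutLap X T p) R := by
    refine (iL2.add (ik 2)).congr_fun (fun p _ => ?_) mR
    simp only [Pi.add_apply]
    ring
  refine ⟨iu, ib, ?_⟩
  -- the limit `c → ∞`
  set w : ℝ × ℝ → ℝ := R.indicator fun p => logZB p * χ p with hw
  have iw : Integrable w := by
    rw [integrable_indicator_iff mR]
    exact iu.mul_continuousOn cχ.continuousOn hK
  -- The mass of g at its pole picks out log|f(1)| = 0, so the pole leaves no main term.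
  have hlog0 : logZB (1, 0) = 0 := by
    have : toC (1, 0) = 1 := by apply Complex.ext <;> simp [toC]
    rw [logZB, this, zetaBlaschke_one]; simp
  have hw0 : w (1, 0) = 0 := by
    by_cases h : ((1, 0) : ℝ × ℝ) ∈ R
    · rw [hw, indicator_of_mem h, hlog0, zero_mul]
    · rw [hw, indicator_of_notMem h]
  have cw : ContinuousAt w (1, 0) := by
    have hRn : R ∈ 𝓝 ((1, 0) : ℝ × ℝ) :=
      prod_mem_nhds (Icc_mem_nhds (by norm_num) (by linarith)) (Icc_mem_nhds (by linarith)
        (by linarith))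
    have h1 : ContinuousAt (fun p => logZB p * χ p) (1, 0) := by
      refine ContinuousAt.mul ?_ cχ.continuousAt
      have e1 : toC (1, 0) = 1 := by apply Complex.ext <;> simp [toC]
      refine ContinuousAt.log ?_ ?_
      · refine ContinuousAt.norm (ContinuousAt.comp (g := zetaBlaschke) ?_
          continuous_toC.continuousAt)
        rw [e1]
        refine (differentiableOn_zetaBlaschke.differentiableAt ?_).continuousAt
        exact (isOpen_lt continuous_const Complex.continuous_re).mem_nhds (by simp)
      · rw [e1, zetaBlaschke_one]; simp
    refine h1.congr ?_
    filter_upwards [hRn] with p hp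
    rw [hw, indicator_of_mem hp]
  have t1 := tendsto_integral_regKernel iw cw
  rw [hw0, mul_zero] at t1
  have hsum : ∀ᶠ c : ℝ in atTop, ∑ ρ ∈ S, (analyticOrderNatAt zetaBlaschke ρ : ℝ) *
      (regGr c (ρ.re, ρ.im) * χ (ρ.re, ρ.im)) = smoothZeroSum T := by
    -- None of these finitely many zeros is 1, so for large c they all lie outside the smoothing
    -- disc.
    have hev : ∀ᶠ c : ℝ in atTop, ∀ ρ ∈ S,
        1 ≤ c ^ 2 * ((ρ.re - 1) ^ 2 + ρ.im ^ 2) := by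
      rw [Finset.eventually_all]
      intro ρ hρ
      obtain ⟨⟨_, _, h1⟩, _, _⟩ := (Set.Finite.mem_toFinset _).1 hρ
      have h0 : 0 < (ρ.re - 1) ^ 2 + ρ.im ^ 2 := by nlinarith [sq_nonneg ρ.im]
      exact ((tendsto_pow_atTop two_ne_zero).atTop_mul_const h0).eventually_ge_atTop 1
    filter_upwards [hev, eventually_ge_atTop 2] with c hc hc2
    refine Finset.sum_congr rfl fun ρ hρ => ?_
    have hz := (Set.Finite.mem_toFinset _).1 hρ
    obtain ⟨n0, n1⟩ := ne_of_mem_zeros hz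
    rw [analyticOrderNatAt_zetaBlaschke n0 n1,
      (regGr_eq (p := (ρ.re, ρ.im)) hc2 hz.2.2.le (hc ρ hρ)).1, gr_eq n0 n1, hχ]
    simp only
    rw [cutR_eq_one (by linarith [hz.1.2.2])]
    ring
  have hfin : ∀ᶠ c : ℝ in atTop, (∫ p in R, logZB p * cutLap X T p) + J -
      2 * Real.pi * smoothZeroSum T = ∫ p, regKernel c (p - (1, 0)) * w p := by
    filter_upwards [hsum, eventually_ge_atTop 2] with c hc hc2
    have h := (green c hc2).2.2.2
    rw [hc] at h
    simp_rw [mul_sub] at h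
    rw [integral_sub iW (ik c)] at h
    have e : ∫ p, regKernel c (p - (1, 0)) * w p =
        ∫ p in R, logZB p * (regKernel c (p - (1, 0)) * χ p) := by
      rw [← integral_indicator mR]
      congr 1
      ext p
      rw [hw]
      by_cases hp : p ∈ R
      · rw [indicator_of_mem hp, indicator_of_mem hp]; ring
      · rw [indicator_of_notMem hp, indicator_of_notMem hp, mul_zero]
    rw [e]
    linarith
  have := tendsto_nhds_unique (t1.congr' (hfin.mono fun c hc => hc.symm)) tendsto_const_nhds
  linarith

theorem intervalIntegrable_integrand {T : ℝ} (hT : 3 ≤ T) :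
    IntervalIntegrable integrand volume (-T) T := by
  -- The identity at height T - 1 lives on [-T, T]; it requires T - 1 ≥ 2.
  have h := (logZB_identity (X := 2) (T := T - 1) le_rfl (by linarith)).2.1
  rw [sub_add_cancel] at h
  refine (h.mul_continuousOn (g := fun y => (1 / 4 + y ^ 2)⁻¹) ?_).congr fun y _ => ?_
  · refine ContinuousOn.inv₀ (by fun_prop) fun y _ => ?_
    positivity
  · simp only [logZB_half, integrand]
    exact (div_eq_mul_inv _ _).symm

end BalazardSaiasYor

namespace BalazardSaiasYor

/-! ### Bounds for the cutoff terms -/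

/-- |s|²/|s-1|² = 1 + (2x-1)/|s-1|², then log(1+v) ≤ v. -/
theorem gr_nonneg_le {x y d : ℝ} (hx : 1 / 2 ≤ x) (hd : 0 < d) (hq : d ≤ (x - 1) ^ 2 + y ^ 2) :
    0 ≤ gr (x, y) ∧ gr (x, y) ≤ x / d := by
  have hq0 : 0 < (x - 1) ^ 2 + y ^ 2 := hd.trans_le hq
  have e : gr (x, y) = Real.log ((x ^ 2 + y ^ 2) / ((x - 1) ^ 2 + y ^ 2)) / 2 := by
    rw [Real.log_div (by nlinarith) hq0.ne', gr]; ring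
  have e2 : (x ^ 2 + y ^ 2) / ((x - 1) ^ 2 + y ^ 2) = 1 + (2 * x - 1) / ((x - 1) ^ 2 + y ^ 2) := by
    field_simp; ring
  have h0 : 0 ≤ (2 * x - 1) / ((x - 1) ^ 2 + y ^ 2) := div_nonneg (by linarith) hq0.le
  rw [e, e2]
  refine ⟨div_nonneg (Real.log_nonneg (by linarith)) two_pos.le, ?_⟩
  have h1 := Real.log_le_sub_one_of_pos
    (show 0 < 1 + (2 * x - 1) / ((x - 1) ^ 2 + y ^ 2) by linarith)
  have h2 : (2 * x - 1) / ((x - 1) ^ 2 + y ^ 2) ≤ 2 * x / d :=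
    div_le_div₀ (by linarith) (by linarith) hd hq
  rw [mul_div_assoc] at h2
  linarith

theorem abs_gry_le {x y d : ℝ} (hx : 1 / 2 ≤ x) (hd : 0 < d) (hy : d ≤ y ^ 2) :
    |gry (x, y)| ≤ x / d := by
  have hA : 0 < x ^ 2 + y ^ 2 := by positivity
  have hB : 0 < (x - 1) ^ 2 + y ^ 2 := by nlinarith [sq_nonneg (x - 1)]
  have e : gry (x, y) = -((2 * x - 1) * y) / ((x ^ 2 + y ^ 2) * ((x - 1) ^ 2 + y ^ 2)) := by
    simp only [gry]; field_simp; ring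
  rw [e, abs_div, abs_neg, abs_mul, abs_of_nonneg (by linarith : 0 ≤ 2 * x - 1),
    abs_of_pos (mul_pos hA hB), div_le_div_iff₀ (mul_pos hA hB) hd]
  have h1 : (2 * x - 1) * |y| ≤ x * (x ^ 2 + y ^ 2) := by
    rw [← sq_abs y]
    nlinarith [mul_nonneg (by linarith : 0 ≤ x) (sq_nonneg (x - |y|)), abs_nonneg y,
      mul_nonneg (abs_nonneg y) (sq_nonneg (x - 1)), mul_nonneg (abs_nonneg y) (sq_nonneg x)]
  calc (2 * x - 1) * |y| * d ≤ x * (x ^ 2 + y ^ 2) * ((x - 1) ^ 2 + y ^ 2) := by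
        refine mul_le_mul h1 (by nlinarith [sq_nonneg (x - 1)]) hd.le (by positivity)
    _ = _ := by ring

theorem abs_grx_le {x y : ℝ} (hx : 2 ≤ x) : |grx (x, y)| ≤ 2 / x := by
  have h1 : x / (x ^ 2 + y ^ 2) ≤ 2 / x := by
    rw [div_le_div_iff₀ (by positivity) (by linarith)]; nlinarith [sq_nonneg y]
  have hB : 0 < (x - 1) ^ 2 + y ^ 2 := by nlinarith [sq_nonneg y]
  have h2 : (x - 1) / ((x - 1) ^ 2 + y ^ 2) ≤ 2 / x := by
    rw [div_le_div_iff₀ hB (by linarith)]; nlinarith [sq_nonneg y]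
  have h3 : 0 ≤ x / (x ^ 2 + y ^ 2) := by positivity
  have h4 : 0 ≤ (x - 1) / ((x - 1) ^ 2 + y ^ 2) := div_nonneg (by linarith) hB.le
  simp only [grx]
  rw [abs_le]
  constructor <;> linarith

theorem hasDerivAt_gr_snd {x y : ℝ} (h0 : x ^ 2 + y ^ 2 ≠ 0) (h1 : (x - 1) ^ 2 + y ^ 2 ≠ 0) :
    HasDerivAt (fun y => gr (x, y)) (gry (x, y)) y := by
  have d : ∀ a : ℝ, HasDerivAt (fun y : ℝ => a + y ^ 2) (2 * y) y := fun a => by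
    simpa using ((hasDerivAt_id' y).pow 2).const_add a
  refine ((((d _).log h0).div_const 2).fun_sub (((d _).log h1).div_const 2)).congr_deriv ?_
  simp only [gry]
  ring

theorem continuousOn_gr {s : Set (ℝ × ℝ)} (h0 : ∀ p ∈ s, p.1 ^ 2 + p.2 ^ 2 ≠ 0)
    (h1 : ∀ p ∈ s, (p.1 - 1) ^ 2 + p.2 ^ 2 ≠ 0) :
    ContinuousOn gr s ∧ ContinuousOn grx s ∧ ContinuousOn gry s := by
  have c0 : ContinuousOn (fun p : ℝ × ℝ => p.1 ^ 2 + p.2 ^ 2) s := by fun_prop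
  have c1 : ContinuousOn (fun p : ℝ × ℝ => (p.1 - 1) ^ 2 + p.2 ^ 2) s := by fun_prop
  refine ⟨((c0.log h0).div_const 2).sub ((c1.log h1).div_const 2), ?_, ?_⟩
  · exact (ContinuousOn.div (by fun_prop) c0 h0).sub (ContinuousOn.div (by fun_prop) c1 h1)
  · exact (ContinuousOn.div (by fun_prop) c0 h0).sub (ContinuousOn.div (by fun_prop) c1 h1)

/-! ### Splitting the cutoff error into horizontal strips and a right end -/

/-- The part of `cutLap` supported on the horizontal strips `T ≤ |y| ≤ T + 1`. -/
noncomputable def stripW (X T : ℝ) (p : ℝ × ℝ) : ℝ :=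
  cutR X p.1 * (2 * gry p * cut' T p.2 + gr p * cut'' T p.2)

/-- The part of `cutLap` supported on the vertical strip `X ≤ x ≤ X + 1`. -/
noncomputable def endW (X T : ℝ) (p : ℝ × ℝ) : ℝ :=
  cut T p.2 * (2 * grx p * cutR' X p.1 + gr p * cutR'' X p.1)

/-- Adding g undoes the factor (s-1)/s, hence removes the slowly decaying part of log|f|. -/
theorem logZB_add_gr {p : ℝ × ℝ} (h : 2 ≤ p.1) :
    logZB p + gr p = Real.log ‖riemannZeta (toC p)‖ := by
  have hs : 2 ≤ (toC p).re := h
  have h0 : toC p ≠ 0 := by intro e; rw [e] at hs; norm_num at hs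
  have h1 : toC p ≠ 1 := by intro e; rw [e] at hs; norm_num at hs
  have hz := (abs_log_norm_riemannZeta_le hs).2
  have h1' := sub_ne_zero.2 h1
  have e : gr p = Real.log ‖toC p / (1 - toC p)‖ := gr_eq h0 h1
  rw [e, logZB, zetaBlaschke_eq h1, norm_mul, norm_div, norm_div, norm_sub_rev 1,
    Real.log_mul (div_ne_zero (norm_ne_zero_iff.2 h1') (norm_ne_zero_iff.2 h0))
      (norm_ne_zero_iff.2 hz),
    Real.log_div (norm_ne_zero_iff.2 h1') (norm_ne_zero_iff.2 h0),
    Real.log_div (norm_ne_zero_iff.2 h0) (norm_ne_zero_iff.2 h1')]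
  ring

theorem abs_snd_mem_strip {T t y : ℝ} (ht : |t| = T + 1 / 2)
    (hy : y ∈ Icc (t - 1 / 2) (t + 1 / 2)) : T ≤ |y| ∧ |y| ≤ T + 1 := by
  have h1 := abs_sub_abs_le_abs_sub t y
  have h2 := abs_sub_abs_le_abs_sub y t
  have h3 : |y - t| ≤ 1 / 2 := abs_le.2 ⟨by linarith [hy.1], by linarith [hy.2]⟩
  have h4 : |t - y| ≤ 1 / 2 := by rwa [abs_sub_comm]
  constructor <;> linarith

/-- g(2 gy η' + g η'') = ∂y(g² η') for η = `cut T`, and η' vanishes at both edges |y| = T and |y| =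
T + 1. This cancellation permits replacing log|f| by log|f| + g. -/
theorem setIntegral_gr_mul_stripW {X T t : ℝ} (hX : 2 ≤ X) (hT : 2 ≤ T) (ht : |t| = T + 1 / 2) :
    ∫ p in Icc (1 / 2) (X + 1) ×ˢ Icc (t - 1 / 2) (t + 1 / 2), gr p * stripW X T p = 0 := by
  set Q := Icc (1 / 2) (X + 1) ×ˢ Icc (t - 1 / 2) (t + 1 / 2) with hQ
  have hy : ∀ p ∈ Q, 0 < p.2 ^ 2 := fun p hp => by
    have := (abs_snd_mem_strip ht hp.2).1
    rw [← sq_abs]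
    have : 0 < |p.2| := by linarith
    positivity
  have h0 : ∀ p ∈ Q, p.1 ^ 2 + p.2 ^ 2 ≠ 0 := fun p hp => by
    have := hy p hp; positivity
  have h1 : ∀ p ∈ Q, (p.1 - 1) ^ 2 + p.2 ^ 2 ≠ 0 := fun p hp => by
    have := hy p hp; positivity
  obtain ⟨c, -, cy⟩ := continuousOn_gr h0 h1
  have k0 := continuous_cutR X
  have k1 := continuous_cut' T
  have k2 := continuous_cut'' T
  have cW : ContinuousOn (fun p => gr p * stripW X T p) Q := by
    unfold stripW; fun_prop
  have end1 : cut' T (t - 1 / 2) = 0 ∧ cut' T (t + 1 / 2) = 0 := by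
    constructor <;> refine (cut_deriv_eq_zero ?_).1 <;>
      rcases abs_cases t with ⟨h, h'⟩ | ⟨h, h'⟩
    · left; rw [abs_le]; constructor <;> linarith
    · right; exact le_abs.2 (Or.inr (by linarith))
    · right; exact le_abs.2 (Or.inl (by linarith))
    · left; rw [abs_le]; constructor <;> linarith
  rw [setIntegral_rect_eq (by linarith) (by linarith)
    (cW.integrableOn_compact (isCompact_rect _ _ _ _))]
  have inner : ∀ x ∈ uIcc (1 / 2) (X + 1),
      ∫ y in (t - 1 / 2)..(t + 1 / 2), gr (x, y) * stripW X T (x, y) = 0 := by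
    intro x hx
    rw [uIcc_of_le (by linarith)] at hx
    have hu : uIcc (t - 1 / 2) (t + 1 / 2) = Icc (t - 1 / 2) (t + 1 / 2) :=
      uIcc_of_le (by linarith)
    have hd : ∀ y ∈ uIcc (t - 1 / 2) (t + 1 / 2),
        HasDerivAt (fun y => cutR X x * (gr (x, y) ^ 2 * cut' T y))
          (gr (x, y) * stripW X T (x, y)) y := fun y hy => by
      rw [hu] at hy
      have d := hasDerivAt_gr_snd (h0 (x, y) ⟨hx, hy⟩) (h1 (x, y) ⟨hx, hy⟩)
      refine (((d.fun_pow 2).fun_mul (hasDerivAt_cut' T y)).const_mul (cutR X x)).congr_deriv ?_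
      simp only [stripW]
      norm_num
      ring
    rw [intervalIntegral.integral_eq_sub_of_hasDerivAt hd, end1.1, end1.2]
    · ring
    · refine ContinuousOn.intervalIntegrable ?_
      rw [hu]
      exact cW.comp (f := fun y => (x, y)) (by fun_prop) fun y hy => ⟨hx, hy⟩
  rw [intervalIntegral.integral_congr (g := fun _ => 0) inner, intervalIntegral.integral_zero]

theorem integral_inv_sq {X : ℝ} (hX : 0 < X) {t : ℝ} :
    IntegrableOn (fun p : ℝ × ℝ => 200 / p.1 ^ 2)
      (Icc (1 / 2) (X + 1) ×ˢ Icc (t - 1 / 2) (t + 1 / 2)) ∧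
    ∫ p in Icc (1 / 2) (X + 1) ×ˢ Icc (t - 1 / 2) (t + 1 / 2), 200 / p.1 ^ 2 ≤ 400 := by
  have i : IntegrableOn (fun p : ℝ × ℝ => 200 / p.1 ^ 2)
      (Icc (1 / 2) (X + 1) ×ˢ Icc (t - 1 / 2) (t + 1 / 2)) := by
    refine ContinuousOn.integrableOn_compact (isCompact_rect _ _ _ _) ?_
    refine ContinuousOn.div (by fun_prop) (by fun_prop) fun p hp => ?_
    have : 0 < p.1 := by linarith [hp.1.1]
    positivity
  refine ⟨i, ?_⟩
  rw [setIntegral_rect_eq (by linarith) (by linarith) i]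
  have h0 : ∀ x ∈ uIcc (1 / 2) (X + 1), x ≠ 0 := fun x hx => by
    rw [uIcc_of_le (by linarith)] at hx
    linarith [hx.1]
  have hd : ∀ x ∈ uIcc (1 / 2) (X + 1),
      HasDerivAt (fun x => -200 * x⁻¹) (∫ _ in (t - 1 / 2)..(t + 1 / 2), 200 / x ^ 2) x := by
    intro x hx
    refine ((hasDerivAt_inv (h0 x hx)).const_mul (-200)).congr_deriv ?_
    rw [intervalIntegral.integral_const, smul_eq_mul]
    ring
  rw [intervalIntegral.integral_eq_sub_of_hasDerivAt hd]
  · have : 0 < (X + 1)⁻¹ := by positivity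
    norm_num
    linarith
  · simp only [intervalIntegral.integral_const, smul_eq_mul]
    refine ContinuousOn.intervalIntegrable ?_
    exact ContinuousOn.mul (by fun_prop)
      (ContinuousOn.div (by fun_prop) (by fun_prop) fun x hx => pow_ne_zero 2 (h0 x hx))

/-- The factor x comes from the growth of the strip weight. For x ≤ 2 there is only an integrable
bound; for x > 2 the function is log|ζ|, of size x^(-3). -/
theorem abs_logZB_add_gr_mul_le {T t : ℝ} (hT : 2 ≤ T) (ht : |t| = T + 1 / 2) {p : ℝ × ℝ}
    (hx : 1 / 2 ≤ p.1) (hy : p.2 ∈ Icc (t - 1 / 2) (t + 1 / 2)) :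
    |logZB p + gr p| * p.1 ≤
      (Icc (1 / 2) 2 ×ˢ Icc (t - 1 / 2) (t + 1 / 2)).indicator (fun p => 2 * |logZB p| + 1) p +
        200 / p.1 ^ 2 := by
  have hx0 : 0 < p.1 := by linarith
  by_cases h2 : p.1 ≤ 2
  · rw [indicator_of_mem (show p ∈ Icc (1 / 2) 2 ×ˢ Icc (t - 1 / 2) (t + 1 / 2) from ⟨⟨hx, h2⟩, hy⟩)]
    have hT2 := (abs_snd_mem_strip ht hy).1
    have hy4 : 4 ≤ (p.1 - 1) ^ 2 + p.2 ^ 2 := by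
      rw [← sq_abs p.2]; nlinarith [sq_nonneg (p.1 - 1)]
    obtain ⟨g0, g1⟩ := gr_nonneg_le hx four_pos hy4
    have h3 : |logZB p + gr p| ≤ |logZB p| + 1 / 2 := by
      refine (abs_add_le _ _).trans ?_
      rw [abs_of_nonneg (show 0 ≤ gr p from g0)]
      have : gr p ≤ p.1 / 4 := g1
      linarith
    have h4 : 0 < 200 / p.1 ^ 2 := by positivity
    have h5 : |logZB p + gr p| * p.1 ≤ (|logZB p| + 1 / 2) * 2 :=
      mul_le_mul h3 h2 hx0.le (by positivity)
    linarith
  · push Not at h2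
    rw [indicator_of_notMem (fun h => absurd h.1.2 (not_le.2 h2)), zero_add, logZB_add_gr h2.le]
    have := (abs_log_norm_riemannZeta_le (s := toC p) h2.le).1
    calc _ ≤ 200 / p.1 ^ 3 * p.1 := by gcongr; exact this
      _ = _ := by field_simp

theorem abs_stripW_le {X T t B : ℝ} (hT : 2 ≤ T) (ht : |t| = T + 1 / 2)
    (hB1 : ∀ T y, |cut' T y| ≤ B) (hB2 : ∀ T y, |cut'' T y| ≤ B) {p : ℝ × ℝ}
    (hx : 1 / 2 ≤ p.1) (hy : p.2 ∈ Icc (t - 1 / 2) (t + 1 / 2)) :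
    |stripW X T p| ≤ 3 * B / T ^ 2 * p.1 := by
  have hT2 := (abs_snd_mem_strip ht hy).1
  have hy2 : T ^ 2 ≤ p.2 ^ 2 := by rw [← sq_abs p.2]; gcongr
  have hT0 : 0 < T ^ 2 := by positivity
  have g : |gr p| ≤ p.1 / T ^ 2 := by
    obtain ⟨g0, g1⟩ := gr_nonneg_le (y := p.2) hx hT0 (by nlinarith [sq_nonneg (p.1 - 1)])
    rw [abs_of_nonneg (show 0 ≤ gr p from g0)]
    exact g1
  have gy : |gry p| ≤ p.1 / T ^ 2 := abs_gry_le hx hT0 hy2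
  have hB : 0 ≤ B := (abs_nonneg _).trans (hB1 0 0)
  have hp : 0 ≤ p.1 / T ^ 2 := by positivity
  rw [stripW, abs_mul]
  calc |cutR X p.1| * |2 * gry p * cut' T p.2 + gr p * cut'' T p.2|
      ≤ 1 * (2 * (p.1 / T ^ 2) * B + p.1 / T ^ 2 * B) := by
        refine mul_le_mul (abs_cutR_le _ _) ((abs_add_le _ _).trans ?_) (abs_nonneg _) one_pos.le
        rw [abs_mul, abs_mul, abs_mul, abs_two]
        gcongr
        · exact hB1 _ _
        · exact hB2 _ _
    _ = _ := by ring

theorem exists_strip_bound : ∃ C : ℝ, 0 ≤ C ∧ ∀ X T t : ℝ, 2 ≤ X → 2 ≤ T → |t| = T + 1 / 2 →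
    IntegrableOn (fun p => logZB p * stripW X T p)
      (Icc (1 / 2) (X + 1) ×ˢ Icc (t - 1 / 2) (t + 1 / 2)) ∧
    |∫ p in Icc (1 / 2) (X + 1) ×ˢ Icc (t - 1 / 2) (t + 1 / 2), logZB p * stripW X T p| ≤
      C * (1 / T ^ 2 * Real.log T) := by
  obtain ⟨B, hB, hB1, hB2⟩ := exists_cut_bound
  obtain ⟨C, hC, hu⟩ := exists_setIntegral_abs_log_zetaBlaschke_le
  -- The areas give 3/2 from the box and 400 from ∫ 200/x²; 401.5 ≤ 803 log T as log T ≥ 1/2.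
  refine ⟨3 * B * (2 * C + 803), by positivity, fun X T t hX hT ht => ?_⟩
  set Q := Icc (1 / 2) (X + 1) ×ˢ Icc (t - 1 / 2) (t + 1 / 2) with hQ
  set A := Icc (1 / 2 : ℝ) 2 ×ˢ Icc (t - 1 / 2) (t + 1 / 2) with hA
  have KQ : IsCompact Q := isCompact_rect _ _ _ _
  have KA : IsCompact A := isCompact_rect _ _ _ _
  have hAQ : A ⊆ Q := prod_mono (Icc_subset_Icc_right (by linarith)) subset_rfl
  have hy : ∀ p ∈ Q, 0 < p.2 ^ 2 := fun p hp => by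
    have := (abs_snd_mem_strip ht hp.2).1
    rw [← sq_abs]
    have : 0 < |p.2| := by linarith
    positivity
  obtain ⟨c, -, cy⟩ := continuousOn_gr (s := Q) (fun p hp => by have := hy p hp; positivity)
    (fun p hp => by have := hy p hp; positivity)
  have k0 := continuous_cutR X
  have k1 := continuous_cut' T
  have k2 := continuous_cut'' T
  have cW : ContinuousOn (stripW X T) Q := by unfold stripW; fun_prop
  have iu : IntegrableOn logZB Q := by
    refine (logZB_identity hX hT).1.mono_set (prod_mono subset_rfl fun y hy => ?_)
    exact abs_le.1 (abs_snd_mem_strip ht hy).2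
  have i1 : IntegrableOn (fun p => logZB p * stripW X T p) Q := iu.mul_continuousOn cW KQ
  have i2 : IntegrableOn (fun p => gr p * stripW X T p) Q := (c.mul cW).integrableOn_compact KQ
  refine ⟨i1, ?_⟩
  have e : ∫ p in Q, logZB p * stripW X T p = ∫ p in Q, (logZB p + gr p) * stripW X T p := by
    simp only [add_mul]
    rw [integral_add i1 i2, setIntegral_gr_mul_stripW hX hT ht, add_zero]
  have iA : IntegrableOn (fun p => 2 * |logZB p| + 1) A := by
    refine ((iu.mono_set hAQ).abs.const_mul 2).add ?_
    exact continuousOn_const.integrableOn_compact KA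
  obtain ⟨i3, hi3⟩ := integral_inv_sq (X := X) (by linarith) (t := t)
  have i4 : IntegrableOn (A.indicator fun p => 2 * |logZB p| + 1) Q :=
    (iA.integrable_indicator KA.measurableSet).integrableOn
  have hL : 1 / 2 ≤ Real.log T := by
    have := Real.log_le_log two_pos hT
    linarith [Real.log_two_gt_d9]
  have b4 : ∫ p in Q, A.indicator (fun p => 2 * |logZB p| + 1) p ≤ 2 * (C * Real.log T) + 3 / 2 := by
    rw [setIntegral_indicator KA.measurableSet, inter_eq_self_of_subset_right hAQ]
    have ia : IntegrableOn (fun p => 2 * |logZB p|) A := (iu.mono_set hAQ).abs.const_mul 2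
    rw [integral_add ia (continuousOn_const.integrableOn_compact KA), integral_const_mul,
      setIntegral_const, volume_real_rect (by norm_num) (by linarith)]
    have := hu T t hT ht
    simp only [smul_eq_mul]
    unfold logZB
    linarith
  have hT0 : 0 < T ^ 2 := by positivity
  rw [e, ← Real.norm_eq_abs]
  calc ‖∫ p in Q, (logZB p + gr p) * stripW X T p‖
      ≤ ∫ p in Q, 3 * B / T ^ 2 *
          (A.indicator (fun p => 2 * |logZB p| + 1) p + 200 / p.1 ^ 2) := by
        refine norm_integral_le_of_norm_le ((i4.add i3).const_mul _) ?_
        refine (ae_restrict_iff' KQ.measurableSet).2 (Eventually.of_forall fun p hp => ?_)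
        rw [Real.norm_eq_abs, abs_mul]
        have h1 := abs_logZB_add_gr_mul_le hT ht hp.1.1 hp.2
        have h2 := abs_stripW_le (X := X) hT ht hB1 hB2 hp.1.1 hp.2
        calc |logZB p + gr p| * |stripW X T p|
            ≤ |logZB p + gr p| * (3 * B / T ^ 2 * p.1) := by gcongr
          _ = 3 * B / T ^ 2 * (|logZB p + gr p| * p.1) := by ring
          _ ≤ _ := by gcongr
    _ ≤ 3 * B / T ^ 2 * ((2 * C + 803) * Real.log T) := by
        rw [integral_const_mul, integral_add i4 i3]
        gcongr
        linarith
    _ = _ := by ring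

/-- Here |log|f|| ≤ 26 and the weight is at most 8B/X, on a strip of area 2(T+1). -/
theorem endW_bound {X T B : ℝ} (hX : 2 ≤ X) (hT : 2 ≤ T)
    (hB1 : ∀ x, |step' x| ≤ B) (hB2 : ∀ x, |step'' x| ≤ B) :
    IntegrableOn (fun p => logZB p * endW X T p) (Icc X (X + 1) ×ˢ Icc (-(T + 1)) (T + 1)) ∧
    |∫ p in Icc X (X + 1) ×ˢ Icc (-(T + 1)) (T + 1), logZB p * endW X T p| ≤
      416 * B * (T + 1) / X := by
  set R := Icc X (X + 1) ×ˢ Icc (-(T + 1)) (T + 1) with hR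
  have KR : IsCompact R := isCompact_rect _ _ _ _
  have hB : 0 ≤ B := (abs_nonneg _).trans (hB1 0)
  have h0 : ∀ p ∈ R, 0 < p.1 - 1 ∧ 0 < p.1 := fun p hp => by
    have := hp.1.1
    constructor <;> linarith
  obtain ⟨c, cx, -⟩ := continuousOn_gr (s := R) (fun p hp => by have := (h0 p hp).2; positivity)
    (fun p hp => by have := (h0 p hp).1; positivity)
  have k0 := continuous_cutR' X
  have k1 := continuous_cutR'' X
  have k2 := continuous_cut T
  have cW : ContinuousOn (endW X T) R := by unfold endW; fun_prop
  have iu : IntegrableOn logZB R :=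
    (logZB_identity hX hT).1.mono_set (prod_mono (Icc_subset_Icc_left (by linarith)) subset_rfl)
  refine ⟨iu.mul_continuousOn cW KR, ?_⟩
  have key : ∀ p ∈ R, ‖logZB p * endW X T p‖ ≤ 26 * (8 * B / X) := by
    intro p hp
    have hp2 : 2 ≤ p.1 := hX.trans hp.1.1
    have hgr : 0 ≤ gr p ∧ gr p ≤ p.1 / (p.1 ^ 2 / 4) := gr_nonneg_le (y := p.2) (by linarith)
      (by positivity) (by nlinarith [sq_nonneg p.2])
    have e1 : p.1 / (p.1 ^ 2 / 4) = 4 / p.1 := by field_simp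
    have h4 : 4 / p.1 ≤ 4 / X := div_le_div_of_nonneg_left (by norm_num) (by linarith) hp.1.1
    have h2 : 2 / p.1 ≤ 2 / X := div_le_div_of_nonneg_left (by norm_num) (by linarith) hp.1.1
    have hg : |gr p| ≤ 4 / X := by rw [abs_of_nonneg hgr.1]; linarith
    have hgx : |grx p| ≤ 2 / X := (abs_grx_le hp2).trans h2
    have hu : |logZB p| ≤ 26 := by
      refine abs_le.2 ⟨neg_le_log_norm_zetaBlaschke hp2, ?_⟩
      have h5 := (abs_log_norm_riemannZeta_le (s := toC p) hp2).1
      have h6 := logZB_add_gr hp2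
      have h7 : 200 / p.1 ^ 3 ≤ 26 := by
        rw [div_le_iff₀ (by positivity)]
        have : (2 : ℝ) ^ 3 ≤ p.1 ^ 3 := by gcongr
        linarith
      have h8 : Real.log ‖riemannZeta (toC p)‖ ≤ 200 / p.1 ^ 3 := (le_abs_self _).trans h5
      linarith [hgr.1]
    rw [norm_mul, Real.norm_eq_abs, Real.norm_eq_abs]
    refine mul_le_mul hu ?_ (abs_nonneg _) (by norm_num)
    rw [endW, abs_mul]
    calc |cut T p.2| * |2 * grx p * cutR' X p.1 + gr p * cutR'' X p.1|
        ≤ 1 * (2 * (2 / X) * B + 4 / X * B) := by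
          refine mul_le_mul ?_ ((abs_add_le _ _).trans ?_) (abs_nonneg _) one_pos.le
          · rw [abs_of_nonneg (cut_nonneg _ _)]; exact cut_le_one _ _
          · rw [abs_mul, abs_mul, abs_mul, abs_two]
            gcongr
            · rw [cutR', abs_neg]; exact hB1 _
            · exact hB2 _
      _ = _ := by ring
  have := norm_setIntegral_le_of_norm_le_const (μ := volume) KR.measure_lt_top key
  rw [volume_real_rect (by linarith) (by linarith), Real.norm_eq_abs] at this
  refine this.trans (le_of_eq ?_)
  ring

/-- The left side does not depend on X, so the right-end error O(T/X) disappears as X → ∞; the two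
strips give the factor 2. -/
theorem exists_smooth_bound : ∃ C : ℝ, 0 ≤ C ∧ ∀ T : ℝ, 2 ≤ T →
    |(∫ y in (-(T + 1))..(T + 1), logZB (1 / 2, y) * (cut T y / (1 / 4 + y ^ 2))) -
      2 * Real.pi * smoothZeroSum T| ≤ C * (1 / T ^ 2 * Real.log T) := by
  obtain ⟨B, hB, hB1, hB2⟩ := exists_step_bound
  obtain ⟨C, hC, hs⟩ := exists_strip_bound
  refine ⟨2 * C, by positivity, fun T hT => ?_⟩
  set D := (∫ y in (-(T + 1))..(T + 1), logZB (1 / 2, y) * (cut T y / (1 / 4 + y ^ 2))) -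
      2 * Real.pi * smoothZeroSum T with hD
  have key : ∀ X : ℝ, 2 ≤ X →
      |D| ≤ 2 * C * (1 / T ^ 2 * Real.log T) + 416 * B * (T + 1) / X := by
    intro X hX
    set R := Icc (1 / 2) (X + 1) ×ˢ Icc (-(T + 1)) (T + 1) with hR
    have mR : MeasurableSet R := (isCompact_rect _ _ _ _).measurableSet
    have t1 : |T + 1 / 2| = T + 1 / 2 := abs_of_pos (by linarith)
    have t2 : |-(T + 1 / 2)| = T + 1 / 2 := by rw [abs_neg, t1]
    obtain ⟨iP, bP⟩ := hs X T _ hX hT t1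
    obtain ⟨iN, bN⟩ := hs X T _ hX hT t2
    obtain ⟨iE, bE⟩ := endW_bound hX hT hB1 hB2
    set P := Icc (1 / 2) (X + 1) ×ˢ Icc (T + 1 / 2 - 1 / 2) (T + 1 / 2 + 1 / 2) with hP
    set N := Icc (1 / 2) (X + 1) ×ˢ Icc (-(T + 1 / 2) - 1 / 2) (-(T + 1 / 2) + 1 / 2) with hN
    set E := Icc X (X + 1) ×ˢ Icc (-(T + 1)) (T + 1) with hE
    have mN : MeasurableSet N := (isCompact_rect _ _ _ _).measurableSet
    have hPR : P ⊆ R := prod_mono subset_rfl (Icc_subset_Icc (by linarith) (by linarith))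
    have hNR : N ⊆ R := prod_mono subset_rfl (Icc_subset_Icc (by linarith) (by linarith))
    have hER : E ⊆ R := prod_mono (Icc_subset_Icc_left (by linarith)) subset_rfl
    have hdisj : Disjoint P N := by
      rw [Set.disjoint_left]
      intro p hp hn
      have := hp.2.1
      have := hn.2.2
      linarith
    have zS : ∀ p ∈ R \ (P ∪ N), logZB p * stripW X T p = 0 := by
      rintro p ⟨hp, hq⟩
      have : |p.2| ≤ T := by
        by_contra h
        rw [abs_le, not_and_or, not_le, not_le] at h
        refine hq ?_
        rcases h with h | h
        · exact Or.inr ⟨hp.1, by linarith [hp.2.1], by linarith⟩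
        · exact Or.inl ⟨hp.1, by linarith, by linarith [hp.2.2]⟩
      obtain ⟨z1, z2⟩ := cut_deriv_eq_zero (Or.inl this)
      rw [stripW, z1, z2]; ring
    have zE : ∀ p ∈ R \ E, logZB p * endW X T p = 0 := by
      rintro p ⟨hp, hq⟩
      have : p.1 ≤ X := by
        by_contra h
        exact hq ⟨⟨by linarith, hp.1.2⟩, hp.2⟩
      obtain ⟨z1, z2⟩ := cutR_deriv_eq_zero (Or.inl this)
      rw [endW, z1, z2]; ring
    have iS : IntegrableOn (fun p => logZB p * stripW X T p) R :=
      (iP.union iN).of_forall_sdiff_eq_zero mR zS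
    have iE' : IntegrableOn (fun p => logZB p * endW X T p) R :=
      iE.of_forall_sdiff_eq_zero mR zE
    have h1 := (logZB_identity hX hT).2.2
    have e : ∀ p, logZB p * cutLap X T p = logZB p * stripW X T p + logZB p * endW X T p :=
      fun p => mul_add _ _ _
    simp only [e] at h1
    rw [← hR, integral_add iS iE',
      setIntegral_eq_of_subset_of_forall_sdiff_eq_zero mR (union_subset hPR hNR) zS,
      setIntegral_union hdisj mN iP iN,
      setIntegral_eq_of_subset_of_forall_sdiff_eq_zero mR hER zE] at h1
    have hD' : D = -((∫ p in P, logZB p * stripW X T p) + (∫ p in N, logZB p * stripW X T p)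
        + ∫ p in E, logZB p * endW X T p) := by
      rw [hD, ← h1]; ring
    rw [hD', abs_neg]
    refine (abs_add_three _ _ _).trans ?_
    linarith
  have lim : Tendsto (fun X : ℝ => 2 * C * (1 / T ^ 2 * Real.log T) + 416 * B * (T + 1) / X)
      atTop (𝓝 (2 * C * (1 / T ^ 2 * Real.log T) + 0)) :=
    tendsto_const_nhds.add (tendsto_const_nhds.div_atTop tendsto_id)
  rw [add_zero] at lim
  exact ge_of_tendsto lim ((eventually_ge_atTop 2).mono key)

end BalazardSaiasYor

namespace BalazardSaiasYor

/-! ### Removing the smoothing -/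

/-- The zeros to the right of the critical line up to height `W`, weighted by `w γ`. -/
noncomputable def weightedZeroSum (W : ℝ) (w : ℝ → ℝ) : ℝ :=
  ∑ ρ ∈ (zerosRightOfLine_finite W).toFinset,
    (analyticOrderNatAt riemannZeta ρ : ℝ) * (w ρ.im * Real.log ‖ρ / (1 - ρ)‖)

theorem log_norm_div_nonneg {T : ℝ} {ρ : ℂ} (h : ρ ∈ zerosRightOfLine T) :
    0 ≤ Real.log ‖ρ / (1 - ρ)‖ := by
  obtain ⟨h0, h1⟩ := ne_of_mem_zeros h
  rw [← gr_eq h0 h1]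
  refine (gr_nonneg_le h.2.2.le ?_ le_rfl).1
  by_contra hc
  have e1 : ρ.re - 1 = 0 := by nlinarith [sq_nonneg (ρ.re - 1), sq_nonneg ρ.im]
  have e2 : ρ.im = 0 := by nlinarith [sq_nonneg (ρ.re - 1), sq_nonneg ρ.im]
  exact h1 (Complex.ext (by simpa [sub_eq_zero] using e1) (by simpa using e2))

/-- Each log|ρ/(1-ρ)| is nonnegative, since β > 1/2 puts ρ closer to 1 than to 0. -/
theorem weightedZeroSum_mono {W : ℝ} {v w : ℝ → ℝ} (h : ∀ y, v y ≤ w y) :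
    weightedZeroSum W v ≤ weightedZeroSum W w :=
  Finset.sum_le_sum fun _ hρ => mul_le_mul_of_nonneg_left
    (mul_le_mul_of_nonneg_right (h _) (log_norm_div_nonneg ((Set.Finite.mem_toFinset _).1 hρ)))
    (Nat.cast_nonneg _)

theorem weightedZeroSum_eq {S W : ℝ} (h : S ≤ W) {w : ℝ → ℝ} (hw : ∀ y, S < |y| → w y = 0) :
    weightedZeroSum W w = weightedZeroSum S w := by
  refine (Finset.sum_subset (fun ρ hρ => ?_) fun ρ hρ hn => ?_).symm
  · rw [Set.Finite.mem_toFinset] at hρ ⊢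
    exact ⟨hρ.1, ⟨by linarith [hρ.2.1.1], by linarith [hρ.2.1.2]⟩, hρ.2.2⟩
  · rw [Set.Finite.mem_toFinset] at hρ hn
    rw [hw, zero_mul, mul_zero]
    by_contra hc
    exact hn ⟨hρ.1, abs_le.1 (not_lt.1 hc), hρ.2.2⟩

theorem integral_cut_eq {S W : ℝ} (hS : 2 ≤ S) (h : S + 1 ≤ W) :
    ∫ y in (-(S + 1))..(S + 1), logZB (1 / 2, y) * (cut S y / (1 / 4 + y ^ 2)) =
      ∫ y in Icc (-W) W, integrand y * cut S y := by
  rw [intervalIntegral.integral_of_le (by linarith), ← integral_Icc_eq_integral_Ioc]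
  rw [setIntegral_eq_of_subset_of_forall_sdiff_eq_zero measurableSet_Icc
    (Icc_subset_Icc (by linarith) h : Icc (-(S + 1)) (S + 1) ⊆ Icc (-W) W)]
  · refine setIntegral_congr_fun measurableSet_Icc fun y _ => ?_
    simp only [logZB_half, integrand]
    ring
  · rintro y ⟨-, hy⟩
    rw [cut_eq_zero, mul_zero]
    by_contra hc
    exact hy (abs_le.1 (not_le.1 hc).le)

/-- Only an upper bound: log|ζ| has no pointwise lower bound near zeros. The constant uses (T-1)² ≥
(2T/3)² ≥ (3/7)T². -/
theorem integrand_le {T y : ℝ} (hT : 3 ≤ T) (h1 : T - 1 ≤ |y|) (h2 : |y| ≤ T + 2) :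
    integrand y ≤ 14 * (1 / T ^ 2 * Real.log T) := by
  have hu : logZB (1 / 2, y) ≤ 6 * Real.log T :=
    log_norm_zetaBlaschke_le (by linarith) (by norm_num [toC]) (by norm_num [toC])
      (by simp only [toC]; linarith)
  have hL : 0 ≤ Real.log T := Real.log_nonneg (by linarith)
  have hy : 6 / 14 * T ^ 2 ≤ 1 / 4 + y ^ 2 := by
    rw [← sq_abs y]
    nlinarith
  have hy0 : 0 < 1 / 4 + y ^ 2 := by positivity
  rw [integrand, ← logZB_half, div_le_iff₀ hy0]
  calc _ ≤ _ := hu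
    _ = 14 * (1 / T ^ 2 * Real.log T) * (6 / 14 * T ^ 2) := by field_simp
    _ ≤ _ := by gcongr

theorem integral_cut_sub_cut_le {T : ℝ} (hT : 3 ≤ T) :
    ∫ y in Icc (-(T + 2)) (T + 2), (cut (T + 1) y - cut (T - 1) y) ≤ 6 := by
  have i : ∀ S, IntegrableOn (cut S) (Icc (-(T + 2)) (T + 2)) := fun S =>
    (continuous_cut S).continuousOn.integrableOn_compact isCompact_Icc
  have i1 : ∀ a : ℝ, IntegrableOn (fun _ => (1 : ℝ)) (Icc (-a) a) := fun a =>
    continuousOn_const.integrableOn_compact isCompact_Icc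
  rw [integral_sub (i _) (i _)]
  have h1 : ∫ y in Icc (-(T + 2)) (T + 2), cut (T + 1) y ≤
      ∫ y in Icc (-(T + 2)) (T + 2), (1 : ℝ) :=
    setIntegral_mono (i _) (i1 _) fun y => cut_le_one _ _
  have h2 : ∫ y in Icc (-(T - 1)) (T - 1), (1 : ℝ) ≤
      ∫ y in Icc (-(T + 2)) (T + 2), cut (T - 1) y := by
    rw [setIntegral_congr_fun (g := cut (T - 1)) measurableSet_Icc
      fun y hy => (cut_eq_one (abs_le.2 hy)).symm]
    exact setIntegral_mono_set (i _) (Eventually.of_forall fun y => cut_nonneg _ _)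
      (Icc_subset_Icc (by linarith) (by linarith)).eventuallyLE
  rw [setIntegral_const, Real.volume_real_Icc_of_le (by linarith), smul_eq_mul] at h1 h2
  linarith

theorem cut_le_indicator {T : ℝ} (y : ℝ) : cut (T - 1) y ≤ (Icc (-T) T).indicator 1 y := by
  by_cases h : y ∈ Icc (-T) T
  · rw [indicator_of_mem h]; exact cut_le_one _ _
  · rw [indicator_of_notMem h, cut_eq_zero]
    by_contra hc
    exact h (abs_le.1 (by linarith))

theorem indicator_le_cut {T : ℝ} (y : ℝ) : (Icc (-T) T).indicator 1 y ≤ cut (T + 1) y := by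
  by_cases h : y ∈ Icc (-T) T
  · rw [indicator_of_mem h, cut_eq_one ((abs_le.2 h).trans (by linarith))]; rfl
  · rw [indicator_of_notMem h]; exact cut_nonneg _ _

/-- The smoothed estimate at heights T ± 1, on a common window and in terms of T. Since T ≥ 3,
1/(T-1)² ≤ 3/T² and log(T+1) ≤ 2 log T. -/
theorem exists_weighted_bound : ∃ C : ℝ, 0 ≤ C ∧ ∀ T : ℝ, 3 ≤ T → ∀ S, S = T - 1 ∨ S = T + 1 →
    |(∫ y in Icc (-(T + 2)) (T + 2), integrand y * cut S y) -
      2 * Real.pi * weightedZeroSum (T + 2) (cut S)| ≤ C * (1 / T ^ 2 * Real.log T) := by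
  obtain ⟨C, hC, h⟩ := exists_smooth_bound
  refine ⟨3 * C, by positivity, fun T hT S hS => ?_⟩
  have hS2 : 2 ≤ S := by rcases hS with rfl | rfl <;> linarith
  have hSW : S + 1 ≤ T + 2 := by rcases hS with rfl | rfl <;> linarith
  have hL : 0 ≤ Real.log T := Real.log_nonneg (by linarith)
  have e : smoothZeroSum S = weightedZeroSum (T + 2) (cut S) :=
    (weightedZeroSum_eq hSW fun y hy => cut_eq_zero hy.le).symm
  rw [← integral_cut_eq hS2 hSW, ← e]
  refine (h S hS2).trans ?_
  have key : 1 / S ^ 2 * Real.log S ≤ 3 * (1 / T ^ 2 * Real.log T) := by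
    rcases hS with rfl | rfl
    · have h1 : Real.log (T - 1) ≤ Real.log T := Real.log_le_log (by linarith) (by linarith)
      have h2 : 1 / (T - 1) ^ 2 ≤ 3 * (1 / T ^ 2) := by
        rw [mul_one_div, div_le_div_iff₀ (by nlinarith) (by positivity)]
        nlinarith
      have h3 : 0 ≤ Real.log (T - 1) := Real.log_nonneg (by linarith)
      calc _ ≤ 3 * (1 / T ^ 2) * Real.log T := mul_le_mul h2 h1 h3 (by positivity)
        _ = _ := by ring
    · have h1 : Real.log (T + 1) ≤ 2 * Real.log T := by
        rw [← Nat.cast_two, ← Real.log_pow]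
        exact Real.log_le_log (by linarith) (by nlinarith)
      have h2 : 1 / (T + 1) ^ 2 ≤ 1 / T ^ 2 :=
        one_div_le_one_div_of_le (by positivity) (by nlinarith)
      have h3 : 0 ≤ Real.log (T + 1) := Real.log_nonneg (by linarith)
      calc _ ≤ 1 / T ^ 2 * (2 * Real.log T) := mul_le_mul h2 h1 h3 (by positivity)
        _ ≤ _ := by
          have : 0 ≤ 1 / T ^ 2 * Real.log T := by positivity
          linarith
  calc C * (1 / S ^ 2 * Real.log S) ≤ C * (3 * (1 / T ^ 2 * Real.log T)) := by gcongr
    _ = _ := by ring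

theorem exists_bound_truncatedIntegral_sub : ∃ C : ℝ, ∀ T : ℝ, 3 ≤ T →
    |truncatedIntegral T - 2 * Real.pi * zeroSum T| ≤ C * (1 / T ^ 2 * Real.log T) := by
  obtain ⟨C, hC, h⟩ := exists_weighted_bound
  -- 2·14·6 + 14·6 = 252. One C is the smoothed error at T - 1; comparing integrals and comparing
  -- zero sums between T - 1 and T + 1 cost 2C each.
  refine ⟨5 * C + 252, fun T hT => ?_⟩
  have hm := h T hT _ (Or.inl rfl)
  have hp := h T hT _ (Or.inr rfl)
  set q := 1 / T ^ 2 * Real.log T with hq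
  have hq0 : 0 ≤ q := mul_nonneg (by positivity) (Real.log_nonneg (by linarith))
  set χ : ℝ → ℝ := (Icc (-T) T).indicator 1 with hχ
  set K := Icc (-(T + 2)) (T + 2) with hK
  have hχm : ∀ y, cut (T - 1) y ≤ χ y := cut_le_indicator
  have hχp : ∀ y, χ y ≤ cut (T + 1) y := indicator_le_cut
  have iK : IntegrableOn integrand K := by
    have := intervalIntegrable_integrand (T := T + 2) (by linarith)
    rwa [intervalIntegrable_iff_integrableOn_Icc_of_le (by linarith)] at this
  have ic : ∀ S, IntegrableOn (fun y => integrand y * cut S y) K := fun S =>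
    iK.mul_continuousOn (continuous_cut S).continuousOn isCompact_Icc
  have iη : IntegrableOn (fun y => cut (T + 1) y - cut (T - 1) y) K :=
    ((continuous_cut _).sub (continuous_cut _)).continuousOn.integrableOn_compact isCompact_Icc
  have eχ : (fun y => integrand y * χ y) = (Icc (-T) T).indicator integrand := by
    ext y
    by_cases hy : y ∈ Icc (-T) T
    · rw [hχ, indicator_of_mem hy, indicator_of_mem hy, Pi.one_apply, mul_one]
    · rw [hχ, indicator_of_notMem hy, indicator_of_notMem hy, mul_zero]
  have hTK : Icc (-T) T ⊆ K := Icc_subset_Icc (by linarith) (by linarith)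
  have iχ : IntegrableOn (fun y => integrand y * χ y) K := by
    rw [eχ]
    exact ((iK.mono_set hTK).integrable_indicator measurableSet_Icc).integrableOn
  have e1 : truncatedIntegral T = ∫ y in K, integrand y * χ y := by
    rw [eχ, setIntegral_indicator measurableSet_Icc, inter_eq_self_of_subset_right hTK,
      truncatedIntegral, intervalIntegral.integral_of_le (by linarith),
      integral_Icc_eq_integral_Ioc]
  have e2 : zeroSum T = weightedZeroSum (T + 2) χ := by
    rw [weightedZeroSum_eq (S := T) (w := χ) (by linarith) fun y hy =>
      indicator_of_notMem (fun hc : y ∈ Icc (-T) T => absurd (abs_le.2 hc) (not_le.2 hy)) _]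
    refine Finset.sum_congr rfl fun ρ hρ => ?_
    have hmem := ((Set.Finite.mem_toFinset _).1 hρ).2.1
    rw [hχ, indicator_of_mem (show ρ.im ∈ Icc (-T) T from hmem), Pi.one_apply, one_mul]
  have z1 := weightedZeroSum_mono (W := T + 2) hχm
  have z2 := weightedZeroSum_mono (W := T + 2) hχp
  have iM : IntegrableOn (fun y => 2 * (14 * q) * (cut (T + 1) y - cut (T - 1) y)) K :=
    iη.const_mul _
  have iD : IntegrableOn (fun y => integrand y * cut (T + 1) y - integrand y * cut (T - 1) y) K :=
    (ic _).sub (ic _)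
  have upper : ∀ y ∈ K, integrand y * (cut (T + 1) y - cut (T - 1) y) ≤
      14 * q * (cut (T + 1) y - cut (T - 1) y) := by
    intro y hy
    rcases le_total (T - 1) |y| with hy1 | hy1
    · exact mul_le_mul_of_nonneg_right (integrand_le hT hy1 (abs_le.2 hy))
        (sub_nonneg.2 ((hχm y).trans (hχp y)))
    · rw [cut_eq_one hy1, cut_eq_one (hy1.trans (by linarith)), sub_self, mul_zero, mul_zero]
  -- If v ≤ M with M ≥ 0 then |v| ≤ 2M - v. So the L¹ norm of the integrand in the transition zone
  -- is bounded by its signed integral, whose lower bound comes from the monotone zero sums.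
  have dom : ∀ y ∈ K, ‖integrand y * χ y - integrand y * cut (T - 1) y‖ ≤
      2 * (14 * q) * (cut (T + 1) y - cut (T - 1) y) -
        (integrand y * cut (T + 1) y - integrand y * cut (T - 1) y) := by
    intro y hy
    have hη : 0 ≤ cut (T + 1) y - cut (T - 1) y := sub_nonneg.2 ((hχm y).trans (hχp y))
    have h1 : |χ y - cut (T - 1) y| ≤ cut (T + 1) y - cut (T - 1) y := by
      rw [abs_of_nonneg (sub_nonneg.2 (hχm y))]
      linarith [hχp y]
    have h2 := upper y hy
    have h3 : 0 ≤ 14 * q * (cut (T + 1) y - cut (T - 1) y) := by positivity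
    rw [← mul_sub, norm_mul, Real.norm_eq_abs, Real.norm_eq_abs]
    refine (mul_le_mul_of_nonneg_left h1 (abs_nonneg _)).trans ?_
    rw [← abs_of_nonneg hη, ← abs_mul, abs_of_nonneg hη, abs_le]
    constructor <;> linarith
  have j1 : |(∫ y in K, integrand y * χ y) - ∫ y in K, integrand y * cut (T - 1) y| ≤
      2 * (14 * q) * 6 - ((∫ y in K, integrand y * cut (T + 1) y) -
        ∫ y in K, integrand y * cut (T - 1) y) := by
    rw [← integral_sub iχ (ic _), ← integral_sub (ic _) (ic _), ← Real.norm_eq_abs]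
    refine (norm_integral_le_of_norm_le (iM.sub iD)
      ((ae_restrict_iff' measurableSet_Icc).2 (Eventually.of_forall dom))).trans ?_
    simp only [Pi.sub_apply]
    rw [integral_sub iM iD, integral_const_mul]
    gcongr
    exact integral_cut_sub_cut_le hT
  have j2 : (∫ y in K, integrand y * cut (T + 1) y) - ∫ y in K, integrand y * cut (T - 1) y ≤
      14 * q * 6 := by
    rw [← integral_sub (ic _) (ic _)]
    simp only [← mul_sub]
    refine (setIntegral_mono_on ?_ (iη.const_mul _) measurableSet_Icc upper).trans ?_
    · exact iK.mul_continuousOn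
        ((continuous_cut _).sub (continuous_cut _)).continuousOn isCompact_Icc
    · rw [integral_const_mul]
      gcongr
      exact integral_cut_sub_cut_le hT
  rw [e1, e2]
  have p1 : 2 * Real.pi * weightedZeroSum (T + 2) (cut (T - 1)) ≤
      2 * Real.pi * weightedZeroSum (T + 2) χ := by gcongr
  have p2 : 2 * Real.pi * weightedZeroSum (T + 2) χ ≤
      2 * Real.pi * weightedZeroSum (T + 2) (cut (T + 1)) := by gcongr
  rw [abs_le] at hm hp j1 ⊢
  constructor <;> linarith

end BalazardSaiasYor

theorem theorem2 :
    (∀ T : ℝ, 3 ≤ T →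
      IntervalIntegrable BalazardSaiasYor.integrand MeasureTheory.volume (-T) T) ∧
    ∃ C : ℝ, ∀ T : ℝ, 3 ≤ T →
      |BalazardSaiasYor.truncatedIntegral T - 2 * Real.pi * BalazardSaiasYor.zeroSum T| ≤
        C * (1 / T ^ 2 * Real.log T) :=
  ⟨fun _ => BalazardSaiasYor.intervalIntegrable_integrand,
    BalazardSaiasYor.exists_bound_truncatedIntegral_sub⟩
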